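/- **Noiseless model.** A noiseless protocol $\Pi$ of length $N$ ($N$ even) acts on registers $A,B$ of arbitrary finite numbers of qubits and a single-qubit communication register $C$. It is given by unitaries $U_1,\dots,U_{N+1}$, where $U_i$ acts on $AC$ (Alice) for $i$ odd and on $BC$ (Bob) for $i$ even. It induces the channel $\Pi(\sigma)=\mathrm{Tr}_E\big(U_{N+1}\cdots U_1\,\sigma\,U_1^\dagger\cdots U_{N+1}^\dagger\big)$ from $ABCE$ to $ABC$, with $E$ an arbitrary finite-dimensional reference register. **Shared entanglement model.** A universal simulator $S$ of length $N'$ ($N'$ even) with alphabet size $q$ starts from an arbitrary finite-dimensional shared pure state $|\phi\rangle^{T_AT_B}$. Alice and Bob act in alternation, in $N'+1$ turns, the first and the last by Alice, and after each of the first $N'$ turns a classical $q$-ary symbol is sent to the other party through the noisy classical channel. A turn of a party is a finite sequence of fixed quantum instruments on that party's classical register, communication symbol, scratch and entanglement registers and local copy of $C$, and of classically controlled black-box calls to that party's own unitaries of $\Pi$ or their inverses. The black box is the embedded protocol, in which $U_N$ is followed by swapping $B$ with a dummy register $\tilde B$, $U_{N+1}$ is followed by swapping $AC$ with dummy registers $\tilde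 A\tilde C$, and $U_j=I$ for $j>N+1$. Only the black box touches $A,B,\tilde A,\tilde B$; the simulator itself does not depend on $\Pi$. The output is the content of $\tilde A\tilde B\tilde C$, and $S^\Pi$ is the induced channel from $ABCE$ to $ABC$. The rates are $$R_C=\frac{N}{N'\log_2 q},\qquad R_E=\frac{\log_2\min(\dim T_A,\dim T_B)}{N'\log_2 q}.$$ $S$ succeeds with error $\epsilon$ at simulating all noiseless protocols of length $N$ over a classical channel if $\|\Pi-S^\Pi\|_\diamond\le\epsilon$ for all such $\Pi$ (all sizes of $A,B,E$) when every transmission goes through an independent use of that channel. Here $\|\cdot\|_\diamond$ is the diamond norm defined with the unnormalised trace norm. **Theorem.** There exist constants $c,l_r>0$ such that for every binary symmetric channel $\mathcal M$ (any crossover probability $p\in[0,1]$) of Shannon capacity $C>0$ and every even $N\ge 2$, there exists a universal simulator $S$ in the shared entanglement model with transmission alphabet of size $2$, communication rate $R_C\ge l_r C$ (that is, length $N'\le \frac{1}{l_r C}N=O(N/C)$) and entanglement consumption rate $R_E\le 1$, which succeeds with error $2^{-cN}$ at simulating all noiseless protocols of length $N$ over $\mathcal M$. -/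

import Mathlib

open scoped ComplexOrder ENNReal Matrix

noncomputable section

namespace QSim

/-! ### Matrices, trace norm, diamond norm -/

/-- The operator `K` on a subsystem `W`, acting as the identity on the rest `R`, as an operator on
the composite system whose basis `G` is split into the two parts by the projections `w`, `r`. -/
def actOn {G W R : Type} [DecidableEq R] (w : G → W) (r : G → R) (K : Matrix W W ℂ) :
    Matrix G G ℂ :=
  Matrix.of fun g h => if r g = r h then K (w g) (w h) else 0

/-- The permutation operator sending the basis vector `h` to the basis vector `f h`. -/
def basisMap {G : Type} [DecidableEq G] (f : G → G) : Matrix G G ℂ :=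
  Matrix.of fun g h => if g = f h then 1 else 0

/-- The conjugation `ρ ↦ K ρ Kᴴ`. -/
def conj {G H : Type} [Fintype G] [Fintype H] (K : Matrix H G ℂ) :
    Matrix G G ℂ →ₗ[ℂ] Matrix H H ℂ where
  toFun ρ := K * ρ * Kᴴ
  map_add' ρ σ := by rw [Matrix.mul_add, Matrix.add_mul]
  map_smul' c ρ := by simp

/-- The partial trace over `R` of an operator on the system with basis `G`, where `G` is split
by the projections `out` (the part that is kept) and `r` (the part that is traced out). -/
def partialTrace {G O R : Type} [Fintype G] [DecidableEq O] [DecidableEq R]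
    (out : G → O) (r : G → R) : Matrix G G ℂ →ₗ[ℂ] Matrix O O ℂ where
  toFun ρ := Matrix.of fun o o' =>
    ∑ g, ∑ h, if out g = o ∧ out h = o' ∧ r g = r h then ρ g h else 0
  map_add' ρ σ := by
    ext o o'
    simp only [Matrix.of_apply, Matrix.add_apply, ← Finset.sum_add_distrib]
    refine Finset.sum_congr rfl fun g _ => Finset.sum_congr rfl fun h _ => ?_
    split_ifs <;> simp
  map_smul' c ρ := by
    ext o o'
    simp only [Matrix.of_apply, Matrix.smul_apply, Finset.smul_sum, RingHom.id_apply]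
    refine Finset.sum_congr rfl fun g _ => Finset.sum_congr rfl fun h _ => ?_
    split_ifs <;> simp

/-- The trace norm `‖O‖₁ = Tr (Oᴴ O)^{1/2}`, i.e. the sum of the square roots of the eigenvalues of
`Oᴴ O`. -/
def traceNorm {H : Type} [Fintype H] [DecidableEq H] (O : Matrix H H ℂ) : ℝ :=
  ∑ i, √((Matrix.isHermitian_conjTranspose_mul_self O).eigenvalues i)

/-- Density operators. -/
def IsDensity {H : Type} [Fintype H] (σ : Matrix H H ℂ) : Prop :=
  σ.PosSemidef ∧ σ.trace = 1

/-- `Φ ⊗ id_R`. -/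
def tensorId {I O : Type} (R : Type) (Φ : Matrix I I ℂ →ₗ[ℂ] Matrix O O ℂ)
    (σ : Matrix (I × R) (I × R) ℂ) : Matrix (O × R) (O × R) ℂ :=
  Matrix.of fun u v => Φ (Matrix.of fun i j => σ (i, u.2) (j, v.2)) u.1 v.1

/-- The diamond norm `max {‖(Φ ⊗ id_R) σ‖₁ : σ a density operator}`, with a reference system `R`
of the same dimension as the input system.  (The trace norm is unnormalised: two perfectly
distinguishable channels are at distance `2`.) -/
def diamondNorm {I O : Type} [Fintype I] [DecidableEq I] [Fintype O] [DecidableEq O]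
    (Φ : Matrix I I ℂ →ₗ[ℂ] Matrix O O ℂ) : ℝ≥0∞ :=
  ⨆ (σ : Matrix (I × I) (I × I) ℂ) (_ : IsDensity σ),
    ENNReal.ofReal (traceNorm (tensorId I Φ σ))

/-! ### Classical channels -/

/-- Shannon entropy in bits. -/
def entropy {α : Type} [Fintype α] (P : α → ℝ) : ℝ :=
  (∑ a, Real.negMulLog (P a)) / Real.log 2

/-- Mutual information `H(output) - H(output | input)`, in bits, of the classical channel with
transition probabilities `W a b` for the input distribution `P`. -/
def mutualInfo {α β : Type} [Fintype α] [Fintype β] (W : α → β → ℝ) (P : α → ℝ) : ℝ :=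
  entropy (fun b => ∑ a, P a * W a b) - ∑ a, P a * entropy (W a)

/-- Capacity of a discrete memoryless channel. -/
def capacity {α β : Type} [Fintype α] [Fintype β] (W : α → β → ℝ) : ℝ :=
  sSup (mutualInfo W '' stdSimplex ℝ α)

/-- The binary symmetric channel with crossover probability `p`. -/
def bsc (p : ℝ) (a b : Fin 2) : ℝ := if a = b then 1 - p else p

/-! ### Noiseless protocols -/

/-- Computational basis of `m` qubits. -/
abbrev Qubits (m : ℕ) : Type := Fin m → Fin 2

/-- Computational basis of the registers `A`, `B`, `C`, where `C` is a single qubit. -/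
abbrev ABC (mA mB : ℕ) : Type := Qubits mA × Qubits mB × Fin 2

/-- A noiseless protocol of length `N`: unitaries `U_1, …, U_{N+1}`, where `U_i` is `UA i`, acting
on `A C`, for `i` odd, and `UB i`, acting on `B C`, for `i` even.  The other values of `UA` and `UB`
play no role. -/
structure NoiselessProtocol (N mA mB : ℕ) where
  UA : ℕ → Matrix.unitaryGroup (Qubits mA × Fin 2) ℂ
  UB : ℕ → Matrix.unitaryGroup (Qubits mB × Fin 2) ℂ

namespace NoiselessProtocol

variable {N mA mB : ℕ} (Q : NoiselessProtocol N mA mB)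

/-- `U_i` as an operator on `A B C`. -/
def unitaryABC (i : ℕ) : Matrix (ABC mA mB) (ABC mA mB) ℂ :=
  if Odd i then actOn (fun g => (g.1, g.2.2)) (fun g => g.2.1) (Q.UA i).1
  else actOn (fun g => (g.2.1, g.2.2)) (fun g => g.1) (Q.UB i).1

/-- `U_k ⋯ U_1` on `A B C`. -/
def evolve : ℕ → Matrix (ABC mA mB) (ABC mA mB) ℂ
  | 0 => 1
  | k + 1 => Q.unitaryABC (k + 1) * evolve k

/-- The channel from `A B C E` to `A B C` induced by the protocol: apply `U_{N+1} ⋯ U_1`, then trace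
out the reference register `E`, of dimension `dE`. -/
def channel (dE : ℕ) : Matrix (ABC mA mB × Fin dE) (ABC mA mB × Fin dE) ℂ →ₗ[ℂ]
    Matrix (ABC mA mB) (ABC mA mB) ℂ :=
  partialTrace Prod.fst Prod.snd ∘ₗ conj (actOn Prod.fst Prod.snd (Q.evolve (N + 1)))

end NoiselessProtocol

/-! ### Simulation protocols in the shared entanglement model -/

/-- A quantum instrument in Kraus form: on classical value `z` and quantum state `ρ` it produces
the classical value `z'` with the (unnormalised) state `∑ₖ (op z z' k) ρ (op z z' k)ᴴ`. -/
structure Instrument (Z H : Type) [Fintype Z] [Fintype H] [DecidableEq H] where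
  card : ℕ
  op : Z → Z → Fin card → Matrix H H ℂ
  complete : ∀ z, ∑ z', ∑ k, (op z z' k)ᴴ * op z z' k = 1

/-- One step of a party with classical register `X`, classical communication register of size `q`
and quantum registers `H` at her free disposal: either a quantum instrument on `X`, the
communication register and `H`, or a call to the black box, controlled by the content of `X`:
nothing for `none`, the `j`-th unitary for `some (j, false)`, its inverse for `some (j, true)`. -/
inductive Step (X : Type) (q : ℕ) (H : Type) [Fintype X] [Fintype H] [DecidableEq H]
  | apply (I : Instrument (X × Fin q) H)
  | query (f : X → Option (ℕ × Bool))

/-- A simulation protocol in the shared entanglement model with communication alphabet of size `q`.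
It does not refer to the protocol to be simulated. -/
structure Simulator (q : ℕ) where
  /-- the number of transmissions; Alice holds the communication register at the end -/
  length : ℕ
  length_even : Even length
  /-- classical registers of Alice and Bob -/
  X : Type
  Y : Type
  /-- quantum scratch registers of Alice and Bob -/
  SA : Type
  SB : Type
  /-- entanglement registers of Alice and Bob -/
  TA : Type
  TB : Type
  [fX : Fintype X] [fY : Fintype Y] [fSA : Fintype SA] [fSB : Fintype SB]
  [fTA : Fintype TA] [fTB : Fintype TB]
  [dX : DecidableEq X] [dY : DecidableEq Y] [dSA : DecidableEq SA] [dSB : DecidableEq SB]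
  [dTA : DecidableEq TA] [dTB : DecidableEq TB]
  /-- initial content of the local registers -/
  x₀ : X
  y₀ : Y
  sA₀ : SA
  sB₀ : SB
  /-- the shared entangled state -/
  φ : TA × TB → ℂ
  φ_unit : ∑ t, ‖φ t‖ ^ 2 = 1
  /-- Alice's operation in turn `i`, used for `i` odd, `i ≤ length + 1`.  Her free quantum registers
  are `C_A`, its safe copy, the scratch register and the entanglement register. -/
  alice : ℕ → List (Step X q (Fin 2 × Fin 2 × SA × TA))
  /-- Bob's operation in turn `i`, used for `i` even, `i ≤ length`.  His free quantum registers are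
  `C_B`, the scratch register and the entanglement register. -/
  bob : ℕ → List (Step Y q (Fin 2 × SB × TB))

attribute [instance] Simulator.fX Simulator.fY Simulator.fSA Simulator.fSB Simulator.fTA
  Simulator.fTB Simulator.dX Simulator.dY Simulator.dSA Simulator.dSB Simulator.dTA Simulator.dTB

/-- Computational basis of Alice's quantum registers during a simulation: `A` and `C_A`, their dummy
copies `A'` and `C'`, into which the black box stores the final state, the scratch register and
the entanglement register. -/
structure RegA (m : ℕ) (SA TA : Type) where
  a : Qubits m
  c : Fin 2
  a' : Qubits m
  c' : Fin 2
  s : SA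
  t : TA
  deriving DecidableEq, Fintype

/-- Computational basis of Bob's quantum registers during a simulation: `B` and `C_B`, the dummy
copy `B'` of `B`, the scratch register and the entanglement register. -/
structure RegB (m : ℕ) (SB TB : Type) where
  b : Qubits m
  c : Fin 2
  b' : Qubits m
  s : SB
  t : TB
  deriving DecidableEq, Fintype

namespace Simulator

variable {q : ℕ} (S : Simulator q)

/-- Computational basis of all quantum registers: Alice's, Bob's, and the reference register. -/
abbrev Reg (mA mB dE : ℕ) : Type := RegA mA S.SA S.TA × RegB mB S.SB S.TB × Fin dE

/-- Values of the classical registers: Alice's, Bob's, and the communication register. -/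
abbrev Cl : Type := S.X × S.Y × Fin q

/-- Classical-quantum states: `ρ z` is the unnormalised state of the quantum registers
conditioned on the value `z` of the classical registers. -/
abbrev CQ (mA mB dE : ℕ) : Type := S.Cl → Matrix (S.Reg mA mB dE) (S.Reg mA mB dE) ℂ

variable {N mA mB dE : ℕ}

/-- The map on classical-quantum states with Kraus operators `F z z' k`. -/
def krausMap {n : ℕ}
    (F : S.Cl → S.Cl → Fin n → Matrix (S.Reg mA mB dE) (S.Reg mA mB dE) ℂ) :
    S.CQ mA mB dE →ₗ[ℂ] S.CQ mA mB dE :=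
  LinearMap.pi fun z' => ∑ z, ∑ k, conj (F z z' k) ∘ₗ LinearMap.proj z

/-- Exchange of `A C_A` with `A' C'`. -/
def swapA : S.Reg mA mB dE → S.Reg mA mB dE
  | (x, y, e) => ({ x with a := x.a', c := x.c', a' := x.a, c' := x.c }, y, e)

/-- Exchange of `B` with `B'`. -/
def swapB : S.Reg mA mB dE → S.Reg mA mB dE
  | (x, y, e) => (x, { y with b := y.b', b' := y.b }, e)

/-- Alice's unitary `U_j` acting on `A C_A`. -/
def unitaryA (Q : NoiselessProtocol N mA mB) (j : ℕ) :
    Matrix (S.Reg mA mB dE) (S.Reg mA mB dE) ℂ :=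
  actOn (fun (x, _, _) => (x.a, x.c)) (fun (x, y, e) => ((x.a', x.c', x.s, x.t), y, e)) (Q.UA j).1

/-- Bob's unitary `U_j` acting on `B C_B`. -/
def unitaryB (Q : NoiselessProtocol N mA mB) (j : ℕ) :
    Matrix (S.Reg mA mB dE) (S.Reg mA mB dE) ℂ :=
  actOn (fun (_, y, _) => (y.b, y.c)) (fun (x, y, e) => (x, (y.b', y.s, y.t), e)) (Q.UB j).1

/-- Alice's black box: her unitaries in the embedded noiseless protocol, in which `U_{N+1}` is
followed by the exchange of `A C_A` with `A' C'`, and `U_j` is the identity for `j > N + 1`. -/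
def boxA (Q : NoiselessProtocol N mA mB) (j : ℕ) : Matrix (S.Reg mA mB dE) (S.Reg mA mB dE) ℂ :=
  if j = N + 1 then basisMap S.swapA * S.unitaryA Q j
  else if Odd j ∧ j ≤ N then S.unitaryA Q j
  else 1

/-- Bob's black box: his unitaries in the embedded noiseless protocol, in which `U_N` is
followed by the exchange of `B` with `B'`, and `U_j` is the identity for `j > N + 1`. -/
def boxB (Q : NoiselessProtocol N mA mB) (j : ℕ) : Matrix (S.Reg mA mB dE) (S.Reg mA mB dE) ℂ :=
  if j = N ∧ 0 < N then basisMap S.swapB * S.unitaryB Q j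
  else if Even j ∧ 0 < j ∧ j ≤ N then S.unitaryB Q j
  else 1

/-- The operator applied by a call to the black box. -/
def callBox {G : Type} [DecidableEq G] (box : ℕ → Matrix G G ℂ) :
    Option (ℕ × Bool) → Matrix G G ℂ
  | none => 1
  | some (j, false) => box j
  | some (j, true) => (box j)ᴴ

/-- A step of Alice. -/
def stepA (Q : NoiselessProtocol N mA mB) :
    Step S.X q (Fin 2 × Fin 2 × S.SA × S.TA) → (S.CQ mA mB dE →ₗ[ℂ] S.CQ mA mB dE)
  | .apply I => S.krausMap fun (x, y, u) (x', y', u') (k : Fin I.card) =>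
      if y = y' then
        actOn (fun (r, _, _) => (r.c, r.c', r.s, r.t)) (fun (r, t, e) => ((r.a, r.a'), t, e))
          (I.op (x, u) (x', u') k)
      else 0
  | .query f => S.krausMap fun z z' (_ : Fin 1) =>
      if z = z' then callBox (S.boxA Q) (f z.1) else 0

/-- A step of Bob. -/
def stepB (Q : NoiselessProtocol N mA mB) :
    Step S.Y q (Fin 2 × S.SB × S.TB) → (S.CQ mA mB dE →ₗ[ℂ] S.CQ mA mB dE)
  | .apply I => S.krausMap fun (x, y, u) (x', y', u') (k : Fin I.card) =>
      if x = x' then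
        actOn (fun (_, r, _) => (r.c, r.s, r.t)) (fun (t, r, e) => (t, (r.b, r.b'), e))
          (I.op (y, u) (y', u') k)
      else 0
  | .query f => S.krausMap fun z z' (_ : Fin 1) =>
      if z = z' then callBox (S.boxB Q) (f z.2.1) else 0

/-- The operation of turn `i`: Alice's for `i` odd, Bob's for `i` even. -/
def turn (Q : NoiselessProtocol N mA mB) (i : ℕ) : S.CQ mA mB dE →ₗ[ℂ] S.CQ mA mB dE :=
  if Odd i then (S.alice i).foldl (fun f s => S.stepA Q s ∘ₗ f) LinearMap.id
  else (S.bob i).foldl (fun f s => S.stepB Q s ∘ₗ f) LinearMap.id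

/-- One transmission of the communication register through the classical channel `W`. -/
def noise (W : Fin q → Fin q → ℝ) : S.CQ mA mB dE →ₗ[ℂ] S.CQ mA mB dE :=
  LinearMap.pi fun (x, y, u') => ∑ u, (W u u' : ℂ) • LinearMap.proj (x, y, u)

/-- The first `k + 1` turns, with a use of the channel `W` between any two consecutive ones. -/
def run (W : Fin q → Fin q → ℝ) (Q : NoiselessProtocol N mA mB) :
    ℕ → (S.CQ mA mB dE →ₗ[ℂ] S.CQ mA mB dE)
  | 0 => S.turn Q 1
  | k + 1 => S.turn Q (k + 2) ∘ₗ S.noise W ∘ₗ run W Q k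

/-- The isometry which places an input on `A B C E` into `A`, `B`, `C_A`, `E`, the entangled state
into the entanglement registers, and initialises all other quantum registers. -/
def prepare : Matrix (S.Reg mA mB dE) (ABC mA mB × Fin dE) ℂ :=
  Matrix.of fun (x, y, e) i =>
    if ((x.a, y.b, x.c), e) = i ∧ x.a' = 0 ∧ x.c' = 0 ∧ x.s = S.sA₀ ∧
      y.c = 0 ∧ y.b' = 0 ∧ y.s = S.sB₀
    then S.φ (x.t, y.t) else 0

/-- The initial classical-quantum state. -/
def initial [NeZero q] :
    Matrix (ABC mA mB × Fin dE) (ABC mA mB × Fin dE) ℂ →ₗ[ℂ] S.CQ mA mB dE :=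
  LinearMap.pi fun z => if z = (S.x₀, S.y₀, 0) then conj S.prepare else 0

set_option synthInstance.maxSize 512 in
/-- The output on the registers `A' B' C'`; everything else is discarded. -/
def output : S.CQ mA mB dE →ₗ[ℂ] Matrix (ABC mA mB) (ABC mA mB) ℂ :=
  ∑ z, partialTrace (fun (x, y, _) => (x.a', y.b', x.c'))
    (fun (x, y, e) => ((x.a, x.c, x.s, x.t), (y.b, y.c, y.s, y.t), e)) ∘ₗ LinearMap.proj z

/-- The channel from `A B C E` to `A B C` induced by the simulation of the protocol `Q`, when each
transmission goes through the memoryless classical channel `W`. -/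
def channel [NeZero q] (W : Fin q → Fin q → ℝ) (Q : NoiselessProtocol N mA mB) (dE : ℕ) :
    Matrix (ABC mA mB × Fin dE) (ABC mA mB × Fin dE) ℂ →ₗ[ℂ] Matrix (ABC mA mB) (ABC mA mB) ℂ :=
  S.output ∘ₗ S.run W Q S.length ∘ₗ S.initial

/-- `S` succeeds with error `ε` at simulating all noiseless protocols of length `N` over the
classical channel `W`. -/
def SucceedsOver [NeZero q] (W : Fin q → Fin q → ℝ) (N : ℕ) (ε : ℝ) : Prop :=
  ∀ (mA mB dE : ℕ) (Q : NoiselessProtocol N mA mB),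
    diamondNorm (Q.channel dE - S.channel W Q dE) ≤ ENNReal.ofReal ε

/-- Communication rate when simulating protocols of length `N`. -/
def commRate (N : ℕ) : ℝ := N / (S.length * Real.logb 2 q)

/-- Entanglement consumption rate. -/
def entRate : ℝ :=
  Real.logb 2 (min (Fintype.card S.TA) (Fintype.card S.TB) : ℕ) / (S.length * Real.logb 2 q)

end Simulator

end QSim

end

/-! The parties never wait for certainty. In each of `T = 4 (N + 1)` steps the owner takes over the
communication qubit, applies the Pauli correction and the black-box call that its current picture of
the history suggests, and immediately teleports the qubit to the other party. What it did and the
outcome of the teleportation form a letter of the fixed alphabet `Msg`, which it then sends,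
encoded, through the classical channel.

Whatever is chosen, the resulting state is, up to sign, a word in Pauli operators and black-box
calls applied to the input. This word is kept as a reduced stack (`mach`, `stackOp_machStep`), so a
wrong guess is never fatal: it puts an entry on the stack, or removes one, and both can be repaired
by later calls. A party that knows the history corrects the pending Pauli operator and then extends
a correct stack, or undoes the top entry if that entry is its own (`bestMove`). Two consecutive
informed steps gain at least one unit of progress, and each misinformed step costs at most three
units (`progress_mach`). After enough progress the result has been swapped into the dummy registers;
surplus calls are identities, and stray Pauli operators only hit a register that is traced out
(`Progress.exists_stackOp_eq`, `partialTrace_conj_coreState`).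

To be informed means to have decoded all earlier messages of the other party. These are encoded by a
tree code, the causal convolution with coefficients in a prime field chosen one after the other, in
which words differ in half of the places after they part (`exists_isTreeCode`). Nearest codeword
decoding then fails for at most four times as many prefixes as there are corrupted symbols
(`card_treeDecode_ne_le`). Each symbol travels in a repetition code of length `O(1 / (1 - 2p)^2)`,
which is `O(1 / C)` because `C ≤ (1 - 2p)^2 / log 2` (`exists_blockCode`, `capacity_bsc_le`), and is
corrupted with probability at most `4 ^ (-48)`. Hence `T / 48` or more corrupted symbols occur with
probability at most `2 ^ (-T)` (`prob_blockErrors_le`), and with fewer the progress `T / 2 - 3 * 4 *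
errors` exceeds `N + 1` (`progress_logAt`).

The outcomes of the teleportations are uniform whatever the state is, so the simulation is exactly a
mixture, over noise bits and outcomes, of channels (`channel_eq`). Outside the unlikely event these
agree with the given protocol, so the diamond distance is at most twice the probability of that
event (`diamondNorm_sub_sum_le`). -/

set_option linter.unusedSectionVars false

noncomputable section

namespace QSim

/-! ### Operators on subsystems -/

/-- The projections `w`, `r` split the basis `G` as a product; `put g a` replaces the `w`-part
of `g` by `a`. -/
structure Splits {G W R : Type} (w : G → W) (r : G → R) (put : G → W → G) : Prop where
  w_put : ∀ g a, w (put g a) = a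
  r_put : ∀ g a, r (put g a) = r g
  inj : ∀ g h, w g = w h → r g = r h → g = h

section actOn

variable {G W R J : Type} [Fintype G] [Fintype W] [DecidableEq R] {w : G → W} {r : G → R}
  {put : G → W → G}

/-- Row `g` of the operator is supported on the basis vectors that differ from `g` only in the
`w`-part, and these are parametrised by `W` through `put`. Almost all matrix computations below go
through this formula. -/
theorem Splits.actOn_mul_apply (h : Splits w r put) (K : Matrix W W ℂ) (M : Matrix G J ℂ)
    (g : G) (j : J) : (actOn w r K * M) g j = ∑ a, K (w g) a * M (put g a) j := by
  rw [Matrix.mul_apply]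
  symm
  refine Finset.sum_of_injOn (put g) ?_ (by simp) ?_ ?_
  · intro a _ b _ hab
    rw [← h.w_put g a, hab, h.w_put]
  · intro k _ hk
    rw [actOn, Matrix.of_apply, if_neg, zero_mul]
    intro hr
    refine hk ⟨w k, by simp, h.inj _ _ (h.w_put _ _) ((h.r_put _ _).trans hr)⟩
  · intro a _
    rw [actOn, Matrix.of_apply, if_pos (h.r_put g a).symm, h.w_put]

theorem Splits.actOn_mul (h : Splits w r put) (K L : Matrix W W ℂ) :
    actOn w r K * actOn w r L = actOn w r (K * L) := by
  ext g k
  rw [h.actOn_mul_apply]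
  simp only [actOn, Matrix.of_apply, h.r_put, h.w_put, Matrix.mul_apply]
  split_ifs <;> simp

theorem actOn_conjTranspose (K : Matrix W W ℂ) : (actOn w r K)ᴴ = actOn w r Kᴴ := by
  ext g k
  simp only [actOn, Matrix.conjTranspose_apply, Matrix.of_apply, eq_comm (a := r g)]
  split_ifs <;> simp

theorem Splits.actOn_one [DecidableEq G] [DecidableEq W] (h : Splits w r put) :
    actOn w r (1 : Matrix W W ℂ) = 1 := by
  ext g k
  simp only [actOn, Matrix.of_apply, Matrix.one_apply]
  by_cases hgk : g = k
  · simp [hgk]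
  · rw [if_neg hgk]
    split_ifs with h1 h2
    · exact absurd (h.inj _ _ h2 h1) hgk
    · rfl
    · rfl

theorem actOn_sum {ι : Type} (s : Finset ι) (K : ι → Matrix W W ℂ) :
    ∑ i ∈ s, actOn w r (K i) = actOn w r (∑ i ∈ s, K i) := by
  ext g k
  simp only [actOn, Matrix.sum_apply, Matrix.of_apply]
  split_ifs <;> simp

theorem Splits.actOn_mem_unitary [DecidableEq G] [DecidableEq W] (h : Splits w r put)
    {K : Matrix W W ℂ} (hK : K ∈ Matrix.unitaryGroup W ℂ) :
    actOn w r K ∈ Matrix.unitaryGroup G ℂ := by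
  rw [Matrix.mem_unitaryGroup_iff, Matrix.star_eq_conjTranspose] at hK ⊢
  rw [actOn_conjTranspose, h.actOn_mul, hK, h.actOn_one]

end actOn

section basisMap

variable {G J : Type} [Fintype G] [DecidableEq G] {f : G → G}

theorem basisMap_mul_apply (hf : Function.Involutive f) (M : Matrix G J ℂ) (g : G) (j : J) :
    (basisMap f * M) g j = M (f g) j := by
  rw [Matrix.mul_apply, Finset.sum_eq_single (f g)]
  · simp [basisMap, hf g]
  · intro k _ hk
    rw [basisMap, Matrix.of_apply, if_neg, zero_mul]
    rintro rfl
    exact hk (hf k).symm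
  · simp

theorem basisMap_mem_unitary (hf : Function.Involutive f) :
    (basisMap f : Matrix G G ℂ) ∈ Matrix.unitaryGroup G ℂ := by
  rw [Matrix.mem_unitaryGroup_iff, Matrix.star_eq_conjTranspose]
  ext g k
  rw [basisMap_mul_apply hf, Matrix.conjTranspose_apply, basisMap, Matrix.of_apply,
    Matrix.one_apply]
  by_cases h : g = k
  · simp [h, hf k]
  · rw [if_neg h, if_neg, star_zero]
    intro h'
    exact h (by rw [h', hf])

end basisMap

/-! ### The trace norm of a difference of positive operators -/

section traceNorm

open scoped MatrixOrder

variable {H : Type} [Fintype H] [DecidableEq H]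

/-- Write `A = Bᴴ B` and apply Bessel's inequality to each row of `B`. Only Bessel's inequality is
required of `w`, not orthonormality, because some of the vectors to which this is applied may
vanish. -/
theorem sum_dotProduct_mulVec_le {A : Matrix H H ℂ} (hA : A.PosSemidef) {ι : Type}
    [Fintype ι] (w : ι → EuclideanSpace ℂ H)
    (hw : ∀ u : EuclideanSpace ℂ H, ∑ i, ‖inner ℂ (w i) u‖ ^ 2 ≤ ‖u‖ ^ 2) :
    ∑ i, (star (w i).ofLp ⬝ᵥ A *ᵥ (w i).ofLp).re ≤ A.trace.re := by
  obtain ⟨B, hB⟩ := CStarAlgebra.nonneg_iff_eq_star_mul_self.mp hA.nonneg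
  rw [Matrix.star_eq_conjTranspose] at hB
  subst hB
  have key : ∀ x : EuclideanSpace ℂ H, (star x.ofLp ⬝ᵥ (Bᴴ * B) *ᵥ x.ofLp).re
      = ∑ k, ‖inner ℂ (WithLp.toLp 2 (fun h => star (B k h)) : EuclideanSpace ℂ H) x‖ ^ 2 := by
    intro x
    rw [← Matrix.mulVec_mulVec, Matrix.dotProduct_mulVec, ← Matrix.star_mulVec]
    simp only [dotProduct, Pi.star_apply, Complex.re_sum]
    refine Finset.sum_congr rfl fun k _ => ?_
    have : inner ℂ (WithLp.toLp 2 (fun h => star (B k h)) : EuclideanSpace ℂ H) x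
        = (B *ᵥ x.ofLp) k := by
      simp [PiLp.inner_apply, Matrix.mulVec, dotProduct, mul_comm]
    rw [this, ← Complex.normSq_eq_norm_sq, Complex.normSq_apply]
    simp
  simp only [key]
  rw [Finset.sum_comm]
  calc ∑ k, ∑ i, ‖inner ℂ (WithLp.toLp 2 (fun h => star (B k h)) : EuclideanSpace ℂ H) (w i)‖ ^ 2
      ≤ ∑ k, ‖(WithLp.toLp 2 (fun h => star (B k h)) : EuclideanSpace ℂ H)‖ ^ 2 := by
        refine Finset.sum_le_sum fun k _ => ?_
        refine le_trans (le_of_eq ?_) (hw _)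
        exact Finset.sum_congr rfl fun i _ => by rw [norm_inner_symm]
    _ = ((Bᴴ * B).trace).re := by
        rw [Matrix.trace, Complex.re_sum]
        simp only [EuclideanSpace.norm_sq_eq, Matrix.diag_apply, Matrix.mul_apply,
          Matrix.conjTranspose_apply, Complex.re_sum, norm_star]
        rw [Finset.sum_comm]
        refine Finset.sum_congr rfl fun k _ => Finset.sum_congr rfl fun h _ => ?_
        rw [← Complex.normSq_eq_norm_sq, Complex.normSq_apply]
        simp

/-- Positivity of the quadratic form at `x - s y`, where `s` is a sign. -/
theorem re_dotProduct_mulVec_le {A : Matrix H H ℂ} (hA : A.PosSemidef) (x y : H → ℂ) (s : ℝ)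
    (hs : s ^ 2 = 1) :
    s * (star x ⬝ᵥ A *ᵥ y).re ≤ ((star x ⬝ᵥ A *ᵥ x).re + (star y ⬝ᵥ A *ᵥ y).re) / 2 := by
  have h := hA.re_dotProduct_nonneg (x - (s : ℂ) • y)
  have hc : (star y ⬝ᵥ A *ᵥ x).re = (star x ⬝ᵥ A *ᵥ y).re := by
    have : star y ⬝ᵥ A *ᵥ x = star (star x ⬝ᵥ A *ᵥ y) := by
      rw [Matrix.star_dotProduct, Matrix.star_mulVec, hA.1.eq, ← Matrix.dotProduct_mulVec]
    rw [this]; simp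
  simp only [star_sub, star_smul, Matrix.mulVec_sub, Matrix.mulVec_smul, sub_dotProduct,
    dotProduct_sub, smul_dotProduct, dotProduct_smul, smul_eq_mul] at h
  simp only [Complex.star_def, Complex.conj_ofReal, map_sub, Complex.re_ofReal_mul,
    RCLike.re_to_complex, Complex.sub_re, hc] at h
  have h' : s * (s * (star y ⬝ᵥ A *ᵥ y).re) = (star y ⬝ᵥ A *ᵥ y).re := by
    rw [← mul_assoc, ← sq, hs, one_mul]
  rw [mul_sub, h'] at h
  linarith

/-- In a singular value decomposition of `O = A - B` each singular value is `⟨w i, A v i⟩ - ⟨w i, B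
v i⟩`. The two terms are bounded by averages of diagonal values of `A` and `B`, with opposite signs
`s`, and these sum to at most the traces. -/
theorem traceNorm_sub_le {A B : Matrix H H ℂ} (hA : A.PosSemidef) (hB : B.PosSemidef) :
    traceNorm (A - B) ≤ A.trace.re + B.trace.re := by
  set O := A - B with hO
  have hO' := Matrix.isHermitian_conjTranspose_mul_self O
  set v := hO'.eigenvectorBasis with hv
  set e := hO'.eigenvalues with he
  have hmul : ∀ i, (Oᴴ * O) *ᵥ (v i).ofLp = (e i : ℂ) • (v i).ofLp := fun i => by
    rw [hO'.mulVec_eigenvectorBasis i]; rfl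
  have he0 : ∀ i, 0 ≤ e i := (Matrix.posSemidef_conjTranspose_mul_self O).eigenvalues_nonneg
  have hin : ∀ i j, inner ℂ (WithLp.toLp 2 (O *ᵥ (v i).ofLp) : EuclideanSpace ℂ H)
      (WithLp.toLp 2 (O *ᵥ (v j).ofLp)) = (e j : ℂ) * inner ℂ (v i) (v j) := by
    intro i j
    rw [EuclideanSpace.inner_toLp_toLp, dotProduct_comm, Matrix.star_mulVec,
      ← Matrix.dotProduct_mulVec, Matrix.mulVec_mulVec, hmul, dotProduct_smul,
      dotProduct_comm]
    rfl
  -- The left singular vectors. For a zero singular value the convention `0⁻¹ = 0` makes the vector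
  -- vanish.
  set w : H → EuclideanSpace ℂ H := fun i =>
    ((√(e i) : ℂ))⁻¹ • WithLp.toLp 2 (O *ᵥ (v i).ofLp) with hw
  have hsq : ∀ i, ((√(e i) : ℝ) : ℂ) * (√(e i) : ℝ) = (e i : ℂ) := fun i => by
    rw [← Complex.ofReal_mul, Real.mul_self_sqrt (he0 i)]
  have hterm : ∀ i, √(e i) = (star (w i).ofLp ⬝ᵥ O *ᵥ (v i).ofLp).re := by
    intro i
    have h1 := hin i i
    rw [EuclideanSpace.inner_toLp_toLp, dotProduct_comm, inner_self_eq_norm_sq_to_K,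
      v.orthonormal.1 i] at h1
    have h2 : star (w i).ofLp ⬝ᵥ O *ᵥ (v i).ofLp = ((√(e i) : ℂ))⁻¹ * e i := by
      simp only [hw, WithLp.ofLp_smul, star_smul, smul_dotProduct, h1]
      simp
    rw [h2, ← hsq i]
    by_cases h0 : √(e i) = 0
    · simp [h0]
    · rw [inv_mul_cancel_left₀ (by exact_mod_cast h0)]
      simp
  have hbw : ∀ u : EuclideanSpace ℂ H, ∑ i, ‖inner ℂ (w i) u‖ ^ 2 ≤ ‖u‖ ^ 2 := by
    intro u
    have hON : Orthonormal ℂ (fun i : {i // e i ≠ 0} => w i) := by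
      rw [orthonormal_iff_ite]
      rintro ⟨i, hi⟩ ⟨j, hj⟩
      simp only [hw, inner_smul_left, inner_smul_right, hin, orthonormal_iff_ite.mp v.orthonormal,
        Subtype.mk.injEq]
      split_ifs with hij
      · subst hij
        have : ((√(e i) : ℝ) : ℂ) ≠ 0 := by
          exact_mod_cast Real.sqrt_ne_zero'.mpr (lt_of_le_of_ne (he0 i) (Ne.symm hi))
        rw [← hsq i]
        simp only [map_inv₀, Complex.conj_ofReal]
        field_simp
      · simp
    have hb := hON.sum_inner_products_le u (s := Finset.univ)
    refine le_trans (le_of_eq ?_) hb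
    rw [← Finset.sum_subtype (p := fun i => e i ≠ 0) (Finset.univ.filter fun i => e i ≠ 0) (by simp)
      (f := fun i => ‖inner ℂ (w i) u‖ ^ 2), Finset.sum_filter]
    refine Finset.sum_congr rfl fun i _ => ?_
    split_ifs with hi
    · rfl
    · simp only [hw, not_not.mp hi]
      simp
  have hbv : ∀ u : EuclideanSpace ℂ H, ∑ i, ‖inner ℂ (v i) u‖ ^ 2 ≤ ‖u‖ ^ 2 := fun u =>
    v.orthonormal.sum_inner_products_le u
  have hbound : ∀ i, √(e i) ≤
      ((star (w i).ofLp ⬝ᵥ A *ᵥ (w i).ofLp).re + (star (v i).ofLp ⬝ᵥ A *ᵥ (v i).ofLp).re) / 2 +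
      ((star (w i).ofLp ⬝ᵥ B *ᵥ (w i).ofLp).re + (star (v i).ofLp ⬝ᵥ B *ᵥ (v i).ofLp).re) / 2 := by
    intro i
    have h1 := re_dotProduct_mulVec_le hA (w i).ofLp (v i).ofLp 1 (by norm_num)
    have h2 := re_dotProduct_mulVec_le hB (w i).ofLp (v i).ofLp (-1) (by norm_num)
    rw [hterm i, hO, Matrix.sub_mulVec, dotProduct_sub, Complex.sub_re]
    linarith
  have hs := Finset.sum_le_sum fun i (_ : i ∈ Finset.univ) => hbound i
  simp only [Finset.sum_add_distrib, ← Finset.sum_div] at hs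
  have a1 := sum_dotProduct_mulVec_le hA w hbw
  have a2 := sum_dotProduct_mulVec_le hA v hbv
  have a3 := sum_dotProduct_mulVec_le hB w hbw
  have a4 := sum_dotProduct_mulVec_le hB v hbv
  rw [traceNorm]
  linarith

end traceNorm

/-! ### Maps in Kraus form -/

section Kraus

variable {G I O R : Type} [Fintype G] [Fintype I] [DecidableEq I] [Fintype O] [DecidableEq O]
  [Fintype R] [DecidableEq R]

/-- Trace preserving maps in Kraus form. -/
def IsKraus (Φ : Matrix I I ℂ →ₗ[ℂ] Matrix O O ℂ) : Prop :=
  ∃ (T : Type) (_ : Fintype T) (K : T → Matrix O I ℂ),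
    Φ = ∑ s, conj (K s) ∧ ∑ s, (K s)ᴴ * K s = 1

theorem conj_comp {G H J : Type} [Fintype G] [Fintype H] [Fintype J] (K : Matrix J H ℂ)
    (L : Matrix H G ℂ) : conj K ∘ₗ conj L = conj (K * L) := by
  ext1 ρ
  ext1
  simp [conj, Matrix.mul_assoc, Matrix.conjTranspose_mul]

theorem conj_smul {G H : Type} [Fintype G] [Fintype H] (c : ℂ) (K : Matrix H G ℂ) :
    conj (c • K) = (c * star c) • conj K := by
  ext1 ρ
  ext1
  simp [conj, smul_smul, mul_comm]

/-- The operator which projects the part `r` of the system to the basis vector `s` and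
removes it. -/
def sliceOp (out : G → O) (r : G → R) (s : R) : Matrix O G ℂ :=
  Matrix.of fun o g => if out g = o ∧ r g = s then 1 else 0

/-- `K ⊗ 1_R`. -/
def tensorOne (R : Type) [DecidableEq R] (K : Matrix O I ℂ) : Matrix (O × R) (I × R) ℂ :=
  Matrix.of fun u v => if u.2 = v.2 then K u.1 v.1 else 0

theorem partialTrace_eq_sum_conj (out : G → O) (r : G → R) :
    partialTrace out r = ∑ s, conj (sliceOp out r s) := by
  refine LinearMap.ext fun ρ => Matrix.ext fun o o' => ?_
  have : ∀ s, conj (sliceOp out r s) ρ o o'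
      = ∑ h, ∑ g, (if out g = o ∧ r g = s then (1 : ℂ) else 0) * ρ g h *
          (if out h = o' ∧ r h = s then (1 : ℂ) else 0) := by
    intro s
    simp only [sliceOp, conj, LinearMap.coe_mk, AddHom.coe_mk, Matrix.mul_apply, Matrix.of_apply,
      Matrix.conjTranspose_apply, Finset.sum_mul]
    refine Finset.sum_congr rfl fun h _ => Finset.sum_congr rfl fun g _ => ?_
    congr 1
    split_ifs <;> simp
  rw [LinearMap.sum_apply, Matrix.sum_apply]
  simp only [this]
  rw [Finset.sum_comm]
  simp only [partialTrace, LinearMap.coe_mk, AddHom.coe_mk, Matrix.of_apply]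
  rw [Finset.sum_comm]
  refine Finset.sum_congr rfl fun h _ => ?_
  rw [Finset.sum_comm]
  refine Finset.sum_congr rfl fun g _ => ?_
  rw [Finset.sum_eq_single (r g)]
  · by_cases h1 : out g = o <;> by_cases h2 : out h = o' <;> by_cases h3 : r g = r h <;>
      simp [h1, h2, h3, eq_comm (a := r h)]
  · intro s _ hs
    rw [if_neg (fun h => hs h.2.symm)]
    simp
  · simp

/-- The slices at the values of `r` form a complete set of Kraus operators as soon as `out` and `r`
together separate the basis; not every pair of values has to occur. -/
theorem isKraus_partialTrace_comp_conj [DecidableEq G] {out : G → O} {r : G → R}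
    (hinj : ∀ g h, out g = out h → r g = r h → g = h) {V : Matrix G I ℂ} (hV : Vᴴ * V = 1) :
    IsKraus (partialTrace out r ∘ₗ conj V) := by
  refine ⟨R, inferInstance,
    fun s => (sliceOp out r s) * V, ?_, ?_⟩
  · rw [partialTrace_eq_sum_conj]
    refine LinearMap.ext fun ρ => ?_
    simp only [LinearMap.comp_apply, LinearMap.sum_apply]
    exact Finset.sum_congr rfl fun s _ => by rw [← conj_comp]; rfl
  · have h1 : ∑ s, (sliceOp out r s)ᴴ *
        (sliceOp out r s) = 1 := by
      ext g h
      rw [Matrix.sum_apply, Finset.sum_eq_single (r g), Matrix.mul_apply,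
        Finset.sum_eq_single (out g)]
      · simp only [sliceOp, Matrix.conjTranspose_apply, Matrix.of_apply, Matrix.one_apply]
        by_cases hgh : g = h
        · simp [hgh]
        · rw [if_neg hgh, if_neg (c := out h = out g ∧ r h = r g)
            (fun hh => hgh (hinj _ _ hh.1.symm hh.2.symm)), mul_zero]
      · intro o _ ho
        simp [sliceOp, Ne.symm ho]
      · simp
      · intro s _ hs
        simp [sliceOp, Matrix.mul_apply, Ne.symm hs]
      · simp
    calc _ = ∑ s, Vᴴ * ((sliceOp out r s)ᴴ *
        (sliceOp out r s)) * V := by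
          refine Finset.sum_congr rfl fun s _ => ?_
          simp only [Matrix.conjTranspose_mul, Matrix.mul_assoc]
      _ = 1 := by
        rw [← Matrix.sum_mul, ← Matrix.mul_sum, h1, Matrix.mul_one, hV]

theorem tensorId_conj (K : Matrix O I ℂ) (σ : Matrix (I × R) (I × R) ℂ) :
    tensorId R (conj K) σ = tensorOne R K * σ *
      (tensorOne R K)ᴴ := by
  ext u v
  simp only [tensorId, tensorOne, conj, LinearMap.coe_mk, AddHom.coe_mk, Matrix.mul_apply,
    Matrix.of_apply, Matrix.conjTranspose_apply, Fintype.sum_prod_type]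
  refine Finset.sum_congr rfl fun j _ => ?_
  rw [Finset.sum_eq_single v.2]
  · simp only [if_true]
    congr 1
    refine Finset.sum_congr rfl fun i _ => ?_
    rw [Finset.sum_eq_single u.2]
    · simp
    · intro s _ hs
      simp [Ne.symm hs]
    · simp
  · intro s _ hs
    simp [Ne.symm hs]
  · simp

theorem tensorId_sum {ι : Type} (s : Finset ι) (Φ : ι → Matrix I I ℂ →ₗ[ℂ] Matrix O O ℂ)
    (σ : Matrix (I × R) (I × R) ℂ) :
    tensorId R (∑ i ∈ s, Φ i) σ = ∑ i ∈ s, tensorId R (Φ i) σ := by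
  ext u v
  simp [tensorId, Matrix.sum_apply]

theorem IsKraus.tensorId {Φ : Matrix I I ℂ →ₗ[ℂ] Matrix O O ℂ} (h : IsKraus Φ)
    {σ : Matrix (I × R) (I × R) ℂ} (hσ : σ.PosSemidef) :
    (tensorId R Φ σ).PosSemidef ∧ (tensorId R Φ σ).trace = σ.trace := by
  obtain ⟨T, _, K, rfl, hK⟩ := h
  rw [tensorId_sum]
  simp only [tensorId_conj]
  constructor
  · exact Matrix.posSemidef_sum _ fun s _ => hσ.mul_mul_conjTranspose_same _
  · rw [Matrix.trace_sum]
    have hc : ∀ s, (tensorOne R (K s) * σ * (tensorOne R (K s))ᴴ).trace =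
        ((tensorOne R (K s))ᴴ * tensorOne R (K s) * σ).trace := fun s => by
      rw [Matrix.trace_mul_comm, Matrix.mul_assoc]
    simp only [hc]
    rw [← Matrix.trace_sum, ← Finset.sum_mul]
    suffices h : ∑ s, (tensorOne R (K s))ᴴ *
        (tensorOne R (K s)) = 1 by
      rw [h, Matrix.one_mul]
    ext u v
    have h2 := congrFun (congrFun hK u.1) v.1
    rw [Matrix.sum_apply] at h2 ⊢
    simp only [tensorOne, Matrix.mul_apply, Matrix.of_apply, Matrix.conjTranspose_apply,
      Fintype.sum_prod_type] at h2 ⊢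
    by_cases huv : u.2 = v.2
    · rw [Matrix.one_apply] at h2 ⊢
      simp only [Prod.ext_iff, huv, and_true]
      rw [← h2]
      refine Finset.sum_congr rfl fun s _ => Finset.sum_congr rfl fun o _ => ?_
      rw [Finset.sum_eq_single v.2]
      · simp
      · intro t _ ht
        simp [ht]
      · simp
    · rw [Matrix.one_apply_ne (fun h => huv (congrArg Prod.snd h))]
      refine Finset.sum_eq_zero fun s _ => Finset.sum_eq_zero fun o _ =>
        Finset.sum_eq_zero fun t _ => ?_
      split_ifs with h3 h4
      · exact absurd (h3.symm.trans h4) huv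
      all_goals simp

/-- A mixture of channels is close to a channel that all but a small part of them agree with. -/
theorem diamondNorm_sub_sum_le {Ω : Type} [Fintype Ω] {Φ : Matrix I I ℂ →ₗ[ℂ] Matrix O O ℂ}
    (hΦ : IsKraus Φ) (p : Ω → ℝ) (hp : ∀ ω, 0 ≤ p ω) (hp1 : ∑ ω, p ω = 1)
    (Ψ : Ω → Matrix I I ℂ →ₗ[ℂ] Matrix O O ℂ) (hΨ : ∀ ω, IsKraus (Ψ ω)) (bad : Ω → Prop)
    [DecidablePred bad] (hgood : ∀ ω, ¬ bad ω → Ψ ω = Φ) :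
    diamondNorm (Φ - ∑ ω, (p ω : ℂ) • Ψ ω) ≤
      ENNReal.ofReal (2 * ∑ ω, if bad ω then p ω else 0) := by
  refine iSup₂_le fun σ hσ => ENNReal.ofReal_le_ofReal ?_
  set b := Finset.univ.filter bad
  have h1 : tensorId I (Φ - ∑ ω, (p ω : ℂ) • Ψ ω) σ =
      (∑ ω ∈ b, (p ω : ℂ) • tensorId I Φ σ) - ∑ ω ∈ b, (p ω : ℂ) • tensorId I (Ψ ω) σ := by
    -- Since the weights sum to one, `Φ` is distributed over them, and the good terms cancel.
    have h2 : Φ - ∑ ω, (p ω : ℂ) • Ψ ω = ∑ ω ∈ b, (p ω : ℂ) • (Φ - Ψ ω) := by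
      rw [Finset.sum_filter]
      have : Φ = ∑ ω, (p ω : ℂ) • Φ := by
        rw [← Finset.sum_smul, ← Complex.ofReal_sum, hp1, Complex.ofReal_one, one_smul]
      conv_lhs => rw [this]
      rw [← Finset.sum_sub_distrib]
      refine Finset.sum_congr rfl fun ω _ => ?_
      split_ifs with hb
      · rw [smul_sub]
      · rw [hgood ω hb, sub_self]
    rw [h2, tensorId_sum, ← Finset.sum_sub_distrib]
    refine Finset.sum_congr rfl fun ω _ => ?_
    ext u v
    simp [tensorId, mul_sub]
  rw [h1]
  have hpc : ∀ ω, (0 : ℂ) ≤ p ω := fun ω => by exact_mod_cast hp ω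
  refine (traceNorm_sub_le
    (Matrix.posSemidef_sum _ fun ω _ => (hΦ.tensorId hσ.1).1.smul (hpc ω))
    (Matrix.posSemidef_sum _ fun ω _ => ((hΨ ω).tensorId hσ.1).1.smul (hpc ω))).trans
    (le_of_eq ?_)
  simp only [Matrix.trace_sum, Matrix.trace_smul, (hΦ.tensorId hσ.1).2,
    ((hΨ _).tensorId hσ.1).2, hσ.2]
  rw [← Finset.sum_filter]
  simp [b]
  ring

end Kraus

/-! ### Sums over finite sequences -/

/-- The continuation of a finite sequence by a default value. -/
def extend {Ω : Type} (o : Ω) {n : ℕ} (ω : Fin n → Ω) (i : ℕ) : Ω :=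
  if h : i < n then ω ⟨i, h⟩ else o

/-- Splitting off the last entry. Stating it for functions of infinite sequences keeps the length
out of the types, so that inductions on the length can be carried out. -/
theorem sum_extend_succ {Ω M : Type} [Fintype Ω] [AddCommMonoid M] (o : Ω) (n : ℕ)
    (F : (ℕ → Ω) → M) :
    ∑ ω : Fin (n + 1) → Ω, F (extend o ω) =
      ∑ ω : Fin n → Ω, ∑ a, F (Function.update (extend o ω) n a) := by
  rw [← (Fin.snocEquiv fun _ : Fin (n + 1) => Ω).sum_comp, Fintype.sum_prod_type, Finset.sum_comm]
  refine Finset.sum_congr rfl fun ω _ => Finset.sum_congr rfl fun a _ => ?_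
  congr 1
  funext i
  simp only [extend, Fin.snocEquiv, Equiv.coe_fn_mk, Function.update_apply]
  by_cases h : i = n
  · subst h
    simp [Fin.snoc]
  · rw [if_neg h]
    by_cases h2 : i < n
    · rw [dif_pos h2, dif_pos (by omega), Fin.snoc, dif_pos h2]
      rfl
    · rw [dif_neg h2, dif_neg (by omega)]

/-! ### A tree code -/

section treeCode

variable {F Δ : Type} [Field F] [DecidableEq F]

/-- The causal convolution of `g` with the sequence `δ ∘ d`. -/
def conv (g : ℕ → F) (δ : Δ → F) (d : ℕ → Δ) (i : ℕ) : F :=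
  ∑ j ∈ Finset.range (i + 1), g (i - j) * δ (d j)

/-- The number of zeros among the first `m` entries of the convolution. -/
def zeros (g : ℕ → F) (δ : Δ → F) (d : ℕ → Δ) (m : ℕ) : ℕ :=
  ((Finset.range m).filter fun i => conv g δ d i = 0).card

theorem conv_congr {g g' : ℕ → F} {δ : Δ → F} {d d' : ℕ → Δ} {i : ℕ} (hg : ∀ j ≤ i, g j = g' j)
    (hd : ∀ j ≤ i, d j = d' j) : conv g δ d i = conv g' δ d' i := by
  refine Finset.sum_congr rfl fun j hj => ?_
  rw [hg _ (Nat.sub_le _ _), hd j (Nat.lt_succ_iff.mp (Finset.mem_range.mp hj))]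

theorem zeros_congr {g g' : ℕ → F} {δ : Δ → F} {d d' : ℕ → Δ} {m : ℕ} (hg : ∀ j < m, g j = g' j)
    (hd : ∀ j < m, d j = d' j) : zeros g δ d m = zeros g' δ d' m := by
  rw [zeros, zeros]
  congr 1
  refine Finset.filter_congr fun i hi => ?_
  rw [Finset.mem_range] at hi
  rw [conv_congr (fun j hj => hg j (by omega)) fun j hj => hd j (by omega)]

theorem zeros_succ (g : ℕ → F) (δ : Δ → F) (d : ℕ → Δ) (m : ℕ) :
    zeros g δ d (m + 1) = zeros g δ d m + if conv g δ d m = 0 then 1 else 0 := by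
  rw [zeros, zeros, Finset.range_add_one, Finset.filter_insert]
  split_ifs
  · rw [Finset.card_insert_of_notMem (by simp)]
  · rfl

variable [Fintype F] [Fintype Δ]

/-- The sum over all difference sequences with nonzero start of `|F|` to the number of zeros. -/
def zeroSum (g : ℕ → F) (δ : Δ → F) (o : Δ) (n : ℕ) : ℕ :=
  ∑ d : Fin n → Δ, if n = 0 ∨ δ (extend o d 0) ≠ 0 then
    Fintype.card F ^ zeros g δ (extend o d) n else 0

/-- Entry `n` of the convolution is affine in the new coefficient with slope `δ (d 0) ≠ 0`, so
exactly one value of the coefficient makes it vanish. That value contributes a factor `|F|`, the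
others a factor `1`, which is less than `2` on average. -/
theorem sum_update_pow_zeros_le (g : ℕ → F) (δ : Δ → F) (d : ℕ → Δ) (n : ℕ) (h : δ (d 0) ≠ 0) :
    ∑ a, Fintype.card F ^ zeros (Function.update g n a) δ d (n + 1) ≤
      ∑ _a : F, 2 * Fintype.card F ^ zeros g δ d n := by
  have h1 : ∀ a, zeros (Function.update g n a) δ d n = zeros g δ d n := fun a =>
    zeros_congr (fun j hj => Function.update_of_ne (by omega) _ _) fun _ _ => rfl
  obtain ⟨c, hc⟩ : ∃ c, ∀ a, conv (Function.update g n a) δ d n = a * δ (d 0) + c := by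
    refine ⟨∑ j ∈ Finset.range n, g (n - (j + 1)) * δ (d (j + 1)), fun a => ?_⟩
    rw [conv, Finset.sum_range_succ', add_comm]
    congr 1
    · simp
    · refine Finset.sum_congr rfl fun j hj => ?_
      rw [Finset.mem_range] at hj
      rw [Function.update_of_ne (by omega)]
  have h2 : ∀ a, (a * δ (d 0) + c = 0 ↔ a = -c / δ (d 0)) := fun a => by
    rw [eq_div_iff h, eq_neg_iff_add_eq_zero]
  simp only [zeros_succ, h1, hc, h2, pow_add]
  rw [← Finset.mul_sum, Finset.sum_const, Finset.card_univ, smul_eq_mul]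
  have h3 : ∀ a : F, Fintype.card F ^ (if a = -c / δ (d 0) then 1 else 0) ≤
      1 + if a = -c / δ (d 0) then Fintype.card F else 0 := fun a => by
    split_ifs <;> simp
  have h4 := Finset.sum_le_sum fun a (_ : a ∈ Finset.univ) => h3 a
  rw [Finset.sum_add_distrib, Finset.sum_ite_eq'] at h4
  simp only [Finset.mem_univ, if_true, Finset.sum_const, Finset.card_univ, smul_eq_mul,
    mul_one] at h4
  calc _ ≤ Fintype.card F ^ zeros g δ d n * (Fintype.card F + Fintype.card F) :=
        Nat.mul_le_mul_left _ h4
    _ = _ := by ring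

/-- The coefficients are fixed one at a time. Averaged over the next coefficient, the potential
grows by at most a factor `2` per sequence, and there are `|Δ|` ways to prolong a sequence, so some
choice is at least as good as the average. The potentials of smaller depth do not involve this
coefficient. -/
theorem exists_zeroSum_le (δ : Δ → F) (o : Δ) (n : ℕ) :
    ∃ g : ℕ → F, ∀ m ≤ n, zeroSum g δ o m ≤ (2 * Fintype.card Δ) ^ m := by
  induction n with
  | zero =>
    refine ⟨0, fun m hm => ?_⟩
    obtain rfl : m = 0 := by omega
    simp [zeroSum, zeros]
  | succ n ih =>
    obtain ⟨g, hg⟩ := ih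
    have hsum : ∑ a, zeroSum (Function.update g n a) δ o (n + 1) ≤
        ∑ _a : F, 2 * Fintype.card Δ * zeroSum g δ o n := by
      simp only [zeroSum]
      have he : ∀ a : F, (∑ d : Fin (n + 1) → Δ, if n + 1 = 0 ∨ δ (extend o d 0) ≠ 0 then
          Fintype.card F ^ zeros (Function.update g n a) δ (extend o d) (n + 1) else 0) = _ :=
        fun a => sum_extend_succ o n fun d => if n + 1 = 0 ∨ δ (d 0) ≠ 0 then
          Fintype.card F ^ zeros (Function.update g n a) δ d (n + 1) else 0
      simp only [he]
      rw [Finset.sum_comm, Finset.sum_const, Finset.mul_sum, Finset.smul_sum]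
      refine Finset.sum_le_sum fun d _ => ?_
      rw [Finset.sum_comm]
      refine (Finset.sum_le_card_nsmul _ _
        (∑ _a : F, if n = 0 ∨ δ (extend o d 0) ≠ 0 then
          2 * Fintype.card F ^ zeros g δ (extend o d) n else 0) fun b _ => ?_).trans
        (le_of_eq ?_)
      · by_cases hb : δ (Function.update (extend o d) n b 0) ≠ 0
        · have h0 : n = 0 ∨ δ (extend o d 0) ≠ 0 := by
            rcases Nat.eq_zero_or_pos n with h | h
            · exact Or.inl h
            · rw [Function.update_of_ne (by omega)] at hb
              exact Or.inr hb
          simp only [if_pos h0, hb, or_true, if_true, ne_eq, not_false_eq_true]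
          refine (sum_update_pow_zeros_le g δ _ n hb).trans (le_of_eq ?_)
          refine Finset.sum_congr rfl fun a _ => ?_
          rw [zeros_congr (d := Function.update (extend o d) n b) (d' := extend o d)
            (fun _ _ => rfl) fun j hj => Function.update_of_ne (by omega) _ _]
        · simp [hb]
      · simp only [Finset.sum_const, Finset.card_univ, smul_eq_mul]
        split_ifs <;> ring
    obtain ⟨a, -, ha⟩ := Finset.exists_le_of_sum_le Finset.univ_nonempty hsum
    have hcongr : ∀ m ≤ n, zeroSum (Function.update g n a) δ o m = zeroSum g δ o m := by
      intro m hm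
      refine Finset.sum_congr rfl fun d _ => ?_
      rw [zeros_congr (g := Function.update g n a) (g' := g)
        (fun j hj => Function.update_of_ne (by omega) _ _) fun _ _ => rfl]
    refine ⟨Function.update g n a, fun m hm => ?_⟩
    rcases Nat.lt_or_ge n m with h | h
    · obtain rfl : m = n + 1 := by omega
      refine ha.trans ?_
      rw [pow_succ']
      exact Nat.mul_le_mul_left _ (hg n le_rfl)
    · rw [hcongr m h]
      exact hg m h

/-- A single sequence contributes `|F| ^ zeros` to a potential of at most `(2 |Δ|) ^ m`; compare
exponents, using that `|F|` is at least the square of the base. -/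
theorem exists_two_mul_zeros_le (δ : Δ → F) (hQ : (2 * Fintype.card Δ) ^ 2 ≤ Fintype.card F)
    (n : ℕ) :
    ∃ g : ℕ → F, ∀ d : ℕ → Δ, δ (d 0) ≠ 0 → ∀ m ≤ n, 2 * zeros g δ d m ≤ m := by
  rcases isEmpty_or_nonempty Δ with hΔ | ⟨⟨o⟩⟩
  · exact ⟨0, fun d => (hΔ.false (d 0)).elim⟩
  obtain ⟨g, hg⟩ := exists_zeroSum_le δ o n
  refine ⟨g, fun d hd m hm => ?_⟩
  have hpos : 0 < Fintype.card Δ := Fintype.card_pos_iff.mpr ⟨o⟩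
  have hle : Fintype.card F ^ zeros g δ d m ≤ (2 * Fintype.card Δ) ^ m := by
    refine le_trans ?_ (hg m hm)
    have hex : ∀ j < m, extend o (fun i : Fin m => d i) j = d j := fun j hj => by
      simp [extend, hj]
    refine le_trans (le_of_eq ?_) (Finset.single_le_sum (f := fun d : Fin m → Δ =>
      if m = 0 ∨ δ (extend o d 0) ≠ 0 then Fintype.card F ^ zeros g δ (extend o d) m else 0)
      (fun _ _ => Nat.zero_le _) (Finset.mem_univ fun i : Fin m => d i))
    have h0 : m = 0 ∨ δ (extend o (fun i : Fin m => d i) 0) ≠ 0 := by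
      rcases Nat.eq_zero_or_pos m with h | h
      · exact Or.inl h
      · rw [hex 0 h]
        exact Or.inr hd
    rw [if_pos h0, zeros_congr (fun _ _ => rfl) hex]
  have h2 : (2 * Fintype.card Δ) ^ (2 * zeros g δ d m) ≤ (2 * Fintype.card Δ) ^ m := by
    rw [pow_mul]
    exact (Nat.pow_le_pow_left hQ _).trans hle
  exact (Nat.pow_le_pow_iff_right (by omega)).mp h2

end treeCode

/-! ### Decoding the tree code, and counting the wrongly decoded prefixes. -/

section treeDecode

variable {F A : Type} [Field F] [DecidableEq F] [Nonempty A]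

/-- The number of errors among the first `k` symbols of `r` if the message is `y`. -/
def codeCost (g : ℕ → F) (ι : A → F) (r : ℕ → F) (k : ℕ) (y : ℕ → A) : ℕ :=
  ((Finset.range k).filter fun i => conv g ι y i ≠ r i).card

/-- Nearest codeword decoding of the first `k` symbols of `r`. -/
def treeDecode (g : ℕ → F) (ι : A → F) (r : ℕ → F) (k : ℕ) : ℕ → A :=
  Function.argmin (codeCost g ι r k)

theorem treeDecode_congr {g : ℕ → F} {ι : A → F} {r r' : ℕ → F} {k : ℕ}
    (h : ∀ i < k, r i = r' i) : treeDecode g ι r k = treeDecode g ι r' k := by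
  have : codeCost g ι r k = codeCost g ι r' k := by
    funext y
    rw [codeCost, codeCost]
    congr 1
    exact Finset.filter_congr fun i hi => by rw [h i (Finset.mem_range.mp hi)]
  rw [treeDecode, treeDecode, this]

/-- `g` generates a code in which any two codewords differ in at least half of the positions after
the first position where the messages differ, up to depth `n`. -/
def IsTreeCode (g : ℕ → F) (ι : A → F) (n : ℕ) : Prop :=
  ∀ x y : ℕ → A, x 0 ≠ y 0 → ∀ m ≤ n,
    2 * ((Finset.range m).filter fun i => conv g ι x i = conv g ι y i).card ≤ m

/-- Convolution is additive, so two codewords agree exactly where the convolution of the difference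
of the messages vanishes. Pairs of letters serve as the alphabet of differences. -/
theorem exists_isTreeCode [Fintype F] [Fintype A] {ι : A → F} (hι : Function.Injective ι)
    (hQ : (2 * (Fintype.card A * Fintype.card A)) ^ 2 ≤ Fintype.card F) (n : ℕ) :
    ∃ g : ℕ → F, IsTreeCode g ι n := by
  obtain ⟨g, hg⟩ := exists_two_mul_zeros_le (Δ := A × A) (fun a => ι a.1 - ι a.2)
    (by rwa [Fintype.card_prod]) n
  refine ⟨g, fun x y hxy m hm => ?_⟩
  have := hg (fun i => (x i, y i)) (sub_ne_zero.mpr (hι.ne hxy)) m hm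
  convert this using 2
  rw [zeros]
  congr 1
  refine Finset.filter_congr fun i _ => ?_
  simp only [conv, mul_sub, Finset.sum_sub_distrib, sub_eq_zero]

/-- A common prefix adds the same amount to both codewords, and the convolution is invariant under
shifts. Hence a distance bound for messages that part at the root is enough for messages that part
at any `s`. -/
theorem conv_add_eq_iff (g : ℕ → F) (ι : A → F) {x y : ℕ → A} {s : ℕ} (h : ∀ j < s, x j = y j)
    (i : ℕ) : conv g ι x (s + i) = conv g ι y (s + i) ↔
      conv g ι (fun j => x (s + j)) i = conv g ι (fun j => y (s + j)) i := by
  have key : ∀ z : ℕ → A, conv g ι z (s + i) =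
      ∑ j ∈ Finset.range s, g (s + i - j) * ι (z j) + conv g ι (fun j => z (s + j)) i := by
    intro z
    rw [conv, add_assoc, Finset.sum_range_add, conv]
    congr 1
    refine Finset.sum_congr rfl fun j _ => ?_
    rw [Nat.add_sub_add_left]
  rw [key x, key y, Finset.sum_congr rfl fun j hj => by rw [h j (Finset.mem_range.mp hj)]]
  exact add_right_inj _

/-- Take for `s` the first wrong letter. Before `s` both codewords have the same errors. From `s` on
they differ in at least half of the places, each of which is an error for the true or for the
decoded message. The decoded message has no more errors than the true one, so the latter has errors
in at least a quarter of the places. -/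
theorem exists_errors_of_treeDecode_ne {g : ℕ → F} {ι : A → F} {n : ℕ} (hg : IsTreeCode g ι n)
    (x : ℕ → A) (r : ℕ → F) {k : ℕ} (hk : k ≤ n) (hbad : ∃ j < k, treeDecode g ι r k j ≠ x j) :
    ∃ s < k, k - s ≤ 4 * ((Finset.Ico s k).filter fun i => conv g ι x i ≠ r i).card := by
  classical
  set y := treeDecode g ι r k with hy
  set s := Nat.find hbad
  obtain ⟨hsk, hs⟩ := Nat.find_spec hbad
  have hlt : ∀ j < s, y j = x j := fun j hj => by
    by_contra h
    exact Nat.find_min hbad hj ⟨hj.trans hsk, h⟩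
  refine ⟨s, hsk, ?_⟩
  have hmin : codeCost g ι r k y ≤ codeCost g ι r k x := Function.argmin_le _ _
  have hsplit : ∀ z, codeCost g ι r k z = ((Finset.range s).filter fun i => conv g ι z i ≠ r i).card
      + ((Finset.Ico s k).filter fun i => conv g ι z i ≠ r i).card := by
    intro z
    rw [codeCost, Finset.range_eq_Ico, ← Finset.Ico_union_Ico_eq_Ico (Nat.zero_le s) hsk.le,
      Finset.filter_union, Finset.card_union_of_disjoint, Finset.range_eq_Ico]
    exact Finset.disjoint_filter_filter (Finset.Ico_disjoint_Ico_consecutive 0 s k)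
  have heq : ((Finset.range s).filter fun i => conv g ι y i ≠ r i) =
      ((Finset.range s).filter fun i => conv g ι x i ≠ r i) := by
    refine Finset.filter_congr fun i hi => ?_
    rw [Finset.mem_range] at hi
    rw [conv_congr (fun _ _ => rfl) fun j hj => hlt j (by omega)]
  rw [hsplit, hsplit, heq] at hmin
  have hagree : 2 * ((Finset.Ico s k).filter fun i => conv g ι x i = conv g ι y i).card ≤ k - s := by
    have h1 := hg (fun j => x (s + j)) (fun j => y (s + j)) (Ne.symm hs) (k - s) (by omega)
    convert h1 using 2
    symm
    refine Finset.card_bij (fun i _ => s + i) ?_ (by simp) ?_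
    · intro i hi
      simp only [Finset.mem_filter, Finset.mem_range, Finset.mem_Ico] at hi ⊢
      exact ⟨by omega, (conv_add_eq_iff g ι (fun j hj => (hlt j hj).symm) i).mpr hi.2⟩
    · intro i hi
      simp only [Finset.mem_filter, Finset.mem_Ico] at hi
      refine ⟨i - s, ?_, by omega⟩
      simp only [Finset.mem_filter, Finset.mem_range]
      refine ⟨by omega, (conv_add_eq_iff g ι (fun j hj => (hlt j hj).symm) _).mp ?_⟩
      rw [show s + (i - s) = i by omega]
      exact hi.2
  have hcover : (Finset.Ico s k).card ≤
      ((Finset.Ico s k).filter fun i => conv g ι x i = conv g ι y i).card +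
      (((Finset.Ico s k).filter fun i => conv g ι x i ≠ r i).card +
        ((Finset.Ico s k).filter fun i => conv g ι y i ≠ r i).card) := by
    refine le_trans (Finset.card_le_card ?_) ((Finset.card_union_le _ _).trans
      (Nat.add_le_add_left (Finset.card_union_le _ _) _))
    intro i hi
    simp only [Finset.mem_union, Finset.mem_filter, hi, true_and]
    by_contra! h
    exact h.1 (h.2.1.trans h.2.2.symm)
  rw [Nat.card_Ico] at hcover
  omega

/-- Intervals to the left of the points of a set, each of which has many errors, show that there are
many errors. -/
theorem card_filter_le_of_intervals {bad err : ℕ → Prop} [DecidablePred bad] [DecidablePred err]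
    (c n : ℕ) (h : ∀ k ≤ n, bad k → ∃ s < k, k - s ≤ c * ((Finset.Ico s k).filter err).card) :
    ((Finset.range (n + 1)).filter bad).card ≤ c * ((Finset.range n).filter err).card := by
  induction n using Nat.strong_induction_on with
  | _ n ih =>
    by_cases hn : bad n
    -- The points after `s` are at most `n - s` in number and are paid for by the errors in `[s,
    -- n)`. The points up to `s` are left to the induction, with errors before `s`.
    · obtain ⟨s, hs, hs2⟩ := h n le_rfl hn
      have h1 := ih s hs fun k hk => h k (by omega)
      have h2 : ((Finset.range (n + 1)).filter bad).card ≤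
          ((Finset.range (s + 1)).filter bad).card + (n - s) := by
        rw [Finset.range_eq_Ico, ← Finset.Ico_union_Ico_eq_Ico (Nat.zero_le (s + 1))
          (by omega : s + 1 ≤ n + 1), Finset.filter_union, ← Finset.range_eq_Ico]
        refine (Finset.card_union_le _ _).trans (Nat.add_le_add_left ?_ _)
        refine (Finset.card_filter_le _ _).trans ?_
        simp
      have h3 : ((Finset.range n).filter err).card = ((Finset.range s).filter err).card +
          ((Finset.Ico s n).filter err).card := by
        rw [Finset.range_eq_Ico, ← Finset.Ico_union_Ico_eq_Ico (Nat.zero_le s) hs.le,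
          Finset.filter_union, Finset.card_union_of_disjoint, Finset.range_eq_Ico]
        exact Finset.disjoint_filter_filter (Finset.Ico_disjoint_Ico_consecutive 0 s n)
      rw [h3, mul_add]
      omega
    · rw [Finset.range_add_one, Finset.filter_insert, if_neg hn]
      rcases n with _ | n
      · simp
      · refine (ih n (by omega) fun k hk => h k (by omega)).trans ?_
        refine Nat.mul_le_mul_left _ (Finset.card_le_card (Finset.filter_subset_filter _ ?_))
        simp

/-- The number of prefixes which are decoded wrongly. -/
theorem card_treeDecode_ne_le {g : ℕ → F} {ι : A → F} {n : ℕ} (hg : IsTreeCode g ι n)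
    (x : ℕ → A) (r : ℕ → F) [DecidablePred fun k => ∃ j < k, treeDecode g ι r k j ≠ x j] :
    ((Finset.range (n + 1)).filter fun k => ∃ j < k, treeDecode g ι r k j ≠ x j).card ≤
      4 * ((Finset.range n).filter fun i => conv g ι x i ≠ r i).card :=
  card_filter_le_of_intervals 4 n fun _ hk hbad => exists_errors_of_treeDecode_ne hg x r hk hbad

end treeDecode

/-! ### The capacity of the binary symmetric channel -/

/-- The left side is `p log (2p) + (1 - p) log (2 (1 - p))`; use `log x ≤ x - 1` in both terms. -/
theorem log_two_sub_binEntropy_le {p : ℝ} (h0 : 0 ≤ p) (h1 : p ≤ 1) :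
    Real.log 2 - Real.binEntropy p ≤ (1 - 2 * p) ^ 2 := by
  have key : ∀ x : ℝ, 0 ≤ x → x * Real.log 2 - Real.negMulLog x ≤ x * (2 * x - 1) := by
    intro x hx
    rcases hx.eq_or_lt with rfl | hx
    · simp
    · have h := Real.log_le_sub_one_of_pos (by positivity : (0 : ℝ) < 2 * x)
      rw [Real.log_mul (by norm_num) hx.ne'] at h
      rw [Real.negMulLog]
      nlinarith
  have ha := key p h0
  have hb := key (1 - p) (by linarith)
  rw [Real.binEntropy_eq_negMulLog_add_negMulLog_one_sub]
  nlinarith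

/-- The output entropy is at most one bit, and the entropy given the input is that of `p` for both
inputs. The rate has to be compared with the capacity from one side only, so no lower bound is
needed. -/
theorem capacity_bsc_le {p : ℝ} (h0 : 0 ≤ p) (h1 : p ≤ 1) :
    capacity (bsc p) ≤ (1 - 2 * p) ^ 2 / Real.log 2 := by
  have hlog : 0 < Real.log 2 := Real.log_pos (by norm_num)
  refine Real.sSup_le ?_ (by positivity)
  rintro _ ⟨P, hP, rfl⟩
  have hsum : P 0 + P 1 = 1 := by simpa using hP.2
  have hrow : ∀ a, entropy (bsc p a) = Real.binEntropy p / Real.log 2 := by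
    intro a
    rw [entropy, Real.binEntropy_eq_negMulLog_add_negMulLog_one_sub]
    fin_cases a <;> simp [bsc, add_comm]
  have hout : entropy (fun b => ∑ a, P a * bsc p a b) ≤ 1 := by
    rw [entropy, div_le_one hlog]
    have : (∑ a, P a * bsc p a 1) = 1 - ∑ a, P a * bsc p a 0 := by
      simp [bsc]
      linear_combination hsum
    rw [Fin.sum_univ_two, this, ← Real.binEntropy_eq_negMulLog_add_negMulLog_one_sub]
    exact Real.binEntropy_le_log_two
  have h := log_two_sub_binEntropy_le h0 h1
  rw [mutualInfo]
  simp only [hrow, ← Finset.sum_mul]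
  rw [Fin.sum_univ_two, hsum, one_mul]
  rw [le_div_iff₀ hlog, sub_mul, div_mul_cancel₀ _ hlog.ne']
  nlinarith

/-! ### A block code for the binary symmetric channel -/

/-- The probability of the noise value `f`. -/
def flipProb (p : ℝ) (f : Fin 2) : ℝ := if f = 0 then 1 - p else p

theorem flipProb_nonneg {p : ℝ} (h0 : 0 ≤ p) (h1 : p ≤ 1) (f : Fin 2) : 0 ≤ flipProb p f := by
  rw [flipProb]
  split_ifs <;> linarith

theorem sum_flipProb (p : ℝ) : ∑ f, flipProb p f = 1 := by
  simp [flipProb]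

/-- The sign of a bit. -/
def bitSign (b : Fin 2) : ℝ := if b = 0 then 1 else -1

theorem bitSign_add (a b : Fin 2) : bitSign (a + b) = bitSign a * bitSign b := by
  fin_cases a <;> fin_cases b <;> simp [bitSign]

section expectation

variable {ι : Type} [Fintype ι] [DecidableEq ι]

theorem sum_prod_flipProb_mul (p : ℝ) (φ : ι → Fin 2 → ℝ) :
    ∑ n : ι → Fin 2, (∏ i, flipProb p (n i)) * ∏ i, φ i (n i) =
      ∏ i, ∑ b, flipProb p b * φ i b := by
  rw [Fintype.prod_sum]
  simp only [Finset.prod_mul_distrib]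

theorem sum_prod_flipProb (p : ℝ) : ∑ n : ι → Fin 2, ∏ i, flipProb p (n i) = 1 := by
  have h := sum_prod_flipProb_mul p (fun (_ : ι) _ => 1)
  simp only [mul_one, Finset.prod_const_one, sum_flipProb] at h
  exact h

theorem covariance_bitSign (p : ℝ) (j k : ι) :
    ∑ n : ι → Fin 2, (∏ i, flipProb p (n i)) *
      ((bitSign (n j) - (1 - 2 * p)) * (bitSign (n k) - (1 - 2 * p))) =
      if j = k then 1 - (1 - 2 * p) ^ 2 else 0 := by
  by_cases h : j = k
  · subst h
    have hφ : ∀ n : ι → Fin 2, (bitSign (n j) - (1 - 2 * p)) * (bitSign (n j) - (1 - 2 * p)) =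
        ∏ i, if i = j then (bitSign (n i) - (1 - 2 * p)) ^ 2 else 1 := fun n => by
      rw [Finset.prod_ite_eq' Finset.univ j fun i => (bitSign (n i) - (1 - 2 * p)) ^ 2]
      simp [sq]
    simp only [hφ]
    rw [sum_prod_flipProb_mul p fun i b => if i = j then (bitSign b - (1 - 2 * p)) ^ 2 else 1,
      Finset.prod_eq_single j]
    · simp [flipProb, bitSign]
      ring
    · intro i _ hi
      simp only [hi, if_false, mul_one, sum_flipProb]
    · simp
  · rw [if_neg h]
    have hφ : ∀ n : ι → Fin 2, (bitSign (n j) - (1 - 2 * p)) * (bitSign (n k) - (1 - 2 * p)) =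
        ∏ i, ((if i = j then bitSign (n i) - (1 - 2 * p) else 1) *
          if i = k then bitSign (n i) - (1 - 2 * p) else 1) := fun n => by
      rw [Finset.prod_mul_distrib, Finset.prod_ite_eq' Finset.univ j fun i =>
        bitSign (n i) - (1 - 2 * p), Finset.prod_ite_eq' Finset.univ k fun i =>
        bitSign (n i) - (1 - 2 * p)]
      simp
    simp only [hφ]
    rw [sum_prod_flipProb_mul p fun i b => (if i = j then bitSign b - (1 - 2 * p) else 1) *
      if i = k then bitSign b - (1 - 2 * p) else 1]
    refine Finset.prod_eq_zero (Finset.mem_univ j) ?_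
    simp [h, flipProb, bitSign]
    ring

/-- Chebyshev's inequality for the majority of independent flips. -/
theorem prob_majority_le {p : ℝ} (h0 : 0 ≤ p) (h1 : p ≤ 1) (hp : 1 - 2 * p ≠ 0) (S : Finset ι)
    (hS : 0 < S.card) :
    ∑ n : ι → Fin 2, (∏ i, flipProb p (n i)) *
      (if (∑ j ∈ S, bitSign (n j)) * (1 - 2 * p) ≤ 0 then 1 else 0) ≤
      1 / (S.card * (1 - 2 * p) ^ 2) := by
  set δ := 1 - 2 * p with hδ
  have hδ2 : 0 < δ ^ 2 := by positivity
  have hS' : (0 : ℝ) < S.card := by exact_mod_cast hS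
  have hvar : ∑ n : ι → Fin 2, (∏ i, flipProb p (n i)) * (∑ j ∈ S, (bitSign (n j) - δ)) ^ 2 =
      S.card * (1 - δ ^ 2) := by
    have hsq : ∀ n : ι → Fin 2, (∑ j ∈ S, (bitSign (n j) - δ)) ^ 2 =
        ∑ j ∈ S, ∑ k ∈ S, (bitSign (n j) - δ) * (bitSign (n k) - δ) := fun n => by
      rw [sq, Finset.sum_mul_sum]
    simp only [hsq, Finset.mul_sum]
    rw [Finset.sum_comm]
    have : ∀ j ∈ S, ∑ n : ι → Fin 2, ∑ k ∈ S, (∏ i, flipProb p (n i)) *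
        ((bitSign (n j) - δ) * (bitSign (n k) - δ)) = 1 - δ ^ 2 := by
      intro j hj
      rw [Finset.sum_comm]
      simp only [covariance_bitSign, hδ]
      rw [Finset.sum_ite_eq, if_pos hj]
    rw [Finset.sum_congr rfl this, Finset.sum_const, nsmul_eq_mul]
  -- If the majority has the wrong sign, the sum is at distance at least `|S| |δ|` from its mean
  -- `|S| δ`.
  have hle : ∑ n : ι → Fin 2, (∏ i, flipProb p (n i)) *
      (if (∑ j ∈ S, bitSign (n j)) * δ ≤ 0 then 1 else 0) * (S.card * δ) ^ 2 ≤
      ∑ n : ι → Fin 2, (∏ i, flipProb p (n i)) * (∑ j ∈ S, (bitSign (n j) - δ)) ^ 2 := by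
    refine Finset.sum_le_sum fun n _ => ?_
    rw [mul_assoc]
    refine mul_le_mul_of_nonneg_left ?_ (Finset.prod_nonneg fun i _ => flipProb_nonneg h0 h1 _)
    split_ifs with h
    · rw [Finset.sum_sub_distrib, Finset.sum_const, nsmul_eq_mul]
      nlinarith [sq_nonneg (∑ j ∈ S, bitSign (n j))]
    · rw [zero_mul]
      positivity
  rw [hvar, ← Finset.sum_mul] at hle
  rw [le_div_iff₀ (by positivity)]
  refine le_of_mul_le_mul_right ?_ hS'
  nlinarith

end expectation

/-- A block code for the binary symmetric channel, which uses only the transmissions with even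
offset in a block of `D` transmissions.  If the noise is in `good` the decoding is correct. -/
structure BlockCode (F : Type) (p ε : ℝ) where
  D : ℕ
  odd_D : Odd D
  enc : F → ℕ → Fin 2
  dec : (ℕ → Fin 2) → F
  good : (Fin D → Fin 2) → Prop
  dec_eq : ∀ s n r, good n → (∀ o : Fin D, Even (o : ℕ) → r o = enc s o + n o) → dec r = s
  prob_not_good_le : ∑ n : Fin D → Fin 2, (∏ i, flipProb p (n i)) *
    (open Classical in if good n then 0 else 1) ≤ ε

/-- The codeword of a symbol is its indicator vector, each entry repeated at `r` even offsets. A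
majority vote fails with probability at most `1 / (r δ^2) ≤ ε / |F|`, and a union bound covers all
entries. The constant depends on `F` and `ε` but not on `p`. -/
theorem exists_blockCode (F : Type) [Fintype F] [Nonempty F] {ε : ℝ} (hε : 0 < ε) :
    ∃ K : ℝ, 0 < K ∧ ∀ p : ℝ, 0 ≤ p → p ≤ 1 → 1 - 2 * p ≠ 0 →
      ∃ B : BlockCode F p ε, (B.D : ℝ) ≤ K / (1 - 2 * p) ^ 2 := by
  classical
  set m := Fintype.card F with hm
  have hm0 : 0 < m := Fintype.card_pos
  have hm' : (0 : ℝ) < m := by exact_mod_cast hm0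
  refine ⟨2 * m * (m / ε + 1), by positivity, fun p h0 h1 hp => ?_⟩
  set δ := 1 - 2 * p with hδ
  have hδ2 : 0 < δ ^ 2 := by positivity
  have hδ1 : δ ^ 2 ≤ 1 := by
    rw [sq_le_one_iff_abs_le_one, abs_le]
    constructor <;> linarith
  set r := ⌈m / (ε * δ ^ 2)⌉₊ with hr
  have hr0 : 0 < r := Nat.ceil_pos.mpr (by positivity)
  have hrle : (r : ℝ) ≤ (m / ε + 1) / δ ^ 2 := by
    refine (Nat.ceil_lt_add_one (by positivity)).le.trans ?_
    rw [add_div, ← div_div]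
    gcongr
    rw [le_div_iff₀ hδ2]
    linarith
  have hmr : 0 < m * r := Nat.mul_pos hm0 hr0
  -- The even offsets in use are `0, 2, …, 2 (m r - 1)`, so the block can end at an odd length.
  set D := 2 * (m * r) - 1 with hD
  let e : F ≃ Fin m := Fintype.equivFin F
  let S : Fin m → Finset (Fin D) := fun i =>
    Finset.univ.filter fun o => Even (o : ℕ) ∧ (o : ℕ) / 2 / r = i
  have hScard : ∀ i, r ≤ (S i).card := by
    intro i
    have hpos : ∀ j : Fin r, 2 * (i * r + j) < D := by
      intro j
      have h1 : (i : ℕ) * r + j + 1 ≤ m * r := by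
        calc (i : ℕ) * r + j + 1 ≤ i * r + r := by omega
          _ = (i + 1) * r := by ring
          _ ≤ m * r := Nat.mul_le_mul_right _ i.2
      omega
    rw [← Fintype.card_fin r, ← Finset.card_univ]
    refine Finset.card_le_card_of_injOn (fun j => ⟨2 * (i * r + j), hpos j⟩) ?_ ?_
    · intro j _
      simp only [S, Finset.coe_filter, Finset.mem_univ, true_and, Set.mem_ofPred_eq]
      refine ⟨even_two_mul _, ?_⟩
      rw [Nat.mul_div_cancel_left _ (by norm_num), mul_comm, Nat.mul_add_div hr0,
        Nat.div_eq_of_lt j.2, add_zero]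
    · intro j _ k _ hjk
      simp only [Fin.mk.injEq] at hjk
      exact Fin.ext (by omega)
  let Z : Fin m → (ℕ → Fin 2) → ℝ := fun i y => ∑ o ∈ S i, bitSign (y o)
  refine ⟨{
    D := D
    odd_D := ⟨m * r - 1, by omega⟩
    enc := fun s o => if o / 2 / r = e s then 1 else 0
    -- The factor `δ` turns the vote around when `p > 1 / 2`, where most bits are flipped.
    dec := fun y => Classical.epsilon fun s => Z (e s) y * δ < 0
    good := fun n => ∀ i, 0 < (∑ o ∈ S i, bitSign (n o)) * δ
    dec_eq := ?_
    prob_not_good_le := ?_ }, ?_⟩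
  · intro s n y hn hy
    have hZ : ∀ i, Z i y = bitSign (if i = e s then 1 else 0) * ∑ o ∈ S i, bitSign (n o) := by
      intro i
      rw [Finset.mul_sum]
      refine Finset.sum_congr rfl fun o ho => ?_
      simp only [S, Finset.mem_filter, Finset.mem_univ, true_and] at ho
      rw [hy o ho.1, bitSign_add, ho.2]
      simp only [Fin.ext_iff]
    have hs : Z (e s) y * δ < 0 := by
      rw [hZ, if_pos rfl]
      have := hn (e s)
      rw [show bitSign 1 = -1 by simp [bitSign]]
      linarith
    have h := Classical.epsilon_spec (p := fun s => Z (e s) y * δ < 0) ⟨s, hs⟩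
    by_contra hne
    rw [hZ, if_neg (e.injective.ne hne)] at h
    have := hn (e (Classical.epsilon fun s => Z (e s) y * δ < 0))
    rw [show bitSign 0 = 1 by simp [bitSign]] at h
    linarith
  · have hw : ∀ n : Fin D → Fin 2, 0 ≤ ∏ i, flipProb p (n i) := fun n =>
      Finset.prod_nonneg fun i _ => flipProb_nonneg h0 h1 _
    calc _ ≤ ∑ n : Fin D → Fin 2, ∑ i, (∏ i, flipProb p (n i)) *
          (if (∑ j ∈ S i, bitSign (n j)) * δ ≤ 0 then 1 else 0) := by
            refine Finset.sum_le_sum fun n _ => ?_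
            rw [← Finset.mul_sum]
            refine mul_le_mul_of_nonneg_left ?_ (hw n)
            split_ifs with h
            · exact Finset.sum_nonneg fun i _ => by split_ifs <;> norm_num
            · push Not at h
              obtain ⟨i, hi⟩ := h
              refine le_trans ?_ (Finset.single_le_sum (f := fun i =>
                if (∑ j ∈ S i, bitSign (n j)) * δ ≤ 0 then (1 : ℝ) else 0)
                (fun i _ => by split_ifs <;> norm_num) (Finset.mem_univ i))
              rw [if_pos hi]
      _ = ∑ i, ∑ n : Fin D → Fin 2, (∏ i, flipProb p (n i)) *
          (if (∑ j ∈ S i, bitSign (n j)) * δ ≤ 0 then 1 else 0) := Finset.sum_comm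
      _ ≤ ∑ i : Fin m, ε / m := by
        refine Finset.sum_le_sum fun i _ => ?_
        refine (prob_majority_le h0 h1 hp (S i) (hr0.trans_le (hScard i))).trans ?_
        rw [← hδ, div_le_div_iff₀ (by have := hr0.trans_le (hScard i); positivity) hm', one_mul]
        have h2 : (m : ℝ) / (ε * δ ^ 2) ≤ (S i).card :=
          (Nat.le_ceil _).trans (by exact_mod_cast hScard i)
        rw [div_le_iff₀ (by positivity)] at h2
        linarith
      _ = ε := by
        rw [Finset.sum_const, Finset.card_univ, Fintype.card_fin, nsmul_eq_mul]
        field_simp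
  · have : (D : ℝ) ≤ 2 * (m * r) := by exact_mod_cast (Nat.sub_le _ _)
    calc (D : ℝ) ≤ 2 * m * r := by linarith
      _ ≤ 2 * m * ((m / ε + 1) / δ ^ 2) := by gcongr
      _ = _ := by ring

/-! ### Many block errors are unlikely -/

/-- The noise in block `t`. -/
def block (D : ℕ) (f : ℕ → Fin 2) (t : ℕ) (o : Fin D) : Fin 2 := f (t * D + o)

open Classical in
/-- The number of blocks with bad noise. -/
def blockErrors {F : Type} {p ε : ℝ} (B : BlockCode F p ε) (T : ℕ) (f : ℕ → Fin 2) : ℕ :=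
  ((Finset.range T).filter fun t => ¬ B.good (block B.D f t)).card

/-- The noise in different blocks is independent and identically distributed, so the expectation of
the product is a power. -/
theorem sum_blocks {D T : ℕ} (p : ℝ) (ψ : (Fin D → Fin 2) → ℝ) :
    ∑ f : Fin (T * D) → Fin 2, (∏ i, flipProb p (f i)) *
      ∏ t ∈ Finset.range T, ψ (block D (extend 0 f) t) =
      (∑ n : Fin D → Fin 2, (∏ i, flipProb p (n i)) * ψ n) ^ T := by
  have hR : (∑ n : Fin D → Fin 2, (∏ i, flipProb p (n i)) * ψ n) ^ T =
      ∏ _t : Fin T, ∑ n : Fin D → Fin 2, (∏ i, flipProb p (n i)) * ψ n := by simp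
  rw [hR, Fintype.prod_sum]
  symm
  refine Fintype.sum_equiv ((Equiv.curry (Fin T) (Fin D) (Fin 2)).symm.trans
    (finProdFinEquiv.arrowCongr (Equiv.refl _))) _ _ fun n => ?_
  rw [Finset.prod_mul_distrib]
  congr 1
  · rw [← finProdFinEquiv.prod_comp, Fintype.prod_prod_type]
    simp
  · rw [← Fin.prod_univ_eq_prod_range fun t => ψ (block D (extend 0 _) t)]
    refine Finset.prod_congr rfl fun t _ => ?_
    congr 1
    funext o
    have hlt : (t : ℕ) * D + o < T * D := by
      calc (t : ℕ) * D + o < t * D + D := by omega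
        _ = (t + 1) * D := by ring
        _ ≤ T * D := Nat.mul_le_mul_right _ t.2
    have : (⟨t * D + o, hlt⟩ : Fin (T * D)) = finProdFinEquiv (t, o) := by
      ext
      simp [finProdFinEquiv, mul_comm, add_comm]
    rw [block, extend, dif_pos hlt, this]
    simp

/-- Markov's inequality for `4 ^ (a * errors)`: its expectation is at most `(1 + ε 4 ^ a) ^ T ≤ 2 ^
T`, and in the event it is at least `4 ^ T`. -/
theorem prob_blockErrors_le {F : Type} {p ε : ℝ} (h0 : 0 ≤ p) (h1 : p ≤ 1) (B : BlockCode F p ε)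
    {a : ℕ} (hε : ε * 4 ^ a ≤ 1) (T : ℕ) :
    ∑ f : Fin (T * B.D) → Fin 2, (∏ i, flipProb p (f i)) *
      (if T ≤ a * blockErrors B T (extend 0 f) then 1 else 0) ≤ (1 / 2) ^ T := by
  classical
  have hw : ∀ {D : ℕ} (n : Fin D → Fin 2), 0 ≤ ∏ i, flipProb p (n i) := fun n =>
      Finset.prod_nonneg fun i _ => flipProb_nonneg h0 h1 _
  have h2 : ∑ n : Fin B.D → Fin 2, (∏ i, flipProb p (n i)) * (if B.good n then 1 else (4 : ℝ) ^ a)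
      ≤ 2 := by
    calc _ ≤ ∑ n : Fin B.D → Fin 2, ((∏ i, flipProb p (n i)) +
          (∏ i, flipProb p (n i)) * (if B.good n then 0 else 1) * 4 ^ a) := by
          refine Finset.sum_le_sum fun n _ => ?_
          have := hw n
          split_ifs <;> simp [this]
      _ ≤ 1 + ε * 4 ^ a := by
        rw [Finset.sum_add_distrib, sum_prod_flipProb, ← Finset.sum_mul]
        gcongr
        convert B.prob_not_good_le
      _ ≤ 2 := by linarith
  have h3 : ∀ f : ℕ → Fin 2, ∏ t ∈ Finset.range T, (if B.good (block B.D f t) then 1 else (4 : ℝ) ^ a)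
      = (4 ^ a) ^ blockErrors B T f := by
    intro f
    rw [Finset.prod_ite, Finset.prod_const_one, one_mul, Finset.prod_const, blockErrors]
  have h4 := sum_blocks (D := B.D) (T := T) p fun n => if B.good n then 1 else (4 : ℝ) ^ a
  simp only [h3] at h4
  have h5 : (∑ f : Fin (T * B.D) → Fin 2, (∏ i, flipProb p (f i)) *
      (if T ≤ a * blockErrors B T (extend 0 f) then 1 else 0)) * 4 ^ T ≤ 2 ^ T := by
    rw [Finset.sum_mul]
    refine le_trans (Finset.sum_le_sum fun f _ => ?_) (h4.le.trans
      (pow_le_pow_left₀ (Finset.sum_nonneg fun n _ => ?_) h2 T))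
    · rw [mul_assoc]
      refine mul_le_mul_of_nonneg_left ?_ (hw f)
      split_ifs with h
      · rw [one_mul, ← pow_mul]
        exact pow_le_pow_right₀ (by norm_num) h
      · rw [zero_mul]
        positivity
    · refine mul_nonneg (hw n) ?_
      split_ifs <;> positivity
  have h6 : (2 : ℝ) ^ T = (1 / 2) ^ T * 4 ^ T := by
    rw [← mul_pow]
    norm_num
  rw [h6] at h5
  exact le_of_mul_le_mul_right h5 (by positivity)

/-! ### The stack of pending operations -/

/-- What a party does in one step: the Pauli correction, the call to the black box (`some true` for
the next unitary, `some false` for the inverse of the previous one) and the outcome of the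
teleportation. -/
abbrev Msg : Type := (Fin 2 × Fin 2) × Option Bool × (Fin 2 × Fin 2)

/-- An operation that has been applied and not been undone: its owner (`false` is Alice), its
direction, and the Pauli operator applied before it. -/
abbrev Entry : Type := Bool × Bool × (Fin 2 × Fin 2)

/-- The effect of a message of `o` on the pending Pauli operator and the stack. -/
def machStep (o : Bool) (st : (Fin 2 × Fin 2) × List Entry) (m : Msg) :
    (Fin 2 × Fin 2) × List Entry :=
  match m.2.1, st.2 with
  | none, l => (m.2.2 + (st.1 + m.1), l)
  | some s, [] => (m.2.2, [(o, s, st.1 + m.1)])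
  | some s, (o', s', P) :: l =>
    if st.1 + m.1 = 0 ∧ o' = o ∧ s' = !s then (m.2.2 + P, l)
    else (m.2.2, (o, s, st.1 + m.1) :: (o', s', P) :: l)

/-- The pending Pauli operator and the stack after the first steps of the history `h`. -/
def mach (h : ℕ → Msg) : ℕ → (Fin 2 × Fin 2) × List Entry
  | 0 => (0, [])
  | t + 1 => machStep t.bodd (mach h t) (h t)

theorem mach_congr {h h' : ℕ → Msg} {t : ℕ} (H : ∀ i < t, h i = h' i) : mach h t = mach h' t := by
  induction t with
  | zero => rfl
  | succ t ih =>
    rw [mach, mach, ih fun i hi => H i (by omega), H t (by omega)]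

/-- The stack after `n` correct operations. -/
def cleanStack : ℕ → List Entry
  | 0 => []
  | n + 1 => (n.bodd, true, 0) :: cleanStack n

theorem length_cleanStack (n : ℕ) : (cleanStack n).length = n := by
  induction n with
  | zero => rfl
  | succ n ih => simp [cleanStack, ih]

/-- The operation by which `o` makes progress. -/
def bestMove (o : Bool) (st : (Fin 2 × Fin 2) × List Entry) : (Fin 2 × Fin 2) × Option Bool :=
  (st.1, if st.2 = cleanStack st.2.length then
      if st.2.length.bodd = o then some true else none
    else match st.2 with
      | [] => none
      | (o', s, _) :: _ => if o' = o then some (!s) else none)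

/-- There are at least `v` more correct operations at the bottom of the stack than twice the
operations above. -/
def Progress (l : List Entry) (v : ℤ) : Prop :=
  ∃ junk n, l = junk ++ cleanStack n ∧ v + 2 * junk.length ≤ n

theorem Progress.mono {l : List Entry} {v w : ℤ} (h : Progress l v) (hw : w ≤ v) :
    Progress l w := by
  obtain ⟨junk, n, rfl, hv⟩ := h
  exact ⟨junk, n, rfl, by omega⟩

theorem Progress.push {l : List Entry} {v : ℤ} (h : Progress l v) (e : Entry) :
    Progress (e :: l) (v - 2) := by
  obtain ⟨junk, n, rfl, hv⟩ := h
  refine ⟨e :: junk, n, rfl, ?_⟩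
  push_cast [List.length_cons]
  omega

theorem Progress.pop {l : List Entry} {v : ℤ} {e : Entry} (h : Progress (e :: l) v) :
    Progress l (v - 2) := by
  obtain ⟨junk, n, hl, hv⟩ := h
  cases junk with
  | nil =>
    cases n with
    | zero => simp [cleanStack] at hl
    | succ n =>
      simp only [List.nil_append, cleanStack, List.cons.injEq] at hl
      refine ⟨[], n, hl.2, ?_⟩
      push_cast [List.length_nil] at hv ⊢
      omega
  | cons a junk =>
    simp only [List.cons_append, List.cons.injEq] at hl
    refine ⟨junk, n, hl.2, ?_⟩
    push_cast [List.length_cons] at hv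
    omega

/-- A message adds or removes at most one entry. Another entry on top can be counted as junk and
costs two; the loss of a correct entry costs one, and that of a junk entry is a gain. -/
theorem Progress.machStep {o : Bool} {st : (Fin 2 × Fin 2) × List Entry} {v : ℤ}
    (h : Progress st.2 v) (m : Msg) : Progress (machStep o st m).2 (v - 2) := by
  obtain ⟨p, l⟩ := st
  obtain ⟨a, _ | s, b⟩ := m
  · exact h.mono (by omega)
  · rcases l with _ | ⟨⟨o', s', P⟩, l⟩
    · exact h.push _
    · simp only [QSim.machStep]
      split_ifs
      · exact h.pop
      · exact h.push _

theorem pauli_add_self (p : Fin 2 × Fin 2) : p + p = 0 := by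
  revert p
  decide

/-- Whether the top of the stack, or the next correct operation, belongs to `o`. -/
def mine (o : Bool) (l : List Entry) : Prop :=
  if l = cleanStack l.length then l.length.bodd = o else ∃ s P l', l = (o, s, P) :: l'

theorem mine_or (o : Bool) (l : List Entry) : mine o l ∨ mine (!o) l := by
  unfold mine
  split_ifs with h
  · cases o <;> cases l.length.bodd <;> simp
  · rcases l with _ | ⟨⟨o', s, P⟩, l⟩
    · exact absurd rfl h
    · cases o <;> cases o' <;> simp

/-- The correction cancels the pending Pauli operator. On a correct stack the next unitary then
lengthens the correct part by one; otherwise there is junk on top, and its removal gains two. A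
party that does not own the relevant operation makes no call. -/
theorem Progress.machStep_bestMove {o : Bool} {st : (Fin 2 × Fin 2) × List Entry} {v : ℤ}
    (h : Progress st.2 v) {m : Msg} (hm : (m.1, m.2.1) = bestMove o st) :
    (mine o st.2 → Progress (QSim.machStep o st m).2 (v + 1)) ∧
      (¬ mine o st.2 → (QSim.machStep o st m).2 = st.2) := by
  obtain ⟨p, l⟩ := st
  obtain ⟨a, x, b⟩ := m
  simp only [bestMove, Prod.mk.injEq] at hm
  obtain ⟨rfl, hx⟩ := hm
  unfold mine
  by_cases hl : l = cleanStack l.length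
  · simp only [← hl, if_true] at hx ⊢
    obtain ⟨junk, n, hjn, hv⟩ := h
    have hlen := congrArg List.length hjn
    simp only [List.length_append, length_cleanStack] at hlen
    constructor
    · intro ho
      rw [if_pos ho] at hx
      subst hx
      have hnext : (a + a, l) = (a + a, l) → (QSim.machStep o (a, l) (a, some true, b)).2 =
          cleanStack (l.length + 1) := by
        intro _
        have h1 : cleanStack (l.length + 1) = (o, true, a + a) :: l := by
          rw [cleanStack, ← hl, ho, pauli_add_self]
        rw [h1]
        rcases l with _ | ⟨⟨o', s', P⟩, l⟩
        · rfl
        -- The top of a correct stack is a forward call, so a further forward call cannot cancel it.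
        · have hs : s' = true := by
            simp only [List.length_cons, cleanStack, List.cons.injEq, Prod.mk.injEq] at hl
            exact hl.1.2.1
          simp [QSim.machStep, hs]
      rw [hnext rfl]
      refine ⟨[], l.length + 1, rfl, ?_⟩
      push_cast [List.length_nil]
      omega
    · intro ho
      rw [if_neg ho] at hx
      subst hx
      rfl
  · simp only [hl, if_false] at hx ⊢
    rcases l with _ | ⟨⟨o', s', P⟩, l⟩
    · exact absurd rfl hl
    simp only at hx
    constructor
    · rintro ⟨s, P', l', he⟩
      simp only [List.cons.injEq, Prod.mk.injEq] at he
      obtain ⟨⟨rfl, -, -⟩, -⟩ := he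
      rw [if_pos rfl] at hx
      subst hx
      have : (QSim.machStep o' (a, (o', s', P) :: l) (a, some !s', b)).2 = l := by
        simp [QSim.machStep, pauli_add_self]
      rw [this]
      obtain ⟨junk, n, hjn, hv⟩ := h
      cases junk with
      | nil =>
        refine absurd ?_ hl
        simp only [List.nil_append] at hjn
        rw [hjn, length_cleanStack]
      | cons e junk =>
        simp only [List.cons_append, List.cons.injEq] at hjn
        refine ⟨junk, n, hjn.2, ?_⟩
        push_cast [List.length_cons] at hv
        omega
    · intro hm
      have ho : o' ≠ o := by
        rintro rfl
        exact hm ⟨s', P, l, rfl⟩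
      rw [if_neg ho] at hx
      subst hx
      rfl

/-- The owner of step `t` makes progress. -/
def GoodStep (h : ℕ → Msg) (t : ℕ) : Prop := ((h t).1, (h t).2.1) = bestMove t.bodd (mach h t)

-- Two consecutive steps have different owners, and the operation that is due belongs to one of
-- them. If both steps are good, one unit is gained. A bad step loses up to two units and forfeits
-- this gain, hence the factor three.
open Classical in
theorem progress_mach (h : ℕ → Msg) (K : ℕ) : Progress (mach h (2 * K)).2
    (K - 3 * ((Finset.range (2 * K)).filter fun t => ¬ GoodStep h t).card) := by
  induction K with
  | zero => exact ⟨[], 0, rfl, by simp⟩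
  | succ K ih =>
    rw [show 2 * (K + 1) = 2 * K + 1 + 1 by ring, mach, mach, Finset.range_add_one,
      Finset.range_add_one, Finset.filter_insert, Finset.filter_insert]
    set c := ((Finset.range (2 * K)).filter fun t => ¬ GoodStep h t).card with hc
    have hb1 : (2 * K).bodd = false := by simp
    have hb2 : (2 * K + 1).bodd = true := by simp
    have hn1 : 2 * K ∉ (Finset.range (2 * K)).filter fun t => ¬ GoodStep h t := by simp
    have hn2 : ∀ s ⊆ insert (2 * K) ((Finset.range (2 * K)).filter fun t => ¬ GoodStep h t),
        2 * K + 1 ∉ s := by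
      intro s hs hmem
      have := hs hmem
      simp at this
    by_cases h1 : GoodStep h (2 * K) <;> by_cases h2 : GoodStep h (2 * K + 1)
    · simp only [h1, h2, not_true_eq_false, if_false]
      have h3 := ih.machStep_bestMove h1
      rw [GoodStep, mach] at h2
      rcases mine_or (2 * K).bodd (mach h (2 * K)).2 with h4 | h4
      · have h5 := (h3.1 h4).machStep_bestMove h2
        by_cases h6 : mine (2 * K + 1).bodd (machStep (2 * K).bodd (mach h (2 * K)) (h (2 * K))).2
        · exact (h5.1 h6).mono (by push_cast; omega)
        · rw [h5.2 h6]
          exact (h3.1 h4).mono (by push_cast; omega)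
      · by_cases h7 : mine (2 * K).bodd (mach h (2 * K)).2
        · have h5 := (h3.1 h7).machStep_bestMove h2
          by_cases h6 : mine (2 * K + 1).bodd
            (machStep (2 * K).bodd (mach h (2 * K)) (h (2 * K))).2
          · exact (h5.1 h6).mono (by push_cast; omega)
          · rw [h5.2 h6]
            exact (h3.1 h7).mono (by push_cast; omega)
        -- The first party had nothing to do and left the stack alone, so the second party owns the
        -- operation that is due.
        · have h8 := h3.2 h7
          have h5 := Progress.machStep_bestMove (by rw [h8]; exact ih) h2
          refine (h5.1 ?_).mono (by push_cast; omega)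
          rw [h8, hb2]
          rwa [hb1] at h4
    · simp only [h1, h2, not_true_eq_false, if_false, not_false_eq_true, if_true]
      rw [Finset.card_insert_of_notMem (hn2 _ (Finset.subset_insert _ _))]
      have h3 := ih.machStep_bestMove h1
      have h5 : Progress (machStep (2 * K).bodd (mach h (2 * K)) (h (2 * K))).2
          (K - 3 * c) := by
        by_cases h7 : mine (2 * K).bodd (mach h (2 * K)).2
        · exact (h3.1 h7).mono (by omega)
        · rw [h3.2 h7]
          exact ih
      exact (h5.machStep _).mono (by push_cast; omega)
    · simp only [h1, h2, not_true_eq_false, if_false, not_false_eq_true, if_true]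
      rw [Finset.card_insert_of_notMem hn1]
      rw [GoodStep, mach] at h2
      have h4 := ih.machStep (o := (2 * K).bodd) (h (2 * K))
      have h5 := h4.machStep_bestMove h2
      by_cases h6 : mine (2 * K + 1).bodd (machStep (2 * K).bodd (mach h (2 * K)) (h (2 * K))).2
      · exact (h5.1 h6).mono (by push_cast; omega)
      · rw [h5.2 h6]
        exact h4.mono (by push_cast; omega)
    · simp only [h1, h2, not_false_eq_true, if_true]
      rw [Finset.card_insert_of_notMem (hn2 _ subset_rfl), Finset.card_insert_of_notMem hn1]
      exact ((ih.machStep _).machStep _).mono (by push_cast; omega)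

/-! ### The operator of a stack -/

/-- The exponent of a call to the black box. -/
def actSign : Option Bool → ℤ
  | none => 0
  | some true => 1
  | some false => -1

/-- The sum of the exponents of the calls of `o` in a stack. -/
def stackCount (o : Bool) : List Entry → ℤ
  | [] => 0
  | (o', s, _) :: l => (if o' = o then actSign (some s) else 0) + stackCount o l

/-- The sum of the exponents of the calls of `o` in a history. -/
def moveCount (o : Bool) (h : ℕ → Msg) (t : ℕ) : ℤ :=
  ∑ i ∈ Finset.range t, if i.bodd = o then actSign (h i).2.1 else 0

theorem stackCount_machStep (o o' : Bool) (st : (Fin 2 × Fin 2) × List Entry) (m : Msg) :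
    stackCount o (machStep o' st m).2 =
      stackCount o st.2 + if o' = o then actSign m.2.1 else 0 := by
  obtain ⟨p, l⟩ := st
  obtain ⟨a, _ | s, b⟩ := m
  · simp [machStep, actSign]
  · rcases l with _ | ⟨⟨o₁, s₁, P⟩, l⟩
    · simp [machStep, stackCount]
    · simp only [machStep]
      split_ifs with h h2 h2
      · obtain ⟨-, rfl, rfl⟩ := h
        subst h2
        cases s <;> simp [stackCount, actSign]
      · obtain ⟨-, rfl, rfl⟩ := h
        simp [stackCount, h2]
      · simp [stackCount, h2]
        ring
      · simp [stackCount, h2]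

/-- Cancelled calls have opposite exponents. Therefore a party finds the number of its next unitary
from its own messages alone, even when its picture of the stack is wrong. -/
theorem stackCount_mach (o : Bool) (h : ℕ → Msg) (t : ℕ) :
    stackCount o (mach h t).2 = moveCount o h t := by
  induction t with
  | zero => rfl
  | succ t ih =>
    rw [mach, stackCount_machStep, ih, moveCount, moveCount, Finset.sum_range_succ]

section eval

variable {G : Type} [Fintype G] [DecidableEq G]

/-- The unitary of `o` number `c` (starting from `0`), if `U j` are the unitaries of both
parties. -/
def nthUnitary (U : ℕ → Matrix G G ℂ) (o : Bool) (c : ℤ) : Matrix G G ℂ :=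
  if c < 0 then 1 else U (2 * c.toNat + if o then 2 else 1)

/-- The operator of a call of `o` to the black box after `c` previous calls. -/
def moveOp (U : ℕ → Matrix G G ℂ) (o : Bool) (c : ℤ) : Option Bool → Matrix G G ℂ
  | none => 1
  | some true => nthUnitary U o c
  | some false => (nthUnitary U o (c - 1))ᴴ

/-- The operator of a stack. -/
def stackOp (U : ℕ → Matrix G G ℂ) (P : Fin 2 × Fin 2 → Matrix G G ℂ) :
    List Entry → Matrix G G ℂ
  | [] => 1
  | (o, s, p) :: l => moveOp U o (stackCount o l) (some s) * (P p * stackOp U P l)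

/-- A representation of the Pauli group up to signs. -/
structure IsPauliRep (P : Fin 2 × Fin 2 → Matrix G G ℂ) : Prop where
  zero : P 0 = 1
  mul : ∀ p q, ∃ s : ℂ, (s = 1 ∨ s = -1) ∧ P p * P q = s • P (p + q)

variable {U : ℕ → Matrix G G ℂ} {P : Fin 2 × Fin 2 → Matrix G G ℂ}

theorem nthUnitary_mem (hU : ∀ j, U j ∈ Matrix.unitaryGroup G ℂ) (o : Bool) (c : ℤ) :
    nthUnitary U o c ∈ Matrix.unitaryGroup G ℂ := by
  rw [nthUnitary]
  split_ifs
  · exact one_mem _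
  all_goals exact hU _

theorem moveOp_mul_moveOp (hU : ∀ j, U j ∈ Matrix.unitaryGroup G ℂ) (o : Bool) (c : ℤ) (s : Bool) :
    moveOp U o (actSign (some !s) + c) (some s) * moveOp U o c (some !s) = 1 := by
  cases s
  · simp only [moveOp, actSign, Bool.not_false, add_sub_cancel_left]
    exact Matrix.mem_unitaryGroup_iff'.mp (nthUnitary_mem hU o c)
  · simp only [moveOp, actSign, Bool.not_true, neg_add_eq_sub]
    exact Matrix.mem_unitaryGroup_iff.mp (nthUnitary_mem hU o (c - 1))

/-- This is the invariant of the simulation: stack and pending Pauli operator describe the operator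
applied so far, up to sign, for arbitrary messages. When a call cancels the top entry, the Pauli
operator below that entry becomes pending again and merges with the new outcome. -/
theorem stackOp_machStep (hU : ∀ j, U j ∈ Matrix.unitaryGroup G ℂ) (hP : IsPauliRep P) (o : Bool)
    (st : (Fin 2 × Fin 2) × List Entry) (m : Msg) :
    ∃ s : ℂ, (s = 1 ∨ s = -1) ∧
      P m.2.2 * (moveOp U o (stackCount o st.2) m.2.1 * (P m.1 * (P st.1 * stackOp U P st.2))) =
        s • (P (machStep o st m).1 * stackOp U P (machStep o st m).2) := by
  obtain ⟨p, l⟩ := st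
  obtain ⟨a, x, b⟩ := m
  obtain ⟨s₁, hs₁, h₁⟩ := hP.mul a p
  rw [add_comm a p] at h₁
  simp only [← Matrix.mul_assoc (P a), h₁, Matrix.smul_mul, Matrix.mul_smul]
  have key : ∀ x' : Bool, P b * (moveOp U o (stackCount o l) (some x') *
      (P (p + a) * stackOp U P l)) = P b * stackOp U P ((o, x', p + a) :: l) := fun _ => rfl
  rcases x with _ | x
  · obtain ⟨s₂, hs₂, h₂⟩ := hP.mul b (p + a)
    refine ⟨s₁ * s₂, by rcases hs₁ with rfl | rfl <;> rcases hs₂ with rfl | rfl <;> simp, ?_⟩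
    simp only [machStep, moveOp, Matrix.one_mul]
    rw [← Matrix.mul_assoc, h₂, Matrix.smul_mul, smul_smul]
  · rcases l with _ | ⟨⟨o', s', q⟩, l⟩
    · exact ⟨s₁, hs₁, by rw [key]; rfl⟩
    · simp only [machStep]
      split_ifs with h
      · obtain ⟨h0, rfl, rfl⟩ := h
        obtain ⟨s₂, hs₂, h₂⟩ := hP.mul b q
        refine ⟨s₁ * s₂, by rcases hs₁ with rfl | rfl <;> rcases hs₂ with rfl | rfl <;> simp, ?_⟩
        rw [h0, hP.zero, Matrix.one_mul, stackOp, stackCount, if_pos rfl,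
          ← Matrix.mul_assoc (moveOp _ _ _ _) (moveOp _ _ _ _), moveOp_mul_moveOp hU,
          Matrix.one_mul, ← Matrix.mul_assoc, h₂, Matrix.smul_mul, smul_smul]
      · exact ⟨s₁, hs₁, by rw [key]⟩

/-- `U n ⋯ U 1`. -/
def prodUnitaries (U : ℕ → Matrix G G ℂ) : ℕ → Matrix G G ℂ
  | 0 => 1
  | n + 1 => U (n + 1) * prodUnitaries U n

/-- Alice owns half of the entries rounded up, Bob half rounded down; both sides are doubled to
avoid the division. -/
theorem stackCount_cleanStack (o : Bool) (n : ℕ) :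
    2 * stackCount o (cleanStack n) = n - (if n.bodd then 1 else 0) +
      if o = false ∧ n.bodd then 2 else 0 := by
  induction n with
  | zero => simp [cleanStack, stackCount]
  | succ n ih =>
    rw [cleanStack, stackCount, mul_add, ih]
    cases o <;> cases hb : n.bodd <;> simp [hb, actSign] <;> ring

theorem stackOp_cleanStack (hP : IsPauliRep P) (n : ℕ) :
    stackOp U P (cleanStack n) = prodUnitaries U n := by
  induction n with
  | zero => rfl
  | succ n ih =>
    rw [cleanStack, stackOp, hP.zero, Matrix.one_mul, ih, prodUnitaries, moveOp, nthUnitary]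
    have h := stackCount_cleanStack n.bodd n
    rw [if_neg]
    · congr 2
      cases hb : n.bodd <;> simp [hb] at h ⊢ <;> omega
    · cases hb : n.bodd <;> simp [hb] at h ⊢ <;> omega

theorem nthUnitary_eq_one {N : ℕ} (hN : ∀ j, N < j → U j = 1) {o : Bool} {c : ℤ}
    (h : (N : ℤ) < 2 * c + if o then 2 else 1) : nthUnitary U o c = 1 := by
  rw [nthUnitary]
  split_ifs with h1 h2
  · rfl
  · exact hN _ (by rw [if_pos h2] at h; omega)
  · exact hN _ (by rw [if_neg h2] at h; omega)

/-- Each entry lowers the counter by at most one. So a short pile of junk on a long correct stack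
can only contain calls to late unitaries. -/
theorem neg_length_le_stackCount_append (o : Bool) (l l' : List Entry) :
    stackCount o l' - l.length ≤ stackCount o (l ++ l') := by
  induction l with
  | nil => simp
  | cons e l ih =>
    obtain ⟨o', s, p⟩ := e
    push_cast [List.cons_append, stackCount, List.length_cons]
    split_ifs <;> cases s <;> (try simp only [actSign]) <;> omega

theorem prodUnitaries_eq {N : ℕ} (hN : ∀ j, N < j → U j = 1) {n : ℕ} (hn : N ≤ n) :
    prodUnitaries U n = prodUnitaries U N := by
  induction n, hn using Nat.le_induction with
  | base => rfl
  | succ n hn ih => rw [prodUnitaries, ih, hN _ (by omega), Matrix.one_mul]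

/-- If there has been enough progress, then the stack amounts to all unitaries, up to a final Pauli
operator. -/
theorem Progress.exists_stackOp_eq (hP : IsPauliRep P) {N : ℕ} (hN : ∀ j, N < j → U j = 1)
    {l : List Entry} (h : Progress l N) :
    ∃ (s : ℂ) (q : Fin 2 × Fin 2), (s = 1 ∨ s = -1) ∧
      stackOp U P l = s • (P q * prodUnitaries U N) := by
  obtain ⟨junk, n, rfl, hv⟩ := h
  induction junk with
  | nil =>
    refine ⟨1, 0, Or.inl rfl, ?_⟩
    rw [List.nil_append, stackOp_cleanStack hP, hP.zero, Matrix.one_mul, one_smul]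
    exact prodUnitaries_eq hN (by simpa using hv)
  | cons e junk ih =>
    obtain ⟨o, x, p⟩ := e
    push_cast [List.length_cons] at hv
    obtain ⟨s, q, hs, hq⟩ := ih (by omega)
    obtain ⟨s', hs', hq'⟩ := hP.mul p q
    refine ⟨s * s', p + q, by rcases hs with rfl | rfl <;> rcases hs' with rfl | rfl <;> simp, ?_⟩
    have h1 := neg_length_le_stackCount_append o junk (cleanStack n)
    have h2 := stackCount_cleanStack o n
    -- The correct part is longer than `N` by twice the junk, and the junk below has lowered the
    -- counter by at most its length. The unitary called here therefore has a number beyond `N` and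
    -- is the identity.
    have h3 : moveOp U o (stackCount o (junk ++ cleanStack n)) (some x) = 1 := by
      cases x
      · rw [moveOp, nthUnitary_eq_one hN, Matrix.conjTranspose_one]
        cases o <;> cases hb : n.bodd <;> simp [hb] at h2 ⊢ <;> omega
      · rw [moveOp, nthUnitary_eq_one hN]
        cases o <;> cases hb : n.bodd <;> simp [hb] at h2 ⊢ <;> omega
    rw [List.cons_append, stackOp, h3, Matrix.one_mul, hq, Matrix.mul_smul, ← Matrix.mul_assoc,
      hq', Matrix.smul_mul, smul_smul]

end eval

/-! ### The strategy of the parties -/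

section strategy

variable {F : Type} [Field F] [DecidableEq F] {p ε : ℝ}

/-- The number of the parity of a party. -/
def parityOf (o : Bool) : ℕ := if o then 1 else 0

variable (B : BlockCode F p ε) (g : ℕ → F) (ι : Msg → F)

/-- The messages of party `o` in a history. -/
def ownMsgs (o : Bool) (h : ℕ → Msg) (j : ℕ) : Msg := h (2 * j + parityOf o)

/-- The symbol which `o` decodes from the bits `R` received from party `!o` in its block `j`; the
bit of transmission `τ` is `R (τ + 1)`. -/
def recSym (o : Bool) (R : ℕ → Fin 2) (j : ℕ) : F :=
  B.dec fun i => if Even i ∧ i < B.D then R ((2 * j + parityOf (!o)) * B.D + i + 1) else 0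

/-- The history as seen by the owner of step `t`. -/
def estimate (t : ℕ) (R : ℕ → Fin 2) (h : ℕ → Msg) (i : ℕ) : Msg :=
  if i.bodd = t.bodd then h i
  else treeDecode g ι (recSym B t.bodd R) ((t + 1) / 2) (i / 2)

/-- The operation that the owner of step `t` chooses. -/
def decision (t : ℕ) (R : ℕ → Fin 2) (h : ℕ → Msg) : (Fin 2 × Fin 2) × Option Bool :=
  bestMove t.bodd (mach (estimate B g ι t R h) t)

/-- The bit sent in transmission `τ`. -/
def sendBit (τ : ℕ) (h : ℕ → Msg) : Fin 2 :=
  if Even (τ % B.D) then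
    B.enc (conv g ι (ownMsgs (τ / B.D).bodd h) (τ / B.D / 2)) (τ % B.D) else 0

theorem eq_two_mul_add_parityOf (i : ℕ) : 2 * (i / 2) + parityOf i.bodd = i := by
  have := Nat.bodd_add_div2 i
  rw [Nat.div2_val] at this
  rw [parityOf]
  cases hb : i.bodd <;> simp [hb] at this ⊢ <;> omega

variable {B g ι}

theorem recSym_eq {T : ℕ} {R : ℕ → Fin 2} {h : ℕ → Msg} {f : ℕ → Fin 2}
    (hR : ∀ τ < T * B.D, R (τ + 1) = sendBit B g ι τ h + f τ) (o : Bool) {j : ℕ}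
    (hj : 2 * j + parityOf (!o) < T) (hgood : B.good (block B.D f (2 * j + parityOf (!o)))) :
    recSym B o R j = conv g ι (ownMsgs (!o) h) j := by
  refine B.dec_eq _ _ _ hgood fun i hi => ?_
  set t := 2 * j + parityOf (!o) with ht
  have hlt : t * B.D + i < T * B.D := by
    calc t * B.D + i < t * B.D + B.D := by omega
      _ = (t + 1) * B.D := by ring
      _ ≤ T * B.D := Nat.mul_le_mul_right _ hj
  have hD : 0 < B.D := B.odd_D.pos
  have hdiv : (t * B.D + i) / B.D = t := by
    rw [mul_comm, Nat.mul_add_div hD, Nat.div_eq_of_lt i.2, add_zero]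
  have hmod : (t * B.D + i) % B.D = i := by
    rw [mul_comm, Nat.mul_add_mod, Nat.mod_eq_of_lt i.2]
  have htb : t.bodd = !o := by
    rw [ht, parityOf]
    cases o <;> simp
  have ht2 : t / 2 = j := by
    rw [ht, parityOf]
    split_ifs <;> omega
  rw [if_pos ⟨hi, i.2⟩, hR _ hlt, sendBit, hdiv, hmod, if_pos hi, htb, ht2]
  rfl

/-- A party knows its own messages, and the other party has made `(t + 1) / 2` messages before step
`t`, whichever of the two owns step `t`. -/
theorem estimate_eq {t : ℕ} {R : ℕ → Fin 2} {h : ℕ → Msg}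
    (H : ∀ j < (t + 1) / 2, treeDecode g ι (recSym B t.bodd R) ((t + 1) / 2) j =
      ownMsgs (!t.bodd) h j) : mach (estimate B g ι t R h) t = mach h t := by
  refine mach_congr fun i hi => ?_
  rw [estimate]
  split_ifs with hb
  · rfl
  · rw [H (i / 2) (by omega), ownMsgs]
    have : (!t.bodd) = i.bodd := by
      revert hb
      cases i.bodd <;> cases t.bodd <;> simp
    rw [this, eq_two_mul_add_parityOf]

-- A bad step `t` needs a wrongly decoded prefix of length `(t + 1) / 2`, and this length determines
-- `t` among the steps of one party. Corrupted symbols in the two directions sit in disjoint sets of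
-- blocks, so the two bounds add up without an extra factor.
open Classical in
theorem card_not_goodStep_le {K : ℕ} (hg : IsTreeCode g ι K) {R : ℕ → Fin 2} {h : ℕ → Msg}
    {f : ℕ → Fin 2} (hR : ∀ τ < 2 * K * B.D, R (τ + 1) = sendBit B g ι τ h + f τ)
    (hh : ∀ t < 2 * K, ((h t).1, (h t).2.1) = decision B g ι t R h) :
    ((Finset.range (2 * K)).filter fun t => ¬ GoodStep h t).card ≤
      4 * blockErrors B (2 * K) f := by
  set E : Bool → Finset ℕ := fun o => (Finset.range K).filter fun j =>
    conv g ι (ownMsgs (!o) h) j ≠ recSym B o R j with hE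
  have hpar : ∀ o, parityOf o < 2 := fun o => by cases o <;> simp [parityOf]
  have hdec : ∀ o, ((Finset.range (K + 1)).filter fun k => ∃ j < k,
      treeDecode g ι (recSym B o R) k j ≠ ownMsgs (!o) h j).card ≤ 4 * (E o).card := fun o =>
    card_treeDecode_ne_le hg (ownMsgs (!o) h) (recSym B o R)
  have hstep : ∀ o, ((Finset.range (2 * K)).filter fun t => ¬ GoodStep h t ∧ t.bodd = o).card ≤
      ((Finset.range (K + 1)).filter fun k => ∃ j < k,
        treeDecode g ι (recSym B o R) k j ≠ ownMsgs (!o) h j).card := by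
    intro o
    refine Finset.card_le_card_of_injOn (fun t => (t + 1) / 2) ?_ ?_
    · intro t ht
      simp only [Finset.coe_filter, Finset.mem_range, Set.mem_ofPred_eq] at ht ⊢
      refine ⟨by omega, ?_⟩
      by_contra! H
      refine ht.2.1 ?_
      rw [GoodStep, hh t ht.1, decision, estimate_eq]
      rw [ht.2.2]
      exact H
    · intro t ht t' ht' heq
      simp only [Finset.coe_filter, Finset.mem_range, Set.mem_ofPred_eq] at ht ht' heq
      have h1 := eq_two_mul_add_parityOf t
      have h2 := eq_two_mul_add_parityOf t'
      rw [ht.2.2] at h1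
      rw [ht'.2.2] at h2
      have := hpar o
      omega
  have herr : (E false).card + (E true).card ≤ blockErrors B (2 * K) f := by
    have hinj : ∀ o, Function.Injective fun j => 2 * j + parityOf (!o) := fun o a b hab => by
      simp only at hab
      omega
    rw [← Finset.card_image_of_injective (E false) (hinj false),
      ← Finset.card_image_of_injective (E true) (hinj true), blockErrors,
      ← Finset.card_union_of_disjoint]
    · refine Finset.card_le_card ?_
      intro t ht
      have : ∃ o, t ∈ (E o).image fun j => 2 * j + parityOf (!o) := by
        rcases Finset.mem_union.mp ht with h | h
        · exact ⟨_, h⟩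
        · exact ⟨_, h⟩
      obtain ⟨o, hto⟩ := this
      obtain ⟨j, hj, rfl⟩ := Finset.mem_image.mp hto
      simp only [hE, Finset.mem_filter, Finset.mem_range] at hj ⊢
      have := hpar (!o)
      refine ⟨by omega, fun hgood => hj.2 (recSym_eq hR o (by omega) hgood).symm⟩
    · rw [Finset.disjoint_left]
      intro t h1 h2
      obtain ⟨i, -, hi⟩ := Finset.mem_image.mp h1
      obtain ⟨j, -, hj⟩ := Finset.mem_image.mp h2
      simp [parityOf] at hi hj
      omega
  calc _ ≤ ((Finset.range (2 * K)).filter fun t => ¬ GoodStep h t ∧ t.bodd = false).card +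
        ((Finset.range (2 * K)).filter fun t => ¬ GoodStep h t ∧ t.bodd = true).card := by
          refine (Finset.card_le_card ?_).trans (Finset.card_union_le _ _)
          intro t ht
          simp only [Finset.mem_union, Finset.mem_filter] at ht ⊢
          cases t.bodd <;> simp [ht.1, ht.2]
    _ ≤ 4 * (E false).card + 4 * (E true).card :=
      Nat.add_le_add ((hstep false).trans (hdec false)) ((hstep true).trans (hdec true))
    _ ≤ _ := by omega

end strategy

/-! ### The Pauli operators and teleportation -/

/-- The Pauli operator `X ^ q.1 * Z ^ q.2`. -/
def pauliMat (q : Fin 2 × Fin 2) : Matrix (Fin 2) (Fin 2) ℂ :=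
  Matrix.of fun b d => if b = d + q.1 then (if q.2 = 1 ∧ d = 1 then -1 else 1) else 0

theorem pauliMat_zero : pauliMat 0 = 1 := by
  ext b d
  fin_cases b <;> fin_cases d <;> simp [pauliMat]

theorem pauliMat_mul (p q : Fin 2 × Fin 2) :
    ∃ s : ℂ, (s = 1 ∨ s = -1) ∧ pauliMat p * pauliMat q = s • pauliMat (p + q) := by
  refine ⟨if p.2 = 1 ∧ q.1 = 1 then -1 else 1, by split_ifs <;> simp, ?_⟩
  obtain ⟨a, b⟩ := p
  obtain ⟨c, d⟩ := q
  ext i j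
  fin_cases a <;> fin_cases b <;> fin_cases c <;> fin_cases d <;> fin_cases i <;> fin_cases j <;>
    simp [pauliMat, Matrix.mul_apply]

theorem pauliMat_mem_unitary (q : Fin 2 × Fin 2) : pauliMat q ∈ Matrix.unitaryGroup (Fin 2) ℂ := by
  rw [Matrix.mem_unitaryGroup_iff, Matrix.star_eq_conjTranspose]
  obtain ⟨a, b⟩ := q
  ext i j
  fin_cases a <;> fin_cases b <;> fin_cases i <;> fin_cases j <;>
    simp [pauliMat, Matrix.mul_apply]

/-- Exchange two qubits, then apply a Pauli operator to the first. -/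
def fetchMat (q : Fin 2 × Fin 2) : Matrix (Fin 2 × Fin 2) (Fin 2 × Fin 2) ℂ :=
  Matrix.of fun i j => if i.2 = j.1 then pauliMat q i.1 j.2 else 0

theorem fetchMat_isometry (q : Fin 2 × Fin 2) : (fetchMat q)ᴴ * fetchMat q = 1 := by
  obtain ⟨a, b⟩ := q
  ext i j
  obtain ⟨i, i'⟩ := i
  obtain ⟨j, j'⟩ := j
  fin_cases a <;> fin_cases b <;> fin_cases i <;> fin_cases j <;> fin_cases i' <;> fin_cases j' <;>
    simp [fetchMat, pauliMat, Matrix.mul_apply, Fintype.sum_prod_type]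

/-- The amplitude `1 / √2`. -/
def halfAmp : ℂ := ((√2)⁻¹ : ℝ)

theorem halfAmp_mul_self : halfAmp * halfAmp = 1 / 2 := by
  rw [halfAmp, ← Complex.ofReal_mul, ← mul_inv, Real.mul_self_sqrt (by norm_num)]
  norm_num

theorem star_halfAmp : star halfAmp = halfAmp := Complex.conj_ofReal _

/-- The Kraus operator for the outcome `q` of a Bell measurement, after which both qubits
are reset. -/
def bellMat (q : Fin 2 × Fin 2) : Matrix (Fin 2 × Fin 2) (Fin 2 × Fin 2) ℂ :=
  Matrix.of fun i j => if i = 0 then halfAmp * pauliMat q j.2 j.1 else 0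

theorem bellMat_complete : ∑ q, (bellMat q)ᴴ * bellMat q = 1 := by
  have h : ∀ q i j, ((bellMat q)ᴴ * bellMat q) i j =
      1 / 2 * (star (pauliMat q i.2 i.1) * pauliMat q j.2 j.1) := by
    intro q i j
    rw [Matrix.mul_apply, Finset.sum_eq_single 0]
    · simp only [bellMat, Matrix.conjTranspose_apply, Matrix.of_apply, if_true, star_mul',
        star_halfAmp]
      rw [← halfAmp_mul_self]
      ring
    · intro k _ hk
      simp [bellMat, hk]
    · simp
  ext i j
  rw [Matrix.sum_apply]
  simp only [h]
  obtain ⟨i, i'⟩ := i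
  obtain ⟨j, j'⟩ := j
  fin_cases i <;> fin_cases j <;> fin_cases i' <;> fin_cases j' <;>
    simp [pauliMat, Fintype.sum_prod_type] <;> norm_num

/-! ### Placing the state of the protocol into the registers of the simulation -/

section place

variable {G H I : Type}

/-- The state with amplitude `τ g * W (π g) i`. -/
def place (π : G → H) (τ : G → ℂ) (W : Matrix H I ℂ) : Matrix G I ℂ :=
  Matrix.of fun g i => τ g * W (π g) i

theorem place_smul (π : G → H) (τ : G → ℂ) (s : ℂ) (W : Matrix H I ℂ) :
    place π τ (s • W) = s • place π τ W := by
  ext g i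
  simp only [place, Matrix.of_apply, Matrix.smul_apply, smul_eq_mul]
  ring

variable [Fintype G] [Fintype H]

/-- An operator on registers that `π` carries over unchanged, and on which the amplitude `τ` does
not depend, acts on the placed state as it does on the original one. This is how black-box calls are
transferred. -/
theorem actOn_mul_place {W R R' : Type} [Fintype W] [DecidableEq R] [DecidableEq R'] {w : G → W}
    {r : G → R} {put : G → W → G} (h : Splits w r put) {w' : H → W} {r' : H → R'}
    {put' : H → W → H} (h' : Splits w' r' put') {π : G → H} {τ : G → ℂ}
    (hw : ∀ g, w' (π g) = w g) (hπ : ∀ g a, π (put g a) = put' (π g) a)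
    (hτ : ∀ g a, τ (put g a) = τ g) (K : Matrix W W ℂ) (V : Matrix H I ℂ) :
    actOn w r K * place π τ V = place π τ (actOn w' r' K * V) := by
  ext g i
  rw [h.actOn_mul_apply, place, place, Matrix.of_apply, h'.actOn_mul_apply, Finset.mul_sum, hw]
  refine Finset.sum_congr rfl fun a _ => ?_
  rw [Matrix.of_apply, hπ, hτ]
  ring

theorem basisMap_mul_place [DecidableEq G] [DecidableEq H] {f : G → G}
    (hf : Function.Involutive f) {f' : H → H} (hf' : Function.Involutive f') {π : G → H}
    {τ : G → ℂ} (hπ : ∀ g, π (f g) = f' (π g)) (hτ : ∀ g, τ (f g) = τ g) (V : Matrix H I ℂ) :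
    basisMap f * place π τ V = place π τ (basisMap f' * V) := by
  ext g i
  rw [basisMap_mul_apply hf, place, place, Matrix.of_apply, Matrix.of_apply,
    basisMap_mul_apply hf', hπ, hτ]

theorem conj_place_apply [Fintype I] (π : G → H) (τ : G → ℂ) (V : Matrix H I ℂ)
    (σ : Matrix I I ℂ) (g h : G) :
    conj (place π τ V) σ g h = τ g * star (τ h) * conj V σ (π g) (π h) := by
  have h1 : place π τ V = Matrix.of fun g i => τ g * V (π g) i := rfl
  simp only [conj, LinearMap.coe_mk, AddHom.coe_mk, h1, Matrix.mul_apply, Matrix.of_apply,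
    Matrix.conjTranspose_apply, Finset.mul_sum, Finset.sum_mul, star_mul']
  refine Finset.sum_congr rfl fun i _ => Finset.sum_congr rfl fun j _ => ?_
  ring

/-- If the amplitude is the indicator of the image of `emb`, placing is a relabelling of basis
vectors, which the partial trace does not notice. -/
theorem partialTrace_conj_place [Fintype I] {O R R' : Type} [DecidableEq O] [DecidableEq R]
    [DecidableEq R'] {out : G → O} {r : G → R} {out' : H → O} {r' : H → R'} {π : G → H}
    {τ : G → ℂ} {emb : H → G} (hπ : ∀ k, π (emb k) = k) (hτ : ∀ k, τ (emb k) = 1)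
    (hτ' : ∀ g, g ∉ Set.range emb → τ g = 0) (hout : ∀ k, out (emb k) = out' k)
    (hr : ∀ k l, r (emb k) = r (emb l) ↔ r' k = r' l) (V : Matrix H I ℂ) :
    partialTrace out r ∘ₗ conj (place π τ V) = partialTrace out' r' ∘ₗ conj V := by
  have hinj : Function.Injective emb := fun a b hab => by rw [← hπ a, hab, hπ]
  refine LinearMap.ext fun σ => Matrix.ext fun o o' => ?_
  simp only [LinearMap.comp_apply]
  simp only [partialTrace, LinearMap.coe_mk, AddHom.coe_mk, Matrix.of_apply]
  symm
  refine Fintype.sum_of_injective emb hinj _ _ ?_ ?_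
  · intro g hg
    refine Finset.sum_eq_zero fun h _ => ?_
    rw [conj_place_apply, hτ' g hg]
    simp
  · intro k
    refine Fintype.sum_of_injective emb hinj _ _ ?_ ?_
    · intro g hg
      rw [conj_place_apply, hτ' g hg]
      simp
    · intro l
      rw [conj_place_apply, hπ, hπ, hτ, hτ]
      simp only [hout, hr, star_one, one_mul]

theorem actOn_actOn {W R W' R' : Type} [DecidableEq R] [DecidableEq R'] (w : G → W) (r : G → R)
    (w' : W → W') (r' : W → R') (K : Matrix W' W' ℂ) :
    actOn w r (actOn w' r' K) = actOn (fun g => w' (w g)) (fun g => (r' (w g), r g)) K := by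
  ext g h
  simp only [actOn, Matrix.of_apply, Prod.mk.injEq]
  by_cases h1 : r g = r h <;> by_cases h2 : r' (w g) = r' (w h) <;> simp [h1, h2]

end place

/-! ### Teleportation through the entanglement registers -/

section teleport

variable {G H I Y : Type} {T : ℕ}

/-- The amplitude of the contents `a`, `b` of the entangled pair `j`, when the pairs before the
`n`-th have been used and reset. -/
def pairAmp (n j : ℕ) (a b : Fin 2) : ℂ :=
  if j < n then (if a = 0 ∧ b = 0 then 1 else 0) else if a = b then halfAmp else 0

theorem pairAmp_comm (n j : ℕ) (a b : Fin 2) : pairAmp n j a b = pairAmp n j b a := by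
  by_cases h : j < n
  · simp only [pairAmp, h, if_true, and_comm]
  · simp only [pairAmp, h, if_false, eq_comm]

/-- The registers of a simulation, as seen by one of the parties: her and the other copy of the
communication qubit, her and the other entanglement register, and the rest. -/
structure View (G Y : Type) (T : ℕ) where
  u : G → Fin 2
  v : G → Fin 2
  s : G → Fin T → Fin 2
  s' : G → Fin T → Fin 2
  ρ : G → Y

/-- The view of the other party. -/
def View.flip (w : View G Y T) : View G Y T := ⟨w.v, w.u, w.s', w.s, w.ρ⟩

/-- The amplitude when the party holds the communication qubit after `n` teleportations. -/
def View.activeAmp (w : View G Y T) (n : ℕ) (g : G) : ℂ :=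
  (if w.v g = 0 then 1 else 0) * ∏ j : Fin T, pairAmp n j (w.s g j) (w.s' g j)

/-- The amplitude after the party has performed teleportation number `k`. -/
def View.transitAmp (w : View G Y T) (k : Fin T) (g : G) : ℂ :=
  (if w.u g = 0 then 1 else 0) * (if w.v g = 0 then 1 else 0) * (if w.s g k = 0 then 1 else 0) *
    ∏ j ∈ Finset.univ.erase k, pairAmp k j (w.s g j) (w.s' g j)

variable [Fintype G] [Fintype H] {mk : Y → Fin 2 → H}

/-- The state when the party holds the communication qubit. -/
def View.active (w : View G Y T) (mk : Y → Fin 2 → H) (n : ℕ) (W : Matrix H I ℂ) : Matrix G I ℂ :=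
  place (fun g => mk (w.ρ g) (w.u g)) (w.activeAmp n) W

/-- The state when the communication qubit is in the entanglement register of the other party. -/
def View.transit (w : View G Y T) (mk : Y → Fin 2 → H) (k : Fin T) (W : Matrix H I ℂ) :
    Matrix G I ℂ :=
  place (fun g => mk (w.ρ g) (w.s' g k)) (w.transitAmp k) W

/-- `put` changes the communication qubit and the `k`-th entangled qubit of the party. -/
structure View.Access (w : View G Y T) (k : Fin T) (put : G → Fin 2 × Fin 2 → G) : Prop where
  u : ∀ g a, w.u (put g a) = a.1
  v : ∀ g a, w.v (put g a) = w.v g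
  s : ∀ g a, w.s (put g a) = Function.update (w.s g) k a.2
  s' : ∀ g a, w.s' (put g a) = w.s' g
  ρ : ∀ g a, w.ρ (put g a) = w.ρ g

variable {w : View G Y T} {k : Fin T} {put : G → Fin 2 × Fin 2 → G} {R R' : Type} [DecidableEq R]
  [DecidableEq R'] {r : G → R} {cOf : H → Fin 2} {r' : H → R'} {put' : H → Fin 2 → H}

theorem View.Access.prod_erase (h : w.Access k put) (n : ℕ) (g : G) (a : Fin 2 × Fin 2) :
    ∏ j ∈ Finset.univ.erase k, pairAmp n j (w.s (put g a) j) (w.s' (put g a) j) =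
      ∏ j ∈ Finset.univ.erase k, pairAmp n j (w.s g j) (w.s' g j) := by
  refine Finset.prod_congr rfl fun j hj => ?_
  rw [h.s, h.s', Function.update_of_ne (Finset.ne_of_mem_erase hj)]

/-- A Bell measurement teleports the communication qubit up to a Pauli operator. -/
theorem View.Access.bell (h : w.Access k put) (hs : Splits (fun g => (w.u g, w.s g k)) r put)
    (hc : Splits cOf r' put') (hmk : ∀ y a, cOf (mk y a) = a)
    (hput : ∀ y a b, put' (mk y a) b = mk y b) (q : Fin 2 × Fin 2) (W : Matrix H I ℂ) :
    actOn (fun g => (w.u g, w.s g k)) r (bellMat q) * w.active mk k W =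
      (1 / 2 : ℂ) • w.transit mk k (actOn cOf r' (pauliMat q) * W) := by
  ext g i
  rw [hs.actOn_mul_apply, Matrix.smul_apply, View.transit, View.active, place, place,
    Matrix.of_apply, hc.actOn_mul_apply, hmk, smul_eq_mul, Finset.mul_sum, Finset.mul_sum,
    Fintype.sum_prod_type]
  refine Finset.sum_congr rfl fun d _ => ?_
  -- The two halves of the unused pair agree, which fixes the measured half. The factor `1 / 2` is
  -- the product of the amplitudes of the pair and of the measurement.
  rw [hput, Finset.sum_eq_single (w.s' g k)]
  · rw [Matrix.of_apply, h.u, h.ρ, View.activeAmp, h.v,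
      ← Finset.mul_prod_erase _ _ (Finset.mem_univ k), h.prod_erase, h.s, h.s',
      Function.update_self, pairAmp, if_neg (lt_irrefl _), if_pos rfl, View.transitAmp, bellMat,
      Matrix.of_apply, ← halfAmp_mul_self]
    simp only [Prod.mk_eq_zero]
    by_cases h1 : w.u g = 0 <;> by_cases h2 : w.s g k = 0 <;> simp [h1, h2]
    ring_nf
  · intro b _ hb
    rw [Matrix.of_apply, View.activeAmp, ← Finset.mul_prod_erase _ _ (Finset.mem_univ k), h.s, h.s',
      Function.update_self, pairAmp, if_neg (lt_irrefl _), if_neg hb]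
    simp
  · simp

/-- Fetching the communication qubit after the other party has sent it. -/
theorem View.Access.fetch (h : w.Access k put) (hs : Splits (fun g => (w.u g, w.s g k)) r put)
    (hc : Splits cOf r' put') (hmk : ∀ y a, cOf (mk y a) = a)
    (hput : ∀ y a b, put' (mk y a) b = mk y b) (q : Fin 2 × Fin 2) (W : Matrix H I ℂ) :
    actOn (fun g => (w.u g, w.s g k)) r (fetchMat q) * w.flip.transit mk k W =
      w.active mk (k + 1) (actOn cOf r' (pauliMat q) * W) := by
  ext g i
  rw [hs.actOn_mul_apply, View.transit, View.active, place, place,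
    Matrix.of_apply, hc.actOn_mul_apply, hmk, Finset.mul_sum, Fintype.sum_prod_type,
    Finset.sum_eq_single (w.s g k)]
  · refine Finset.sum_congr rfl fun d _ => ?_
    -- For `j ≠ k` the conditions `j < k + 1` and `j < k` are the same: only pair `k` changes its
    -- status.
    have herase : ∏ j ∈ Finset.univ.erase k, pairAmp (k + 1) j (w.s g j) (w.s' g j) =
        ∏ j ∈ Finset.univ.erase k, pairAmp k j (w.s' g j) (w.s g j) := by
      refine Finset.prod_congr rfl fun j hj => ?_
      have : (j : ℕ) ≠ k := fun h => Finset.ne_of_mem_erase hj (Fin.ext h)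
      rw [pairAmp_comm, pairAmp, pairAmp]
      congr 1
      exact propext (by omega)
    have herase' : ∏ j ∈ Finset.univ.erase k,
        pairAmp k j (w.s' (put g (w.s g k, d)) j) (w.s (put g (w.s g k, d)) j) =
        ∏ j ∈ Finset.univ.erase k, pairAmp k j (w.s' g j) (w.s g j) := by
      simp only [pairAmp_comm k _ (w.s' _ _)]
      exact h.prod_erase k g _
    rw [hput, Matrix.of_apply, View.activeAmp, ← Finset.mul_prod_erase _ _ (Finset.mem_univ k),
      herase]
    have hamp : w.flip.transitAmp k (put g (w.s g k, d)) =
        (if w.v g = 0 then 1 else 0) * (if w.s g k = 0 then 1 else 0) *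
          (if w.s' g k = 0 then 1 else 0) *
          ∏ j ∈ Finset.univ.erase k, pairAmp k j (w.s' g j) (w.s g j) := by
      rw [← herase']
      simp only [View.transitAmp, View.flip, h.u, h.v, h.s']
    rw [hamp]
    simp only [View.flip]
    rw [h.s, h.ρ, Function.update_self, pairAmp,
      if_pos (Nat.lt_succ_self _), fetchMat, Matrix.of_apply, if_pos rfl]
    simp only
    by_cases h1 : w.v g = 0 <;> by_cases h2 : w.s g k = 0 <;> by_cases h3 : w.s' g k = 0 <;>
      simp [h1, h2, h3]
    ring
  · intro b _ hb
    refine Finset.sum_eq_zero fun d _ => ?_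
    rw [fetchMat, Matrix.of_apply, if_neg (Ne.symm hb), zero_mul]
  · simp

end teleport

/-! ### The classical registers of the simulation -/

/-- The classical register of a party: the received bits and the own messages. -/
abbrev Store (T n : ℕ) : Type := (Fin n → Fin 2) × (Fin T → Msg)

section store

variable {T n : ℕ}

/-- The received bits. -/
def Store.bits (x : Store T n) (i : ℕ) : Fin 2 := if h : i < n then x.1 ⟨i, h⟩ else 0

/-- The messages. -/
def Store.msgs (x : Store T n) (t : ℕ) : Msg := if h : t < T then x.2 ⟨t, h⟩ else (0, none, 0)

/-- The register with given content. -/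
def toStore (T n : ℕ) (R : ℕ → Fin 2) (h : ℕ → Msg) : Store T n := (fun i => R i, fun t => h t)

theorem bits_toStore {R : ℕ → Fin 2} {h : ℕ → Msg} (hR : ∀ i, n ≤ i → R i = 0) :
    (toStore T n R h).bits = R := by
  funext i
  rw [Store.bits]
  split_ifs with hi
  · rfl
  · exact (hR i (not_lt.mp hi)).symm

theorem msgs_toStore {R : ℕ → Fin 2} {h : ℕ → Msg} (hh : ∀ t, T ≤ t → h t = (0, none, 0)) :
    (toStore T n R h).msgs = h := by
  funext i
  rw [Store.msgs]
  split_ifs with hi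
  · rfl
  · exact (hh i (not_lt.mp hi)).symm

end store

/-- The bits received by `o` before turn `τ`. -/
def maskBits (o : Bool) (τ : ℕ) (R : ℕ → Fin 2) (i : ℕ) : Fin 2 :=
  if i.bodd = o ∧ i < τ then R i else 0

/-- The messages of `o` before turn `τ`. -/
def maskMsgs (D : ℕ) (o : Bool) (τ : ℕ) (h : ℕ → Msg) (t : ℕ) : Msg :=
  if t.bodd = o ∧ t * D < τ then h t else (0, none, 0)

theorem update_maskBits {o : Bool} {τ : ℕ} (hτ : τ.bodd = o) (R : ℕ → Fin 2) :
    Function.update (maskBits o τ R) τ (R τ) = maskBits o (τ + 1) R := by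
  funext i
  by_cases hi : i = τ
  · subst hi
    simp [maskBits, hτ]
  · rw [Function.update_of_ne hi, maskBits, maskBits]
    congr 1
    exact propext (and_congr_right fun _ => by omega)

theorem maskBits_congr {o : Bool} {τ : ℕ} {R R' : ℕ → Fin 2} (h : ∀ i < τ, R i = R' i) :
    maskBits o τ R = maskBits o τ R' := by
  funext i
  rw [maskBits, maskBits]
  split_ifs with hi
  · exact h i hi.2
  · rfl

theorem maskBits_succ_of_ne {o : Bool} {τ : ℕ} (hτ : τ.bodd ≠ o) (R : ℕ → Fin 2) :
    maskBits o (τ + 1) R = maskBits o τ R := by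
  funext i
  rw [maskBits, maskBits]
  congr 1
  refine propext (and_congr_right fun hi => ?_)
  have : i ≠ τ := by
    rintro rfl
    exact hτ hi
  omega

/-! ### The registers of the parties as restrictions of a joint history. -/

section strategy

variable {F : Type} [Field F] [DecidableEq F] {p ε : ℝ}
variable (B : BlockCode F p ε) (g : ℕ → F) (ι : Msg → F) (T : ℕ)

/-- The register of `o` before turn `τ`. -/
def viewStore (o : Bool) (τ : ℕ) (R : ℕ → Fin 2) (h : ℕ → Msg) : Store T (T * B.D) :=
  toStore T (T * B.D) (maskBits o τ R) (maskMsgs B.D o τ h)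

/-- Storing a received bit. -/
def listen (τ : ℕ) (z : Store T (T * B.D) × Fin 2) : Store T (T * B.D) :=
  toStore T (T * B.D) (Function.update z.1.bits τ z.2) z.1.msgs

/-- The operation chosen in turn `τ`. -/
def chosen (τ : ℕ) (z : Store T (T * B.D) × Fin 2) : (Fin 2 × Fin 2) × Option Bool :=
  decision B g ι (τ / B.D) (Function.update z.1.bits τ z.2) z.1.msgs

/-- Storing a received bit and the chosen operation. -/
def prepareMove (τ : ℕ) (z : Store T (T * B.D) × Fin 2) : Store T (T * B.D) :=
  toStore T (T * B.D) (Function.update z.1.bits τ z.2)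
    (Function.update z.1.msgs (τ / B.D) ((chosen B g ι T τ z).1, (chosen B g ι T τ z).2, 0))

/-- Storing the outcome of a teleportation. -/
def storeOutcome (τ : ℕ) (x : Store T (T * B.D)) (m : Fin 2 × Fin 2) : Store T (T * B.D) :=
  toStore T (T * B.D) x.bits (Function.update x.msgs (τ / B.D)
    ((x.msgs (τ / B.D)).1, (x.msgs (τ / B.D)).2.1, m))

/-- The call to the black box which `o` makes after `c` previous calls. -/
def queryOf (o : Bool) (c : ℤ) : Option Bool → Option (ℕ × Bool)
  | none => none
  | some true => if c < 0 then none else some (2 * c.toNat + if o then 2 else 1, false)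
  | some false => if c - 1 < 0 then none else some (2 * (c - 1).toNat + if o then 2 else 1, true)

/-- The call to the black box in turn `τ`. -/
def queryIn (o : Bool) (τ : ℕ) (x : Store T (T * B.D)) : Option (ℕ × Bool) :=
  queryOf o (moveCount o x.msgs (τ / B.D)) (x.msgs (τ / B.D)).2.1

variable {B g ι T} {o : Bool} {τ : ℕ} {R : ℕ → Fin 2} {h : ℕ → Msg}

/-- Because the block length is odd, the first turn of block `t` belongs to the owner of step `t`,
and so do the turns at even offsets, the only ones that the block code uses. -/
theorem bodd_mul_D (t : ℕ) : (t * B.D).bodd = t.bodd := by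
  have : B.D.bodd = true := by
    obtain ⟨k, hk⟩ := B.odd_D
    rw [hk]
    simp [show Nat.bodd 2 = false from rfl]
  rw [Nat.bodd_mul, this, Bool.and_true]

theorem bits_viewStore (hτ : τ ≤ T * B.D) : (viewStore B T o τ R h).bits = maskBits o τ R :=
  bits_toStore fun i hi => by
    rw [maskBits, if_neg (by omega)]

theorem maskMsgs_eq_of_le (hτ : τ ≤ T * B.D) (t : ℕ) (ht : T ≤ t) :
    maskMsgs B.D o τ h t = (0, none, 0) := by
  rw [maskMsgs, if_neg]
  have := Nat.mul_le_mul_right B.D ht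
  omega

theorem msgs_viewStore (hτ : τ ≤ T * B.D) : (viewStore B T o τ R h).msgs = maskMsgs B.D o τ h :=
  msgs_toStore (maskMsgs_eq_of_le hτ)

theorem div_lt_of_lt (hτ : τ < T * B.D) : τ / B.D < T := Nat.div_lt_of_lt_mul (by rwa [mul_comm])

/-- The decision depends only on what its maker knows. -/
theorem decision_mask (t : ℕ) (R : ℕ → Fin 2) (h : ℕ → Msg) :
    decision B g ι t (maskBits t.bodd (t * B.D + 1) R) (maskMsgs B.D t.bodd (t * B.D) h) =
      decision B g ι t R h := by
  have hD : 0 < B.D := B.odd_D.pos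
  rw [decision, decision]
  congr 1
  refine mach_congr fun i hi => ?_
  have hlt : i * B.D < t * B.D := Nat.mul_lt_mul_of_pos_right hi hD
  rw [estimate, estimate]
  split_ifs with hb
  · rw [maskMsgs, if_pos ⟨hb, hlt⟩]
  · rw [treeDecode_congr fun j hj => ?_]
    rw [recSym, recSym]
    congr 1
    funext k
    split_ifs with hk
    · rw [maskBits, if_pos]
      set s := 2 * j + parityOf (!t.bodd) with hs
      have hst : s < t := by
        have h2 := eq_two_mul_add_parityOf t
        have h3 : parityOf t.bodd + parityOf (!t.bodd) = 1 := by cases t.bodd <;> simp [parityOf]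
        have h4 : parityOf t.bodd < 2 := by cases t.bodd <;> simp [parityOf]
        omega
      constructor
      · have hsb : s.bodd = !t.bodd := by
          rw [hs]
          cases t.bodd <;> simp [parityOf]
        have hkb : k.bodd = false := by
          obtain ⟨a, rfl⟩ := hk.1
          rw [← two_mul]
          simp [show Nat.bodd 2 = false from rfl]
        rw [Nat.bodd_succ, Nat.bodd_add, bodd_mul_D, hsb, hkb]
        simp
      · have : (s + 1) * B.D ≤ t * B.D := Nat.mul_le_mul_right _ hst
        rw [add_mul] at this
        omega
    · rfl

/-- At even offsets the sender in turn `τ` owns the block, and the tree code is causal. The bit is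
thus a function of messages that the sender has already stored. -/
theorem sendBit_mask (τ : ℕ) (h : ℕ → Msg) :
    sendBit B g ι τ (maskMsgs B.D τ.bodd (τ + 1) h) = sendBit B g ι τ h := by
  rw [sendBit, sendBit]
  split_ifs with he
  · congr 1
    refine conv_congr (fun _ _ => rfl) fun j hj => ?_
    have hdm : τ / B.D * B.D + τ % B.D = τ := by
      rw [mul_comm]
      exact Nat.div_add_mod τ B.D
    rw [ownMsgs, ownMsgs, maskMsgs, if_pos]
    constructor
    · have hb : τ.bodd = (τ / B.D).bodd := by
        conv_lhs => rw [← hdm]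
        obtain ⟨a, ha⟩ := he
        rw [Nat.bodd_add, bodd_mul_D, ha, ← two_mul]
        simp [show Nat.bodd 2 = false from rfl]
      rw [hb]
      cases (τ / B.D).bodd <;> simp [parityOf]
    · have h2 := eq_two_mul_add_parityOf (τ / B.D)
      have h3 : (2 * j + parityOf (τ / B.D).bodd) * B.D ≤ τ / B.D * B.D :=
        Nat.mul_le_mul_right _ (by omega)
      omega
  · rfl

theorem chosen_viewStore (hτ : τ < T * B.D) (hb : τ.bodd = o) (hd : B.D ∣ τ) :
    chosen B g ι T τ (viewStore B T o τ R h, R τ) = decision B g ι (τ / B.D) R h := by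
  rw [chosen, bits_viewStore hτ.le, msgs_viewStore hτ.le, update_maskBits hb]
  have h1 : τ / B.D * B.D = τ := Nat.div_mul_cancel hd
  have h2 := decision_mask (B := B) (g := g) (ι := ι) (τ / B.D) R h
  rwa [h1, ← bodd_mul_D (B := B), h1, hb] at h2

theorem maskMsgs_update_self {D : ℕ} {m : Msg} (hD : 0 < D) (hb : (τ / D).bodd = o) (hd : D ∣ τ) :
    Function.update (maskMsgs D o τ h) (τ / D) m =
      maskMsgs D o (τ + 1) (Function.update h (τ / D) m) := by
  have h1 : τ / D * D = τ := Nat.div_mul_cancel hd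
  funext i
  rw [maskMsgs]
  by_cases hi : i = τ / D
  · subst hi
    rw [Function.update_self, Function.update_self, if_pos ⟨hb, by omega⟩]
  · rw [Function.update_of_ne hi, Function.update_of_ne hi, maskMsgs]
    congr 1
    refine propext (and_congr_right fun _ => ?_)
    have : i * D ≠ τ := by
      intro h
      rw [← h1] at h
      exact hi (Nat.eq_of_mul_eq_mul_right hD h)
    omega

/-- Together with the next lemmas: what the party computes from its own register is the restriction
of the updated joint history. The outcome entry is provisionally `0` until the measurement has been
made. -/
theorem prepareMove_viewStore (hτ : τ < T * B.D) (hb : τ.bodd = o) (hd : B.D ∣ τ) :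
    prepareMove B g ι T τ (viewStore B T o τ R h, R τ) =
      viewStore B T o (τ + 1) R (Function.update h (τ / B.D)
        ((decision B g ι (τ / B.D) R h).1, (decision B g ι (τ / B.D) R h).2, 0)) := by
  rw [prepareMove, chosen_viewStore hτ hb hd, bits_viewStore hτ.le, msgs_viewStore hτ.le,
    update_maskBits hb, maskMsgs_update_self B.odd_D.pos ?_ hd, viewStore]
  rw [← bodd_mul_D (B := B), Nat.div_mul_cancel hd, hb]

theorem queryIn_viewStore (hτ : τ < T * B.D) (hb : τ.bodd = o) (hd : B.D ∣ τ) (m : Msg) :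
    queryIn B T o τ (viewStore B T o (τ + 1) R (Function.update h (τ / B.D) m)) =
      queryOf o (moveCount o h (τ / B.D)) m.2.1 := by
  have h1 : τ / B.D * B.D = τ := Nat.div_mul_cancel hd
  have hb' : (τ / B.D).bodd = o := by rw [← bodd_mul_D (B := B), h1, hb]
  rw [queryIn, msgs_viewStore hτ, maskMsgs, if_pos ⟨hb', by omega⟩, Function.update_self]
  congr 1
  refine Finset.sum_congr rfl fun i hi => ?_
  rw [Finset.mem_range] at hi
  split_ifs with hio
  · rw [maskMsgs, if_pos, Function.update_of_ne hi.ne]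
    have := Nat.mul_lt_mul_of_pos_right hi B.odd_D.pos
    exact ⟨hio, by omega⟩
  · rfl

theorem storeOutcome_viewStore (hτ : τ < T * B.D) (hb : τ.bodd = o) (hd : B.D ∣ τ) (m : Msg)
    (b : Fin 2 × Fin 2) :
    storeOutcome B T τ (viewStore B T o (τ + 1) R (Function.update h (τ / B.D) m)) b =
      viewStore B T o (τ + 1) R (Function.update h (τ / B.D) (m.1, m.2.1, b)) := by
  have h1 : τ / B.D * B.D = τ := Nat.div_mul_cancel hd
  have hb' : (τ / B.D).bodd = o := by rw [← bodd_mul_D (B := B), h1, hb]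
  rw [storeOutcome, bits_viewStore hτ, msgs_viewStore hτ, maskMsgs, if_pos ⟨hb', by omega⟩,
    Function.update_self, viewStore, ← maskMsgs_update_self B.odd_D.pos hb' hd,
    ← maskMsgs_update_self B.odd_D.pos hb' hd, Function.update_idem]

theorem listen_viewStore (hτ : τ < T * B.D) (hb : τ.bodd = o) (hd : ¬ B.D ∣ τ) :
    listen B T τ (viewStore B T o τ R h, R τ) = viewStore B T o (τ + 1) R h := by
  rw [listen, bits_viewStore hτ.le, msgs_viewStore hτ.le, update_maskBits hb, viewStore]
  congr 1
  funext i
  rw [maskMsgs, maskMsgs]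
  congr 1
  refine propext (and_congr_right fun _ => ?_)
  have : i * B.D ≠ τ := by
    rintro rfl
    exact hd (Dvd.intro_left _ rfl)
  omega

theorem sendBit_viewStore (hτ : τ < T * B.D) (hb : τ.bodd = o) :
    sendBit B g ι τ (viewStore B T o (τ + 1) R h).msgs = sendBit B g ι τ h := by
  rw [msgs_viewStore hτ, ← hb, sendBit_mask]

theorem viewStore_congr_bits {R' : ℕ → Fin 2} (hR : ∀ i < τ, R i = R' i) :
    viewStore B T o τ R h = viewStore B T o τ R' h := by
  rw [viewStore, viewStore, maskBits_congr hR]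

theorem viewStore_succ_of_ne (hb : τ.bodd ≠ o) {h' : ℕ → Msg} (hh : ∀ t, t * B.D ≠ τ → h t = h' t) :
    viewStore B T o (τ + 1) R h' = viewStore B T o τ R h := by
  rw [viewStore, viewStore, maskBits_succ_of_ne hb]
  congr 1
  funext i
  rw [maskMsgs, maskMsgs]
  by_cases hi : i.bodd = o
  · have hne : i * B.D ≠ τ := by
      rintro rfl
      rw [bodd_mul_D] at hb
      exact hb hi
    rw [hh i hne]
    congr 1
    exact propext (and_congr_right fun _ => by omega)
  · rw [if_neg (fun h => hi h.1), if_neg (fun h => hi h.1)]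

/-! ### The joint history -/

/-- The bits received and the messages made so far. -/
abbrev Log : Type := (ℕ → Fin 2) × (ℕ → Msg)

variable (B g ι)

/-- The messages after turn `τ`, in which a teleportation has the outcome `m`. -/
def nextMsgs (τ : ℕ) (J : Log) (m : Fin 2 × Fin 2) : ℕ → Msg :=
  if B.D ∣ τ then Function.update J.2 (τ / B.D)
    ((decision B g ι (τ / B.D) J.1 J.2).1, (decision B g ι (τ / B.D) J.1 J.2).2, m)
  else J.2

/-- The log after turn `τ` and the following transmission, with outcome `m` and noise `f`. -/
def nextLog (τ : ℕ) (J : Log) (a : Fin 2 × (Fin 2 × Fin 2)) : Log :=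
  (Function.update J.1 (τ + 1) (sendBit B g ι τ (nextMsgs B g ι τ J a.2) + a.1),
    nextMsgs B g ι τ J a.2)

/-- The log before turn `τ`. -/
def logAt (ω : ℕ → Fin 2 × (Fin 2 × Fin 2)) : ℕ → Log
  | 0 => (fun _ => 0, fun _ => (0, none, 0))
  | τ + 1 => nextLog B g ι τ (logAt ω τ) (ω τ)

variable {B g ι}

theorem logAt_congr {ω ω' : ℕ → Fin 2 × (Fin 2 × Fin 2)} {τ : ℕ} (H : ∀ i < τ, ω i = ω' i) :
    logAt B g ι ω τ = logAt B g ι ω' τ := by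
  induction τ with
  | zero => rfl
  | succ τ ih => rw [logAt, logAt, ih fun i hi => H i (by omega), H τ (by omega)]

variable {ω : ℕ → Fin 2 × (Fin 2 × Fin 2)}

/-- Turn `τ'` writes only the bit `τ' + 1`, so bits already received are final. -/
theorem logAt_bits (τ i : ℕ) (hi : i ≤ τ) :
    ∀ τ', τ ≤ τ' → (logAt B g ι ω τ').1 i = (logAt B g ι ω τ).1 i := by
  intro τ' h
  induction τ', h using Nat.le_induction with
  | base => rfl
  | succ τ' h ih =>
    rw [logAt, nextLog, ← ih]
    exact Function.update_of_ne (by omega) _ _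

theorem logAt_msgs (τ t : ℕ) (hi : t * B.D < τ) :
    ∀ τ', τ ≤ τ' → (logAt B g ι ω τ').2 t = (logAt B g ι ω τ).2 t := by
  intro τ' h
  induction τ', h using Nat.le_induction with
  | base => rfl
  | succ τ' h ih =>
    rw [logAt, nextLog, ← ih]
    simp only [nextMsgs]
    split_ifs with hd
    · rw [Function.update_of_ne]
      rintro rfl
      rw [Nat.div_mul_cancel hd] at hi
      omega
    · rfl

theorem decision_congr {t : ℕ} {R R' : ℕ → Fin 2} {h h' : ℕ → Msg}
    (hR : ∀ i ≤ t * B.D, R i = R' i) (hh : ∀ i < t, h i = h' i) :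
    decision B g ι t R h = decision B g ι t R' h' := by
  rw [← decision_mask t R h, ← decision_mask t R' h']
  congr 1
  · exact maskBits_congr fun i hi => hR i (by omega)
  · funext i
    rw [maskMsgs, maskMsgs]
    split_ifs with hi
    · exact hh i (lt_of_mul_lt_mul_right hi.2 (Nat.zero_le _))
    · rfl

/-- In the final log every message has been chosen by the strategy. -/
theorem logAt_decision {t : ℕ} (ht : t < T) :
    (((logAt B g ι ω (T * B.D)).2 t).1, ((logAt B g ι ω (T * B.D)).2 t).2.1) =
      decision B g ι t (logAt B g ι ω (T * B.D)).1 (logAt B g ι ω (T * B.D)).2 := by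
  have hD := B.odd_D.pos
  have hlt : t * B.D < T * B.D := Nat.mul_lt_mul_of_pos_right ht hD
  rw [logAt_msgs (t * B.D + 1) t (by omega) _ hlt, logAt, nextLog]
  simp only [nextMsgs]
  rw [if_pos (Dvd.intro_left _ rfl), Nat.mul_div_cancel _ hD, Function.update_self]
  refine decision_congr (fun i hi => ?_) fun i hi => ?_
  · rw [logAt_bits (t * B.D) i hi _ hlt.le]
  · rw [logAt_msgs (t * B.D) i (Nat.mul_lt_mul_of_pos_right hi hD) _ hlt.le]

/-- In the final log every bit has been sent according to the strategy. -/
theorem logAt_sendBit {τ : ℕ} (hτ : τ < T * B.D) :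
    (logAt B g ι ω (T * B.D)).1 (τ + 1) =
      sendBit B g ι τ (logAt B g ι ω (T * B.D)).2 + (ω τ).1 := by
  rw [logAt_bits (τ + 1) (τ + 1) le_rfl _ hτ, logAt, nextLog]
  simp only [Function.update_self]
  congr 1
  rw [← sendBit_mask τ (logAt B g ι ω (T * B.D)).2, ← sendBit_mask]
  congr 1
  funext i
  rw [maskMsgs, maskMsgs]
  split_ifs with hi
  · rw [logAt_msgs (τ + 1) i hi.2 _ hτ, logAt, nextLog]
  · rfl

end strategy

/-! ### Instruments with deterministic classical part -/

/-- The instrument which for each outcome `m` applies the Kraus operator `K z m` and changes the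
classical value `z` to `f z m`. -/
def branch {Z H M : Type} [Fintype Z] [DecidableEq Z] [Fintype H] [DecidableEq H] [Fintype M]
    (f : Z → M → Z) (K : Z → M → Matrix H H ℂ) (hK : ∀ z, ∑ m, (K z m)ᴴ * K z m = 1) :
    Instrument Z H where
  card := Fintype.card M
  op z z' k := if z' = f z ((Fintype.equivFin M).symm k) then K z ((Fintype.equivFin M).symm k)
    else 0
  complete z := by
    rw [Finset.sum_comm, ← hK z, ← (Fintype.equivFin M).symm.sum_comp]
    refine Finset.sum_congr rfl fun k _ => ?_
    rw [Finset.sum_eq_single (f z ((Fintype.equivFin M).symm k))]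
    · simp
    · intro z' _ hz'
      simp [hz']
    · simp

theorem conj_zero {G H : Type} [Fintype G] [Fintype H] : conj (0 : Matrix H G ℂ) = 0 := by
  ext1 ρ
  ext1
  simp [conj]

theorem actOn_zero {G W R : Type} [DecidableEq R] (w : G → W) (r : G → R) :
    actOn w r (0 : Matrix W W ℂ) = 0 := by
  ext
  simp [actOn]

namespace Simulator

variable {q : ℕ} (S : Simulator q) {N mA mB dE : ℕ}

theorem krausMap_single {n : ℕ}
    (F : S.Cl → S.Cl → Fin n → Matrix (S.Reg mA mB dE) (S.Reg mA mB dE) ℂ) (z : S.Cl)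
    (ρ : Matrix (S.Reg mA mB dE) (S.Reg mA mB dE) ℂ) (z' : S.Cl) :
    S.krausMap F (Pi.single z ρ) z' = ∑ k, conj (F z z' k) ρ := by
  rw [krausMap, LinearMap.pi_apply, LinearMap.sum_apply, Finset.sum_eq_single z]
  · rw [LinearMap.sum_apply]
    simp
  · intro y _ hy
    rw [LinearMap.sum_apply]
    simp [Pi.single_eq_of_ne hy]
  · simp

/-- An operator on Alice's free registers. -/
def liftA (K : Matrix (Fin 2 × Fin 2 × S.SA × S.TA) (Fin 2 × Fin 2 × S.SA × S.TA) ℂ) :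
    Matrix (S.Reg mA mB dE) (S.Reg mA mB dE) ℂ :=
  actOn (fun g => (g.1.c, g.1.c', g.1.s, g.1.t)) (fun g => ((g.1.a, g.1.a'), g.2.1, g.2.2)) K

/-- An operator on Bob's free registers. -/
def liftB (K : Matrix (Fin 2 × S.SB × S.TB) (Fin 2 × S.SB × S.TB) ℂ) :
    Matrix (S.Reg mA mB dE) (S.Reg mA mB dE) ℂ :=
  actOn (fun g => (g.2.1.c, g.2.1.s, g.2.1.t)) (fun g => (g.1, (g.2.1.b, g.2.1.b'), g.2.2)) K

variable (Q : NoiselessProtocol N mA mB)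

theorem stepA_branch {M : Type} [Fintype M] (f : S.X × Fin q → M → S.X × Fin q)
    (K : S.X × Fin q → M → Matrix (Fin 2 × Fin 2 × S.SA × S.TA) (Fin 2 × Fin 2 × S.SA × S.TA) ℂ)
    (hK : ∀ z, ∑ m, (K z m)ᴴ * K z m = 1) (x : S.X) (y : S.Y) (u : Fin q)
    (ρ : Matrix (S.Reg mA mB dE) (S.Reg mA mB dE) ℂ) :
    S.stepA Q (.apply (branch f K hK)) (Pi.single (x, y, u) ρ) =
      ∑ m, Pi.single ((f (x, u) m).1, y, (f (x, u) m).2) (conj (S.liftA (K (x, u) m)) ρ) := by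
  funext ⟨x', y', u'⟩
  rw [stepA, krausMap_single, Finset.sum_apply, ← (Fintype.equivFin M).symm.sum_comp]
  refine Finset.sum_congr rfl fun k _ => ?_
  simp only [branch]
  set m := (Fintype.equivFin M).symm k
  by_cases h : (x', y', u') = ((f (x, u) m).1, y, (f (x, u) m).2)
  · rw [← h, Pi.single_eq_same]
    simp only [Prod.mk.injEq] at h
    obtain ⟨rfl, rfl, rfl⟩ := h
    simp only [Prod.mk.eta, if_true]
    rfl
  · rw [Pi.single_eq_of_ne h]
    split_ifs with h1 h2
    · exact absurd (by rw [← h2, h1]) h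
    · rw [actOn_zero, conj_zero]
      rfl
    · rw [conj_zero]
      rfl

theorem stepB_branch {M : Type} [Fintype M] (f : S.Y × Fin q → M → S.Y × Fin q)
    (K : S.Y × Fin q → M → Matrix (Fin 2 × S.SB × S.TB) (Fin 2 × S.SB × S.TB) ℂ)
    (hK : ∀ z, ∑ m, (K z m)ᴴ * K z m = 1) (x : S.X) (y : S.Y) (u : Fin q)
    (ρ : Matrix (S.Reg mA mB dE) (S.Reg mA mB dE) ℂ) :
    S.stepB Q (.apply (branch f K hK)) (Pi.single (x, y, u) ρ) =
      ∑ m, Pi.single (x, (f (y, u) m).1, (f (y, u) m).2) (conj (S.liftB (K (y, u) m)) ρ) := by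
  funext ⟨x', y', u'⟩
  rw [stepB, krausMap_single, Finset.sum_apply, ← (Fintype.equivFin M).symm.sum_comp]
  refine Finset.sum_congr rfl fun k _ => ?_
  simp only [branch]
  set m := (Fintype.equivFin M).symm k
  by_cases h : (x', y', u') = (x, (f (y, u) m).1, (f (y, u) m).2)
  · rw [← h, Pi.single_eq_same]
    simp only [Prod.mk.injEq] at h
    obtain ⟨rfl, rfl, rfl⟩ := h
    simp only [Prod.mk.eta, if_true]
    rfl
  · rw [Pi.single_eq_of_ne h]
    split_ifs with h1 h2
    · exact absurd (by rw [← h2, h1]) h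
    · rw [actOn_zero, conj_zero]
      rfl
    · rw [conj_zero]
      rfl

theorem stepA_query (f : S.X → Option (ℕ × Bool)) (z : S.Cl)
    (ρ : Matrix (S.Reg mA mB dE) (S.Reg mA mB dE) ℂ) :
    S.stepA Q (.query f) (Pi.single z ρ) =
      Pi.single z (conj (callBox (S.boxA Q) (f z.1)) ρ) := by
  funext z'
  rw [stepA, krausMap_single, Fin.sum_univ_one]
  by_cases h : z = z'
  · subst h
    rw [if_pos rfl, Pi.single_eq_same]
  · rw [if_neg h, Pi.single_eq_of_ne (Ne.symm h), conj_zero]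
    rfl

theorem stepB_query (f : S.Y → Option (ℕ × Bool)) (z : S.Cl)
    (ρ : Matrix (S.Reg mA mB dE) (S.Reg mA mB dE) ℂ) :
    S.stepB Q (.query f) (Pi.single z ρ) =
      Pi.single z (conj (callBox (S.boxB Q) (f z.2.1)) ρ) := by
  funext z'
  rw [stepB, krausMap_single, Fin.sum_univ_one]
  by_cases h : z = z'
  · subst h
    rw [if_pos rfl, Pi.single_eq_same]
  · rw [if_neg h, Pi.single_eq_of_ne (Ne.symm h), conj_zero]
    rfl

theorem noise_single (W : Fin q → Fin q → ℝ) (x : S.X) (y : S.Y) (u : Fin q)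
    (ρ : Matrix (S.Reg mA mB dE) (S.Reg mA mB dE) ℂ) :
    S.noise W (Pi.single (x, y, u) ρ) =
      ∑ u', (W u u' : ℂ) • (Pi.single (x, y, u') ρ : S.CQ mA mB dE) := by
  funext ⟨x', y', u'⟩
  rw [noise, LinearMap.pi_apply, LinearMap.sum_apply, Finset.sum_apply]
  simp only [LinearMap.smul_apply, LinearMap.proj_apply, Pi.smul_apply]
  by_cases h : x' = x ∧ y' = y
  · obtain ⟨rfl, rfl⟩ := h
    rw [Finset.sum_eq_single u, Finset.sum_eq_single u', Pi.single_eq_same, Pi.single_eq_same]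
    · intro b _ hb
      rw [Pi.single_eq_of_ne (by simpa using Ne.symm hb), smul_zero]
    · simp
    · intro b _ hb
      rw [Pi.single_eq_of_ne (by simpa using hb), smul_zero]
    · simp
  · rw [Finset.sum_eq_zero, Finset.sum_eq_zero]
    · intro b _
      rw [Pi.single_eq_of_ne, smul_zero]
      simp only [ne_eq, Prod.mk.injEq]
      tauto
    · intro b _
      rw [Pi.single_eq_of_ne, smul_zero]
      simp only [ne_eq, Prod.mk.injEq]
      tauto

end Simulator

theorem mul_mem_unitary {G : Type} [Fintype G] [DecidableEq G] {U V : Matrix G G ℂ}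
    (hU : U ∈ Matrix.unitaryGroup G ℂ) (hV : V ∈ Matrix.unitaryGroup G ℂ) :
    U * V ∈ Matrix.unitaryGroup G ℂ :=
  mul_mem hU hV

/-! ### The protocol with registers for the result -/

section core

set_option synthInstance.maxSize 1024

/-- The registers `A B C` of the protocol, the registers for the result, and the reference. -/
abbrev Core (mA mB dE : ℕ) : Type := ABC mA mB × ABC mA mB × Fin dE

variable {N mA mB dE : ℕ} (Q : NoiselessProtocol N mA mB)

/-- Alice's unitary. -/
def coreA (j : ℕ) : Matrix (Core mA mB dE) (Core mA mB dE) ℂ :=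
  actOn (fun k => (k.1.1, k.1.2.2)) (fun k => (k.1.2.1, k.2)) (Q.UA j).1

/-- Bob's unitary. -/
def coreB (j : ℕ) : Matrix (Core mA mB dE) (Core mA mB dE) ℂ :=
  actOn (fun k => (k.1.2.1, k.1.2.2)) (fun k => (k.1.1, k.2)) (Q.UB j).1

/-- Exchange of `A C` with the registers for the result. -/
def coreSwapA (k : Core mA mB dE) : Core mA mB dE :=
  ((k.2.1.1, k.1.2.1, k.2.1.2.2), (k.1.1, k.2.1.2.1, k.1.2.2), k.2.2)

/-- Exchange of `B` with the register for the result. -/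
def coreSwapB (k : Core mA mB dE) : Core mA mB dE :=
  ((k.1.1, k.2.1.2.1, k.1.2.2), (k.2.1.1, k.1.2.1, k.2.1.2.2), k.2.2)

/-- The unitaries of the embedded protocol. -/
def coreBox (j : ℕ) : Matrix (Core mA mB dE) (Core mA mB dE) ℂ :=
  if j = N + 1 then basisMap coreSwapA * coreA Q j
  else if j = N then basisMap coreSwapB * coreB Q j
  else if j ≤ N then (if Odd j then coreA Q j else coreB Q j)
  else 1

/-- A Pauli operator on `C`. -/
def corePauli (p : Fin 2 × Fin 2) : Matrix (Core mA mB dE) (Core mA mB dE) ℂ :=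
  actOn (fun k => k.1.2.2) (fun k => ((k.1.1, k.1.2.1), k.2)) (pauliMat p)

theorem splits_coreA : Splits (fun k : Core mA mB dE => (k.1.1, k.1.2.2))
    (fun k => (k.1.2.1, k.2)) (fun k a => ((a.1, k.1.2.1, a.2), k.2)) where
  w_put _ _ := rfl
  r_put _ _ := rfl
  inj := by
    rintro ⟨⟨a, b, c⟩, k⟩ ⟨⟨a', b', c'⟩, k'⟩ h1 h2
    simp_all

theorem splits_coreB : Splits (fun k : Core mA mB dE => (k.1.2.1, k.1.2.2))
    (fun k => (k.1.1, k.2)) (fun k a => ((k.1.1, a.1, a.2), k.2)) where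
  w_put _ _ := rfl
  r_put _ _ := rfl
  inj := by
    rintro ⟨⟨a, b, c⟩, k⟩ ⟨⟨a', b', c'⟩, k'⟩ h1 h2
    simp_all

theorem splits_coreC : Splits (fun k : Core mA mB dE => k.1.2.2)
    (fun k => ((k.1.1, k.1.2.1), k.2)) (fun k c => ((k.1.1, k.1.2.1, c), k.2)) where
  w_put _ _ := rfl
  r_put _ _ := rfl
  inj := by
    rintro ⟨⟨a, b, c⟩, k⟩ ⟨⟨a', b', c'⟩, k'⟩ h1 h2
    simp_all

theorem coreSwapA_involutive : Function.Involutive (coreSwapA (mA := mA) (mB := mB) (dE := dE)) :=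
  fun _ => rfl

theorem coreSwapB_involutive : Function.Involutive (coreSwapB (mA := mA) (mB := mB) (dE := dE)) :=
  fun _ => rfl

theorem coreBox_mem_unitary (j : ℕ) :
    coreBox (dE := dE) Q j ∈ Matrix.unitaryGroup (Core mA mB dE) ℂ := by
  have hA := (splits_coreA (mA := mA) (mB := mB) (dE := dE)).actOn_mem_unitary (Q.UA j).2
  have hB := (splits_coreB (mA := mA) (mB := mB) (dE := dE)).actOn_mem_unitary (Q.UB j).2
  rw [coreBox]
  split_ifs
  · exact mul_mem_unitary
      (basisMap_mem_unitary coreSwapA_involutive) hA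
  · exact mul_mem_unitary
      (basisMap_mem_unitary coreSwapB_involutive) hB
  · exact hA
  · exact hB
  · exact one_mem _

theorem isPauliRep_corePauli : IsPauliRep (corePauli (mA := mA) (mB := mB) (dE := dE)) where
  zero := by rw [corePauli, pauliMat_zero, splits_coreC.actOn_one]
  mul p q := by
    obtain ⟨s, hs, h⟩ := pauliMat_mul p q
    refine ⟨s, hs, ?_⟩
    rw [corePauli, corePauli, splits_coreC.actOn_mul, h, corePauli]
    ext
    simp only [actOn, Matrix.of_apply, Matrix.smul_apply]
    split_ifs <;> simp

theorem corePauli_mem_unitary (p : Fin 2 × Fin 2) :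
    corePauli p ∈ Matrix.unitaryGroup (Core mA mB dE) ℂ :=
  splits_coreC.actOn_mem_unitary (pauliMat_mem_unitary p)

/-- The isometry which initialises the registers for the result. -/
def corePrep : Matrix (Core mA mB dE) (ABC mA mB × Fin dE) ℂ :=
  Matrix.of fun k i => if (k.1, k.2.2) = i ∧ k.2.1 = 0 then 1 else 0

theorem corePrep_isometry :
    (corePrep : Matrix (Core mA mB dE) (ABC mA mB × Fin dE) ℂ)ᴴ *
      (corePrep : Matrix (Core mA mB dE) (ABC mA mB × Fin dE) ℂ) = 1 := by
  ext i j
  rw [Matrix.mul_apply, Finset.sum_eq_single (i.1, 0, i.2)]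
  · simp only [corePrep, Matrix.conjTranspose_apply, Matrix.of_apply, Matrix.one_apply]
    by_cases h : i = j <;> simp [h]
  · rintro ⟨k, k', e⟩ _ hk
    rw [Matrix.conjTranspose_apply, corePrep, Matrix.of_apply, if_neg, star_zero, zero_mul]
    rintro ⟨rfl, h2⟩
    simp only at h2
    exact hk (by rw [h2])
  · simp

/-- The state after the operations of a history. -/
def coreState (st : (Fin 2 × Fin 2) × List Entry) :
    Matrix (Core mA mB dE) (ABC mA mB × Fin dE) ℂ :=
  (corePauli st.1 * stackOp (coreBox Q) corePauli st.2 :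
    Matrix (Core mA mB dE) (Core mA mB dE) ℂ) *
      (corePrep : Matrix (Core mA mB dE) (ABC mA mB × Fin dE) ℂ)

theorem stackOp_mem_unitary (l : List Entry) :
    stackOp (coreBox (dE := dE) Q) corePauli l ∈ Matrix.unitaryGroup (Core mA mB dE) ℂ := by
  induction l with
  | nil => exact one_mem _
  | cons e l ih =>
    obtain ⟨o, s, p⟩ := e
    refine mul_mem_unitary ?_
      (mul_mem_unitary (corePauli_mem_unitary p) ih)
    cases s
    · exact Unitary.star_mem (nthUnitary_mem (coreBox_mem_unitary Q) _ _)
    · exact nthUnitary_mem (coreBox_mem_unitary Q) _ _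

theorem coreState_isometry (st : (Fin 2 × Fin 2) × List Entry) :
    (coreState (dE := dE) Q st)ᴴ * coreState (dE := dE) Q st = 1 := by
  have h := mul_mem_unitary (corePauli_mem_unitary (mA := mA) (mB := mB) (dE := dE) st.1)
    (stackOp_mem_unitary Q st.2)
  rw [Matrix.mem_unitaryGroup_iff', Matrix.star_eq_conjTranspose] at h
  rw [coreState, Matrix.conjTranspose_mul, Matrix.mul_assoc,
    ← Matrix.mul_assoc (Matrix.conjTranspose _) _ corePrep, h, Matrix.one_mul, corePrep_isometry]

theorem prodUnitaries_coreBox_of_lt {n : ℕ} (hn : n < N) :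
    prodUnitaries (coreBox (dE := dE) Q) n = actOn Prod.fst Prod.snd (Q.evolve n) := by
  have hs : Splits (Prod.fst : Core mA mB dE → _) Prod.snd (fun k a => (a, k.2)) :=
    ⟨fun _ _ => rfl, fun _ _ => rfl, fun _ _ h1 h2 => Prod.ext h1 h2⟩
  induction n with
  | zero =>
    rw [prodUnitaries, NoiselessProtocol.evolve, hs.actOn_one]
  | succ n ih =>
    rw [prodUnitaries, ih (by omega), NoiselessProtocol.evolve, ← hs.actOn_mul, coreBox,
      if_neg (by omega), if_neg (by omega), if_pos hn.le, NoiselessProtocol.unitaryABC]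
    congr 1
    split_ifs
    · rw [actOn_actOn]
      rfl
    · rw [actOn_actOn]
      rfl

/-- Bob's exchange of registers after `U N` commutes with Alice's `U (N + 1)`, which does not touch
`B`. Both exchanges can therefore be moved to the end. -/
theorem prodUnitaries_coreBox (hN : Even N) (hN0 : 0 < N) :
    prodUnitaries (coreBox (dE := dE) Q) (N + 1) =
      basisMap coreSwapA * (basisMap coreSwapB * actOn Prod.fst Prod.snd (Q.evolve (N + 1))) := by
  have hs : Splits (Prod.fst : Core mA mB dE → _) Prod.snd (fun k a => (a, k.2)) :=
    ⟨fun _ _ => rfl, fun _ _ => rfl, fun _ _ h1 h2 => Prod.ext h1 h2⟩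
  obtain ⟨n, rfl⟩ : ∃ n, N = n + 1 := ⟨N - 1, by omega⟩
  have h1 : Q.unitaryABC (n + 1) = actOn (fun g => (g.2.1, g.2.2)) (fun g => g.1)
      (Q.UB (n + 1)).1 := if_neg (by simpa using hN)
  have h2 : Q.unitaryABC (n + 1 + 1) = actOn (fun g => (g.1, g.2.2)) (fun g => g.2.1)
      (Q.UA (n + 1 + 1)).1 := if_pos hN.add_one
  have hA : coreA (dE := dE) Q (n + 1 + 1) =
      actOn Prod.fst Prod.snd (Q.unitaryABC (n + 1 + 1)) := by
    rw [h2, actOn_actOn]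
    rfl
  have hB : coreB (dE := dE) Q (n + 1) = actOn Prod.fst Prod.snd (Q.unitaryABC (n + 1)) := by
    rw [h1, actOn_actOn]
    rfl
  have hcomm : ∀ V : Matrix (Core mA mB dE) (Core mA mB dE) ℂ,
      coreA Q (n + 1 + 1) * (basisMap coreSwapB * V) =
        basisMap coreSwapB * (coreA Q (n + 1 + 1) * V) := by
    intro V
    ext k l
    rw [coreA, splits_coreA.actOn_mul_apply, basisMap_mul_apply coreSwapB_involutive,
      splits_coreA.actOn_mul_apply]
    refine Finset.sum_congr rfl fun a _ => ?_
    rw [basisMap_mul_apply coreSwapB_involutive]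
    rfl
  rw [prodUnitaries, prodUnitaries, prodUnitaries_coreBox_of_lt Q (Nat.lt_succ_self n), coreBox,
    coreBox, if_pos rfl, if_neg (by omega), if_pos rfl, Matrix.mul_assoc, Matrix.mul_assoc, hcomm,
    hA, hB, hs.actOn_mul, hs.actOn_mul]
  rfl

/-- Discarding a factor that is in a fixed normalised pure state `f`. -/
theorem partialTrace_conj_place_snd {A B I O R : Type} [Fintype A] [DecidableEq A] [Fintype B]
    [Fintype I] [DecidableEq O] [DecidableEq R] (out : B → O) (r : B → R) {f : A → ℂ}
    (hf : ∑ a, f a * star (f a) = 1) (M : Matrix B I ℂ) :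
    partialTrace (fun k : A × B => out k.2) (fun k => (k.1, r k.2)) ∘ₗ
      conj (place Prod.snd (fun k => f k.1) M) = partialTrace out r ∘ₗ conj M := by
  refine LinearMap.ext fun σ => Matrix.ext fun o o' => ?_
  simp only [LinearMap.comp_apply]
  simp only [partialTrace, LinearMap.coe_mk, AddHom.coe_mk, Matrix.of_apply, conj_place_apply,
    Fintype.sum_prod_type_right, Prod.mk.injEq]
  refine Finset.sum_congr rfl fun b _ => ?_
  rw [Finset.sum_comm]
  refine Finset.sum_congr rfl fun b' _ => ?_
  split_ifs with h
  · conv_rhs => rw [← one_mul (conj M σ b b'), ← hf, Finset.sum_mul]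
    refine Finset.sum_congr rfl fun a _ => ?_
    rw [Finset.sum_eq_single a]
    · rw [if_pos ⟨h.1, h.2.1, rfl, h.2.2⟩]
    · intro a' _ ha'
      rw [if_neg fun hh => ha' hh.2.2.1.symm]
    · simp
  · refine Finset.sum_eq_zero fun a _ => Finset.sum_eq_zero fun a' _ => ?_
    rw [if_neg fun hh => h ⟨hh.1, hh.2.1, hh.2.2.2⟩]

theorem sum_pauliMat_mul_star (q : Fin 2 × Fin 2) :
    ∑ c, pauliMat q c 0 * star (pauliMat q c 0) = 1 := by
  obtain ⟨a, b⟩ := q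
  fin_cases a <;> fin_cases b <;> simp [pauliMat]

/-- After enough progress the result is that of the protocol. -/
theorem partialTrace_conj_coreState (hN : Even N) (hN0 : 0 < N)
    {st : (Fin 2 × Fin 2) × List Entry} (h : Progress st.2 (N + 1 : ℕ)) :
    partialTrace (fun k : Core mA mB dE => k.2.1) (fun k => (k.1, k.2.2)) ∘ₗ
      conj (coreState Q st) = Q.channel dE := by
  have hU : ∀ j, N + 1 < j → coreBox (dE := dE) Q j = 1 := fun j hj => by
    rw [coreBox, if_neg (by omega), if_neg (by omega), if_neg (by omega)]
  obtain ⟨s, q, hs, hst⟩ := h.exists_stackOp_eq (isPauliRep_corePauli (mA := mA) (mB := mB)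
    (dE := dE)) hU
  obtain ⟨s', hs', hq⟩ := (isPauliRep_corePauli (mA := mA) (mB := mB) (dE := dE)).mul st.1 q
  rw [coreState, hst, Matrix.mul_smul, ← Matrix.mul_assoc, hq, Matrix.smul_mul, Matrix.smul_mul,
    Matrix.smul_mul, smul_smul, conj_smul]
  -- The undetermined sign cancels in the conjugation.
  have hphase : s * s' * star (s * s') = 1 := by
    rcases hs with rfl | rfl <;> rcases hs' with rfl | rfl <;> simp
  rw [hphase, one_smul, prodUnitaries_coreBox Q hN hN0]
  generalize st.1 + q = r
  set E := Q.evolve (N + 1)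
  have hsplit : Splits (Prod.fst : Core mA mB dE → _) Prod.snd (fun k a => (a, k.2)) :=
    ⟨fun _ _ => rfl, fun _ _ => rfl, fun _ _ h1 h2 => Prod.ext h1 h2⟩
  have hE : ∀ (k : Core mA mB dE) i,
      ((actOn Prod.fst Prod.snd E : Matrix (Core mA mB dE) (Core mA mB dE) ℂ) *
        (corePrep : Matrix (Core mA mB dE) (ABC mA mB × Fin dE) ℂ)) k i =
        if k.2.1 = 0 then
          (actOn Prod.fst Prod.snd E : Matrix (ABC mA mB × Fin dE) _ ℂ) (k.1, k.2.2) i else 0 := by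
    intro k i
    rw [hsplit.actOn_mul_apply]
    by_cases hk : k.2.1 = 0
    · rw [if_pos hk]
      simp only [corePrep, Matrix.of_apply, hk, and_true, mul_ite, mul_one, mul_zero, actOn]
      rw [Finset.sum_eq_single i.1]
      · by_cases he : k.2.2 = i.2
        · simp [he]
        · rw [if_neg he, if_neg]
          intro h
          exact he (Prod.ext_iff.mp h).2
      · intro a _ ha
        rw [if_neg]
        intro h
        exact ha (Prod.ext_iff.mp h).1
      · simp
    · rw [if_neg hk]
      refine Finset.sum_eq_zero fun a _ => ?_
      rw [corePrep, Matrix.of_apply, if_neg (fun h => hk h.2), mul_zero]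
  -- After the exchanges `A B C` contain the reset dummy registers, so the state is a product, and
  -- the remaining Pauli operator acts on the factor that is traced out.
  have hW : ∀ (k : Core mA mB dE) i,
      ((corePauli r * (basisMap coreSwapA * (basisMap coreSwapB * actOn Prod.fst Prod.snd E)) :
        Matrix (Core mA mB dE) (Core mA mB dE) ℂ) * (corePrep : Matrix (Core mA mB dE) (ABC mA mB × Fin dE) ℂ)) k i =
      (if k.1.1 = 0 ∧ k.1.2.1 = 0 then pauliMat r k.1.2.2 0 else 0) *
        (actOn Prod.fst Prod.snd E : Matrix (ABC mA mB × Fin dE) _ ℂ) k.2 i := by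
    intro k i
    rw [Matrix.mul_assoc, Matrix.mul_assoc, Matrix.mul_assoc, corePauli,
      splits_coreC.actOn_mul_apply, Finset.sum_eq_single 0]
    · rw [basisMap_mul_apply coreSwapA_involutive, basisMap_mul_apply coreSwapB_involutive, hE]
      simp only [coreSwapA, coreSwapB, Prod.mk_eq_zero, and_true]
      split_ifs <;> simp
    · intro c _ hc
      rw [basisMap_mul_apply coreSwapA_involutive, basisMap_mul_apply coreSwapB_involutive, hE]
      simp [coreSwapA, coreSwapB, hc]
    · simp
  refine (congrArg (fun V => partialTrace (fun k : Core mA mB dE => k.2.1)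
    (fun k => (k.1, k.2.2)) ∘ₗ conj V) (Matrix.ext hW)).trans
    (partialTrace_conj_place_snd (A := ABC mA mB)
      (f := fun a => if a.1 = 0 ∧ a.2.1 = 0 then pauliMat r a.2.2 0 else 0) Prod.fst Prod.snd ?_ _)
  rw [← sum_pauliMat_mul_star r, Fintype.sum_prod_type, Finset.sum_eq_single 0,
    Fintype.sum_prod_type, Finset.sum_eq_single 0]
  · simp
  · intro b _ hb
    simp [hb]
  · simp
  · intro b _ hb
    simp [hb]
  · simp

end core

set_option synthInstance.maxSize 1024

/-! ### The operations of a party -/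

/-- A Pauli operator on the first of two qubits. -/
def startMat (q : Fin 2 × Fin 2) : Matrix (Fin 2 × Fin 2) (Fin 2 × Fin 2) ℂ :=
  Matrix.of fun i j => if i.2 = j.2 then pauliMat q i.1 j.1 else 0

theorem startMat_isometry (q : Fin 2 × Fin 2) : (startMat q)ᴴ * startMat q = 1 := by
  obtain ⟨a, b⟩ := q
  ext i j
  obtain ⟨i, i'⟩ := i
  obtain ⟨j, j'⟩ := j
  fin_cases a <;> fin_cases b <;> fin_cases i <;> fin_cases j <;> fin_cases i' <;> fin_cases j' <;>
    simp [startMat, pauliMat, Matrix.mul_apply, Fintype.sum_prod_type]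

/-- The operator for obtaining the communication qubit before step `t` and correcting it. -/
def receiveMat (t : ℕ) (q : Fin 2 × Fin 2) : Matrix (Fin 2 × Fin 2) (Fin 2 × Fin 2) ℂ :=
  if t = 0 then startMat q else fetchMat q

theorem receiveMat_isometry (t : ℕ) (q : Fin 2 × Fin 2) :
    (receiveMat t q)ᴴ * receiveMat t q = 1 := by
  rw [receiveMat]
  split_ifs
  · exact startMat_isometry q
  · exact fetchMat_isometry q

/-- Access to the communication qubit and the `T` entangled qubits in the register `H`. -/
structure Port (H : Type) (T : ℕ) where
  R : Type
  dR : DecidableEq R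
  w : Fin T → H → Fin 2 × Fin 2
  r : Fin T → H → R
  put : Fin T → H → Fin 2 × Fin 2 → H
  splits : ∀ k, Splits (w k) (r k) (put k)

attribute [instance] Port.dR

/-- An operator on the communication qubit and the `k`-th entangled qubit. -/
def Port.op {H : Type} {T : ℕ} (P : Port H T) (k : Fin T)
    (L : Matrix (Fin 2 × Fin 2) (Fin 2 × Fin 2) ℂ) : Matrix H H ℂ :=
  actOn (P.w k) (P.r k) L

theorem Port.op_complete {H M : Type} [Fintype H] [DecidableEq H] [Fintype M] {T : ℕ}
    (P : Port H T) (k : Fin T) {L : M → Matrix (Fin 2 × Fin 2) (Fin 2 × Fin 2) ℂ}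
    (hL : ∑ m, (L m)ᴴ * L m = 1) : ∑ m, (P.op k (L m))ᴴ * P.op k (L m) = 1 := by
  simp only [Port.op, actOn_conjTranspose, (P.splits k).actOn_mul]
  rw [actOn_sum, hL, (P.splits k).actOn_one]

section moves

variable {F : Type} [Field F] [DecidableEq F] {p ε : ℝ}
variable (B : BlockCode F p ε) (g : ℕ → F) (ι : Msg → F) {T : ℕ}
variable {H : Type} [Fintype H] [DecidableEq H] (P : Port H T)

/-- The operations of the party `o` in turn `τ`. -/
def moves (o : Bool) (τ : ℕ) : List (Step (Store T (T * B.D)) 2 H) :=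
  if hτ : τ < T * B.D then
    if B.D ∣ τ then
      [.apply (branch (M := Unit) (fun z _ => (prepareMove B g ι T τ z, z.2))
          (fun z _ => P.op ⟨τ / B.D - 1, (Nat.sub_le _ _).trans_lt (div_lt_of_lt hτ)⟩
            (receiveMat (τ / B.D) (chosen B g ι T τ z).1))
          (fun z => P.op_complete _ (L := fun _ => receiveMat _ _)
            (by simpa using receiveMat_isometry _ _))),
        .query (queryIn B T o τ),
        .apply (branch (M := Fin 2 × Fin 2)
          (fun z m => (storeOutcome B T τ z.1 m, sendBit B g ι τ (storeOutcome B T τ z.1 m).msgs))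
          (fun _ m => P.op ⟨τ / B.D, div_lt_of_lt hτ⟩ (bellMat m))
          (fun _ => P.op_complete _ bellMat_complete))]
    else
      [.apply (branch (M := Unit)
        (fun z _ => (listen B T τ z, sendBit B g ι τ (listen B T τ z).msgs))
        (fun _ _ => 1) (fun _ => by simp))]
  else []

end moves

/-- The effect of the steps of a party on states with a given classical part. -/
structure IsPartyStep {X H G V : Type} [Fintype X] [DecidableEq X] [Fintype H] [DecidableEq H]
    [Fintype G] [DecidableEq G] [AddCommGroup V] [Module ℂ V]
    (step : Step X 2 H → (V →ₗ[ℂ] V)) (emb : X → Fin 2 → Matrix G G ℂ →ₗ[ℂ] V)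
    (lift : Matrix H H ℂ → Matrix G G ℂ) (box : ℕ → Matrix G G ℂ) : Prop where
  lift_one : lift 1 = 1
  branch : ∀ (M : Type) [Fintype M] (f : X × Fin 2 → M → X × Fin 2)
    (K : X × Fin 2 → M → Matrix H H ℂ) (hK : ∀ z, ∑ m, (K z m)ᴴ * K z m = 1) (x : X) (u : Fin 2)
    (ρ : Matrix G G ℂ), step (.apply (branch f K hK)) (emb x u ρ) =
      ∑ m, emb (f (x, u) m).1 (f (x, u) m).2 (conj (lift (K (x, u) m)) ρ)
  query : ∀ (f : X → Option (ℕ × Bool)) (x : X) (u : Fin 2) (ρ : Matrix G G ℂ),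
    step (.query f) (emb x u ρ) = emb x u (conj (Simulator.callBox box (f x)) ρ)

/-- The joint operation of a sequence of steps. -/
def runSteps {S V : Type} [AddCommGroup V] [Module ℂ V] (step : S → (V →ₗ[ℂ] V)) (l : List S) :
    V →ₗ[ℂ] V :=
  l.foldl (fun f s => step s ∘ₗ f) LinearMap.id

namespace IsPartyStep

variable {F : Type} [Field F] [DecidableEq F] {p ε : ℝ}
variable {B : BlockCode F p ε} {g : ℕ → F} {ι : Msg → F} {T : ℕ}
variable {H G V : Type} [Fintype H] [DecidableEq H] [Fintype G] [DecidableEq G] [AddCommGroup V]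
  [Module ℂ V] {P : Port H T}
variable {step : Step (Store T (T * B.D)) 2 H → (V →ₗ[ℂ] V)}
  {emb : Store T (T * B.D) → Fin 2 → Matrix G G ℂ →ₗ[ℂ] V}
  {lift : Matrix H H ℂ → Matrix G G ℂ} {box : ℕ → Matrix G G ℂ}

theorem runSteps_moves_of_dvd (h : IsPartyStep step emb lift box) (o : Bool) {τ : ℕ}
    (hτ : τ < T * B.D) (hd : B.D ∣ τ) (x : Store T (T * B.D)) (u : Fin 2) (ρ : Matrix G G ℂ) :
    runSteps step (moves B g ι P o τ) (emb x u ρ) =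
      ∑ m, emb (storeOutcome B T τ (prepareMove B g ι T τ (x, u)) m)
        (sendBit B g ι τ (storeOutcome B T τ (prepareMove B g ι T τ (x, u)) m).msgs)
        (conj (lift (P.op ⟨τ / B.D, div_lt_of_lt hτ⟩ (bellMat m)) *
          (Simulator.callBox box (queryIn B T o τ (prepareMove B g ι T τ (x, u))) *
            lift (P.op ⟨τ / B.D - 1, (Nat.sub_le _ _).trans_lt (div_lt_of_lt hτ)⟩
              (receiveMat (τ / B.D) (chosen B g ι T τ (x, u)).1)))) ρ) := by
  rw [moves, dif_pos hτ, if_pos hd, runSteps, List.foldl_cons, List.foldl_cons, List.foldl_cons,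
    List.foldl_nil, LinearMap.comp_apply, LinearMap.comp_apply, LinearMap.comp_apply,
    LinearMap.id_apply, h.branch, Fintype.sum_unique, h.query, h.branch]
  refine Finset.sum_congr rfl fun m _ => ?_
  rw [← conj_comp, ← conj_comp]
  rfl

theorem runSteps_moves_of_not_dvd (h : IsPartyStep step emb lift box) (o : Bool) {τ : ℕ}
    (hτ : τ < T * B.D) (hd : ¬ B.D ∣ τ) (x : Store T (T * B.D)) (u : Fin 2) (ρ : Matrix G G ℂ) :
    runSteps step (moves B g ι P o τ) (emb x u ρ) =
      emb (listen B T τ (x, u)) (sendBit B g ι τ (listen B T τ (x, u)).msgs) ρ := by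
  rw [moves, dif_pos hτ, if_neg hd, runSteps, List.foldl_cons, List.foldl_nil,
    LinearMap.comp_apply, LinearMap.id_apply, h.branch, Fintype.sum_unique, h.lift_one]
  simp [conj]

end IsPartyStep

/-! ### The quantum state after some steps -/

section side

variable {N mA mB dE T : ℕ} {G Y : Type} [Fintype G] [DecidableEq G]

/-- The view of party `o`, where `w` is that of Alice. -/
def View.of (w : View G Y T) (o : Bool) : View G Y T := bif o then w.flip else w

/-- The operations of party `o` with view `w` act on the state of the protocol as expected. -/
structure IsSide (Q : NoiselessProtocol N mA mB) (o : Bool) (w : View G Y T)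
    (mk : Y → Fin 2 → Core mA mB dE)
    (op : Fin T → Matrix (Fin 2 × Fin 2) (Fin 2 × Fin 2) ℂ → Matrix G G ℂ)
    (box : ℕ → Matrix G G ℂ) : Prop where
  bell : ∀ k q (W : Matrix (Core mA mB dE) (ABC mA mB × Fin dE) ℂ),
    op k (bellMat q) * w.active mk k W =
      (1 / 2 : ℂ) • w.transit mk k (corePauli (mA := mA) (mB := mB) (dE := dE) q * W)
  fetch : ∀ k q (W : Matrix (Core mA mB dE) (ABC mA mB × Fin dE) ℂ),
    op k (fetchMat q) * w.flip.transit mk k W =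
      w.active mk (k + 1) (corePauli (mA := mA) (mB := mB) (dE := dE) q * W)
  start : ∀ k q (W : Matrix (Core mA mB dE) (ABC mA mB × Fin dE) ℂ),
    op k (startMat q) * w.active mk 0 W =
      w.active mk 0 (corePauli (mA := mA) (mB := mB) (dE := dE) q * W)
  call : ∀ c act n (W : Matrix (Core mA mB dE) (ABC mA mB × Fin dE) ℂ),
    Simulator.callBox box (queryOf o c act) * w.active mk n W =
      w.active mk n (moveOp (coreBox (dE := dE) Q) o c act * W)

/-- The quantum state after `n` steps. -/
def stage (w : View G Y T) (mk : Y → Fin 2 → Core mA mB dE) :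
    ℕ → Matrix (Core mA mB dE) (ABC mA mB × Fin dE) ℂ → Matrix G (ABC mA mB × Fin dE) ℂ
  | 0, W => w.active mk 0 W
  | t + 1, W => if ht : t < T then (w.of t.bodd).transit mk ⟨t, ht⟩ W else 0

variable {Q : NoiselessProtocol N mA mB} {w : View G Y T} {mk : Y → Fin 2 → Core mA mB dE}
  {op : Fin T → Matrix (Fin 2 × Fin 2) (Fin 2 × Fin 2) ℂ → Matrix G G ℂ} {box : ℕ → Matrix G G ℂ}

/-- In step `0` Alice already holds the qubit and nothing is fetched. The truncated index `0 - 1 =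
0` is harmless, since `startMat` acts as the identity on the entangled qubit. -/
theorem IsSide.receive {t : ℕ} (h : IsSide Q t.bodd (w.of t.bodd) mk op box) (ht : t < T)
    (q : Fin 2 × Fin 2) (W : Matrix (Core mA mB dE) (ABC mA mB × Fin dE) ℂ) :
    op ⟨t - 1, (Nat.sub_le _ _).trans_lt ht⟩ (receiveMat t q) * stage w mk t W =
      (w.of t.bodd).active mk t (corePauli (mA := mA) (mB := mB) (dE := dE) q * W) := by
  rcases t with _ | t
  · rw [receiveMat, if_pos rfl]
    exact h.start _ _ _
  · have hf : w.of t.bodd = (w.of (t + 1).bodd).flip := by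
      rw [Nat.bodd_succ]
      cases t.bodd <;> rfl
    rw [receiveMat, if_neg (Nat.succ_ne_zero t), stage, dif_pos (Nat.lt_of_succ_lt ht), hf]
    exact h.fetch ⟨t, Nat.lt_of_succ_lt ht⟩ _ _

/-- One step of a party on the state of the protocol. -/
theorem IsSide.step {h : ℕ → Msg} {t : ℕ} (hs : IsSide Q t.bodd (w.of t.bodd) mk op box)
    (ht : t < T) :
    ∃ s : ℂ, (s = 1 ∨ s = -1) ∧
      op ⟨t, ht⟩ (bellMat (h t).2.2) *
        (Simulator.callBox box (queryOf t.bodd (moveCount t.bodd h t) (h t).2.1) *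
          op ⟨t - 1, (Nat.sub_le _ _).trans_lt ht⟩ (receiveMat t (h t).1)) *
        stage w mk t (coreState Q (mach h t)) =
      (s * (1 / 2) : ℂ) • stage w mk (t + 1) (coreState Q (mach h (t + 1))) := by
  obtain ⟨s, hs1, h1⟩ := stackOp_machStep (coreBox_mem_unitary (dE := dE) Q) isPauliRep_corePauli
    t.bodd (mach h t) (h t)
  refine ⟨s, hs1, ?_⟩
  rw [Matrix.mul_assoc, Matrix.mul_assoc, hs.receive ht, hs.call, hs.bell ⟨t, ht⟩, stage,
    dif_pos ht, mul_comm s, mul_smul]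
  congr 1
  rw [View.transit, View.transit, ← place_smul]
  congr 1
  rw [coreState, coreState, ← stackCount_mach, mach, ← Matrix.smul_mul, ← h1]
  simp only [Matrix.mul_assoc]

/-- On density operators the sign disappears and the amplitude `1 / 2` becomes the probability `1 /
4`, which is the same for every outcome and every state. -/
theorem IsSide.conj_step {h : ℕ → Msg} {t : ℕ} (hs : IsSide Q t.bodd (w.of t.bodd) mk op box)
    (ht : t < T) (σ : Matrix (ABC mA mB × Fin dE) (ABC mA mB × Fin dE) ℂ) :
    conj (op ⟨t, ht⟩ (bellMat (h t).2.2) *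
        (Simulator.callBox box (queryOf t.bodd (moveCount t.bodd h t) (h t).2.1) *
          op ⟨t - 1, (Nat.sub_le _ _).trans_lt ht⟩ (receiveMat t (h t).1)))
        (conj (stage w mk t (coreState Q (mach h t))) σ) =
      (1 / 4 : ℂ) • conj (stage w mk (t + 1) (coreState Q (mach h (t + 1)))) σ := by
  obtain ⟨s, hs1, h1⟩ := hs.step (h := h) ht
  rw [← LinearMap.comp_apply, conj_comp, h1, conj_smul, LinearMap.smul_apply]
  congr 1
  rcases hs1 with rfl | rfl <;> norm_num

end side

/-! ### One turn -/

section turn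

variable {F : Type} [Field F] [DecidableEq F] {p ε : ℝ}
variable {B : BlockCode F p ε} {g : ℕ → F} {ι : Msg → F} {N mA mB dE T : ℕ}
variable {H G Y V : Type} [Fintype H] [DecidableEq H] [Fintype G] [DecidableEq G] [AddCommGroup V]
  [Module ℂ V] {P : Port H T}
variable {step : Step (Store T (T * B.D)) 2 H → (V →ₗ[ℂ] V)}
  {emb : Store T (T * B.D) → Fin 2 → Matrix G G ℂ →ₗ[ℂ] V}
  {lift : Matrix H H ℂ → Matrix G G ℂ} {box : ℕ → Matrix G G ℂ}
  {Q : NoiselessProtocol N mA mB} {w : View G Y T} {mk : Y → Fin 2 → Core mA mB dE}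

/-- The number of steps before turn `τ`. -/
def stepsBefore (D τ : ℕ) : ℕ := (τ + D - 1) / D

theorem stepsBefore_of_dvd {D τ : ℕ} (hD : 0 < D) (hd : D ∣ τ) :
    stepsBefore D τ = τ / D ∧ stepsBefore D (τ + 1) = τ / D + 1 := by
  obtain ⟨t, rfl⟩ := hd
  rw [stepsBefore, stepsBefore, Nat.mul_div_cancel_left _ hD]
  constructor
  · rw [Nat.add_sub_assoc hD, Nat.mul_add_div hD, Nat.div_eq_of_lt (by omega), add_zero]
  · rw [show D * t + 1 + D - 1 = D * (t + 1) by rw [mul_add]; omega, Nat.mul_div_cancel_left _ hD]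

theorem stepsBefore_of_not_dvd {D τ : ℕ} (hD : 0 < D) (hd : ¬ D ∣ τ) :
    stepsBefore D (τ + 1) = stepsBefore D τ := by
  rw [stepsBefore, stepsBefore, show τ + 1 + D - 1 = (τ + D - 1) + 1 by omega, Nat.succ_div,
    if_neg, add_zero]
  rw [show τ + D - 1 + 1 = τ + D by omega]
  simpa using hd

variable (Q w mk) in
/-- The quantum state before turn `τ` when the messages are `h`. -/
def stageAt (D τ : ℕ) (h : ℕ → Msg) : Matrix G (ABC mA mB × Fin dE) ℂ :=
  stage w mk (stepsBefore D τ) (coreState Q (mach h (stepsBefore D τ)))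

/-- Formulated for one party with abstract steps, so that Alice and Bob are covered by the same
argument. -/
theorem IsPartyStep.turn {o : Bool} {τ : ℕ} (hp : IsPartyStep step emb lift box)
    (hs : IsSide Q o (w.of o) mk (fun k L => lift (P.op k L)) box) (hτ : τ < T * B.D)
    (hb : τ.bodd = o) (J : Log) (σ : Matrix (ABC mA mB × Fin dE) (ABC mA mB × Fin dE) ℂ) :
    runSteps step (moves B g ι P o τ) (emb (viewStore B T o τ J.1 J.2) (J.1 τ)
        (conj (stageAt Q w mk B.D τ J.2) σ)) =
      ∑ m, (1 / 4 : ℂ) • emb (viewStore B T o (τ + 1) J.1 (nextMsgs B g ι τ J m))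
        (sendBit B g ι τ (nextMsgs B g ι τ J m))
        (conj (stageAt Q w mk B.D (τ + 1) (nextMsgs B g ι τ J m)) σ) := by
  have hD := B.odd_D.pos
  by_cases hd : B.D ∣ τ
  · rw [hp.runSteps_moves_of_dvd o hτ hd]
    refine Finset.sum_congr rfl fun m _ => ?_
    have ho : (τ / B.D).bodd = o := by rw [← bodd_mul_D (B := B), Nat.div_mul_cancel hd, hb]
    rw [prepareMove_viewStore hτ hb hd, storeOutcome_viewStore hτ hb hd, queryIn_viewStore hτ hb hd,
      chosen_viewStore hτ hb hd, sendBit_viewStore hτ hb]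
    have hn : nextMsgs B g ι τ J m = Function.update J.2 (τ / B.D)
        ((decision B g ι (τ / B.D) J.1 J.2).1, (decision B g ι (τ / B.D) J.1 J.2).2, m) :=
      if_pos hd
    simp only
    rw [← hn, ← map_smul]
    congr 1
    rw [stageAt, stageAt, (stepsBefore_of_dvd hD hd).1, (stepsBefore_of_dvd hD hd).2]
    have hx : nextMsgs B g ι τ J m (τ / B.D) = ((decision B g ι (τ / B.D) J.1 J.2).1,
        (decision B g ι (τ / B.D) J.1 J.2).2, m) := by rw [hn, Function.update_self]
    have hlt : ∀ i < τ / B.D, J.2 i = nextMsgs B g ι τ J m i := fun i hi => by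
      rw [hn, Function.update_of_ne hi.ne]
    have hc : moveCount o J.2 (τ / B.D) = moveCount o (nextMsgs B g ι τ J m) (τ / B.D) :=
      Finset.sum_congr rfl fun i hi => by rw [hlt i (Finset.mem_range.mp hi)]
    subst ho
    have := hs.conj_step (h := nextMsgs B g ι τ J m) (div_lt_of_lt hτ) σ
    rw [hx] at this
    rw [mach_congr hlt, hc]
    exact this
  -- No teleportation takes place inside a block. Four equal terms of weight `1 / 4` are kept so
  -- that all turns have the same form.
  · have hn : ∀ m, nextMsgs B g ι τ J m = J.2 := fun m => if_neg hd
    simp only [hn]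
    rw [hp.runSteps_moves_of_not_dvd o hτ hd, listen_viewStore hτ hb hd, sendBit_viewStore hτ hb,
      stageAt, stageAt, stepsBefore_of_not_dvd hD hd, Finset.sum_const, ← Nat.cast_smul_eq_nsmul ℂ,
      smul_smul]
    norm_num

end turn

/-! ### The simulator -/

theorem update_inj_of_eq {ι α : Type} [DecidableEq ι] {k : ι} {a : α} {t s : ι → α}
    (h : t k = s k) (h' : Function.update t k a = Function.update s k a) : t = s := by
  funext j
  by_cases hj : j = k
  · rw [hj, h]
  · have := congrFun h' j
    rwa [Function.update_of_ne hj, Function.update_of_ne hj] at this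

/-- Alice's port. -/
def portA (T : ℕ) : Port (Fin 2 × Fin 2 × Unit × (Fin T → Fin 2)) T where
  R := Fin 2 × (Fin T → Fin 2)
  dR := inferInstance
  w k h := (h.1, h.2.2.2 k)
  r k h := (h.2.1, Function.update h.2.2.2 k 0)
  put k h a := (a.1, h.2.1, (), Function.update h.2.2.2 k a.2)
  splits k := by
    refine ⟨fun g a => by simp, fun g a => by simp, ?_⟩
    rintro ⟨c, c', _, t⟩ ⟨d, d', _, s⟩ h1 h2
    simp only [Prod.mk.injEq] at h1 h2 ⊢
    refine ⟨h1.1, h2.1, trivial, ?_⟩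
    exact update_inj_of_eq h1.2 h2.2

/-- Bob's port. -/
def portB (T : ℕ) : Port (Fin 2 × Unit × (Fin T → Fin 2)) T where
  R := Fin T → Fin 2
  dR := inferInstance
  w k h := (h.1, h.2.2 k)
  r k h := Function.update h.2.2 k 0
  put k h a := (a.1, (), Function.update h.2.2 k a.2)
  splits k := by
    refine ⟨fun g a => by simp, fun g a => by simp, ?_⟩
    rintro ⟨c, _, t⟩ ⟨d, _, s⟩ h1 h2
    simp only [Prod.mk.injEq] at h1 h2 ⊢
    refine ⟨h1.1, trivial, ?_⟩
    exact update_inj_of_eq h1.2 h2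

/-- The amplitudes of `T` maximally entangled pairs. -/
def pairsAmp (T : ℕ) (t : (Fin T → Fin 2) × (Fin T → Fin 2)) : ℂ :=
  ∏ j : Fin T, pairAmp 0 j (t.1 j) (t.2 j)

theorem sum_norm_pairsAmp (T : ℕ) : ∑ t, ‖pairsAmp T t‖ ^ 2 = 1 := by
  have hhalf : ‖halfAmp‖ ^ 2 = 1 / 2 := by
    rw [sq, ← norm_mul, halfAmp_mul_self]
    norm_num
  have h : ∀ (j : Fin T) a, ∑ b, ‖pairAmp 0 j a b‖ ^ 2 = 1 / 2 := by
    intro j a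
    rw [Finset.sum_eq_single a]
    · simp [pairAmp, ← hhalf]
    · intro b _ hb
      simp [pairAmp, Ne.symm hb]
    · simp
  simp only [pairsAmp, norm_prod, ← Finset.prod_pow]
  rw [Fintype.sum_prod_type]
  simp only
  have h2 : ∀ a : Fin T → Fin 2, ∑ b : Fin T → Fin 2, ∏ j : Fin T, ‖pairAmp 0 j (a j) (b j)‖ ^ 2 =
      ∏ j : Fin T, (1 / 2 : ℝ) := by
    intro a
    rw [← Fintype.prod_sum fun (j : Fin T) b => ‖pairAmp 0 j (a j) b‖ ^ 2]
    exact Finset.prod_congr rfl fun j _ => h j _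
  simp only [h2]
  simp

section simulator

variable {F : Type} [Field F] [DecidableEq F] {p ε : ℝ}
variable (B : BlockCode F p ε) (g : ℕ → F) (ι : Msg → F) {T : ℕ} (hT : Even T)

/-- The simulator with `T` steps, each of which takes as many turns as the length of the block
code. -/
abbrev simulator : Simulator 2 where
  length := T * B.D
  length_even := hT.mul_right _
  X := Store T (T * B.D)
  Y := Store T (T * B.D)
  SA := Unit
  SB := Unit
  TA := Fin T → Fin 2
  TB := Fin T → Fin 2
  x₀ := viewStore B T false 0 (fun _ => 0) (fun _ => (0, none, 0))
  y₀ := viewStore B T true 0 (fun _ => 0) (fun _ => (0, none, 0))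
  sA₀ := ()
  sB₀ := ()
  φ := pairsAmp T
  φ_unit := sum_norm_pairsAmp T
  alice i := moves B g ι (portA T) false (i - 1)
  bob i := moves B g ι (portB T) true (i - 1)

variable {N mA mB dE : ℕ}

variable (T mA mB dE) in
/-- The quantum registers of the simulation. -/
abbrev SimReg : Type :=
  RegA mA Unit (Fin T → Fin 2) × RegB mB Unit (Fin T → Fin 2) × Fin dE

variable (T mA mB dE) in
/-- Alice's view of the registers. -/
def viewA : View (SimReg T mA mB dE) ((Qubits mA × Qubits mB) × ABC mA mB × Fin dE) T where
  u g := g.1.c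
  v g := g.2.1.c
  s g := g.1.t
  s' g := g.2.1.t
  ρ g := ((g.1.a, g.2.1.b), (g.1.a', g.2.1.b', g.1.c'), g.2.2)

/-- The registers of the protocol. -/
def mkCore (y : (Qubits mA × Qubits mB) × ABC mA mB × Fin dE) (c : Fin 2) : Core mA mB dE :=
  ((y.1.1, y.1.2, c), y.2)

/-- Change of Alice's qubits. -/
def putA (k : Fin T) (g : SimReg T mA mB dE) (a : Fin 2 × Fin 2) : SimReg T mA mB dE :=
  ({ g.1 with c := a.1, t := Function.update g.1.t k a.2 }, g.2)

/-- Change of Bob's qubits. -/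
def putB (k : Fin T) (g : SimReg T mA mB dE) (a : Fin 2 × Fin 2) : SimReg T mA mB dE :=
  (g.1, { g.2.1 with c := a.1, t := Function.update g.2.1.t k a.2 }, g.2.2)

theorem access_putA (k : Fin T) : (viewA T mA mB dE).Access k (putA k) :=
  ⟨fun _ _ => rfl, fun _ _ => rfl, fun _ _ => rfl, fun _ _ => rfl, fun _ _ => rfl⟩

theorem access_putB (k : Fin T) : (viewA T mA mB dE).flip.Access k (putB k) :=
  ⟨fun _ _ => rfl, fun _ _ => rfl, fun _ _ => rfl, fun _ _ => rfl, fun _ _ => rfl⟩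

theorem splits_putA (k : Fin T) :
    Splits (fun g => ((viewA T mA mB dE).u g, (viewA T mA mB dE).s g k))
    (fun g => ((portA T).r k (g.1.c, g.1.c', g.1.s, g.1.t), (g.1.a, g.1.a'), g.2.1, g.2.2))
    (putA k) where
  w_put g a := by simp [viewA, putA]
  r_put g a := by simp [putA, portA]
  inj := by
    rintro ⟨⟨a, c, a', c', s, t⟩, y, e⟩ ⟨⟨b, d, b', d', s', t'⟩, y', e'⟩ h1 h2
    have h := (portA T).splits k |>.inj (c, c', s, t) (d, d', s', t') h1 (Prod.ext_iff.mp h2).1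
    simp only [Prod.mk.injEq] at h h2 ⊢
    simp [h, h2]

theorem splits_putB (k : Fin T) :
    Splits (fun g => ((viewA T mA mB dE).flip.u g, (viewA T mA mB dE).flip.s g k))
    (fun g => ((portB T).r k (g.2.1.c, g.2.1.s, g.2.1.t), g.1, (g.2.1.b, g.2.1.b'), g.2.2))
    (putB k) where
  w_put g a := by simp [viewA, View.flip, putB]
  r_put g a := by simp [putB, portB]
  inj := by
    rintro ⟨x, ⟨a, c, a', s, t⟩, e⟩ ⟨x', ⟨b, d, b', s', t'⟩, e'⟩ h1 h2
    have h := (portB T).splits k |>.inj (c, s, t) (d, s', t') h1 (Prod.ext_iff.mp h2).1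
    simp only [Prod.mk.injEq] at h h2 ⊢
    simp [h, h2]

theorem startMat_mul_active
    {w : View (SimReg T mA mB dE) ((Qubits mA × Qubits mB) × ABC mA mB × Fin dE) T}
    {k : Fin T} {put : SimReg T mA mB dE → Fin 2 × Fin 2 → SimReg T mA mB dE} (h : w.Access k put)
    {R : Type} [DecidableEq R] {r : SimReg T mA mB dE → R}
    (hs : Splits (fun g => (w.u g, w.s g k)) r put) (n : ℕ) (q : Fin 2 × Fin 2)
    (W : Matrix (Core mA mB dE) (ABC mA mB × Fin dE) ℂ) :
    actOn (fun g => (w.u g, w.s g k)) r (startMat q) * w.active mkCore n W =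
      w.active mkCore n (corePauli (mA := mA) (mB := mB) (dE := dE) q * W) := by
  ext g i
  rw [hs.actOn_mul_apply, View.active, View.active, place, place, Matrix.of_apply, corePauli,
    splits_coreC.actOn_mul_apply, Finset.mul_sum, Fintype.sum_prod_type]
  refine Finset.sum_congr rfl fun c _ => ?_
  rw [Finset.sum_eq_single (w.s g k)]
  · have hs' : w.s (put g (c, w.s g k)) = w.s g := by rw [h.s, Function.update_eq_self]
    rw [Matrix.of_apply, h.u, h.ρ, startMat, Matrix.of_apply, if_pos rfl, View.activeAmp,
      View.activeAmp, h.v, h.s', hs']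
    simp only [mkCore]
    ring
  · intro b _ hb
    rw [startMat, Matrix.of_apply, if_neg (Ne.symm hb), zero_mul]
  · simp

/-- Inverse calls follow from forward calls: apply the hypothesis to `U'ᴴ * W` and cancel both
unitaries. -/
theorem conjTranspose_mul_active
    {w : View (SimReg T mA mB dE) ((Qubits mA × Qubits mB) × ABC mA mB × Fin dE) T}
    {U : Matrix (SimReg T mA mB dE) (SimReg T mA mB dE) ℂ}
    {U' : Matrix (Core mA mB dE) (Core mA mB dE) ℂ} {n : ℕ}
    (hU : U ∈ Matrix.unitaryGroup (SimReg T mA mB dE) ℂ)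
    (hU' : U' ∈ Matrix.unitaryGroup (Core mA mB dE) ℂ)
    (h : ∀ W : Matrix (Core mA mB dE) (ABC mA mB × Fin dE) ℂ,
      U * w.active mkCore n W = w.active mkCore n (U' * W))
    (W : Matrix (Core mA mB dE) (ABC mA mB × Fin dE) ℂ) :
    Uᴴ * w.active mkCore n W = w.active mkCore n (U'ᴴ * W) := by
  rw [Matrix.mem_unitaryGroup_iff', Matrix.star_eq_conjTranspose] at hU
  rw [Matrix.mem_unitaryGroup_iff, Matrix.star_eq_conjTranspose] at hU'
  have h1 := h (U'ᴴ * W)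
  rw [← Matrix.mul_assoc, hU', Matrix.one_mul] at h1
  rw [← h1, ← Matrix.mul_assoc, hU, Matrix.one_mul]

theorem callBox_mul_active
    {w : View (SimReg T mA mB dE) ((Qubits mA × Qubits mB) × ABC mA mB × Fin dE) T}
    {box : ℕ → Matrix (SimReg T mA mB dE) (SimReg T mA mB dE) ℂ} {o : Bool}
    {Q : NoiselessProtocol N mA mB}
    (hbox : ∀ j, box j ∈ Matrix.unitaryGroup (SimReg T mA mB dE) ℂ)
    (h : ∀ (j n : ℕ) (W : Matrix (Core mA mB dE) (ABC mA mB × Fin dE) ℂ),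
      box (2 * j + if o then 2 else 1) * w.active mkCore n W =
        w.active mkCore n (coreBox (dE := dE) Q (2 * j + if o then 2 else 1) * W))
    (c : ℤ) (act : Option Bool) (n : ℕ) (W : Matrix (Core mA mB dE) (ABC mA mB × Fin dE) ℂ) :
    Simulator.callBox box (queryOf o c act) * w.active mkCore n W =
      w.active mkCore n (moveOp (coreBox (dE := dE) Q) o c act * W) := by
  rcases act with _ | _ | _
  · simp only [queryOf, Simulator.callBox, moveOp]
    rw [Matrix.one_mul, Matrix.one_mul]
  · simp only [queryOf, moveOp, nthUnitary]
    by_cases hc : c - 1 < 0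
    · rw [if_pos hc, if_pos hc, Simulator.callBox, Matrix.conjTranspose_one, Matrix.one_mul, Matrix.one_mul]
    · rw [if_neg hc, if_neg hc, Simulator.callBox]
      exact conjTranspose_mul_active (hbox _) (coreBox_mem_unitary Q _) (h (c - 1).toNat n) W
  · simp only [queryOf, moveOp, nthUnitary]
    by_cases hc : c < 0
    · rw [if_pos hc, if_pos hc, Simulator.callBox, Matrix.one_mul, Matrix.one_mul]
    · rw [if_neg hc, if_neg hc, Simulator.callBox]
      exact h c.toNat n W

end simulator

/-! ### Alice and Bob as instances of an abstract party. -/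

section boxes

variable {F : Type} [Field F] [DecidableEq F] {p ε : ℝ}
variable (B : BlockCode F p ε) (g : ℕ → F) (ι : Msg → F) {T : ℕ} (hT : Even T)
variable {N mA mB dE : ℕ} (Q : NoiselessProtocol N mA mB)

theorem splits_unitaryA : Splits (fun g : SimReg T mA mB dE => (g.1.a, g.1.c))
    (fun g => ((g.1.a', g.1.c', g.1.s, g.1.t), g.2.1, g.2.2))
    (fun g a => ({ g.1 with a := a.1, c := a.2 }, g.2)) where
  w_put _ _ := rfl
  r_put _ _ := rfl
  inj := by
    rintro ⟨⟨a, c, a', c', s, t⟩, y, e⟩ ⟨⟨b, d, b', d', s', t'⟩, y', e'⟩ h1 h2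
    simp only [Prod.mk.injEq] at h1 h2 ⊢
    simp [h1, h2]

theorem splits_unitaryB : Splits (fun g : SimReg T mA mB dE => (g.2.1.b, g.2.1.c))
    (fun g => (g.1, (g.2.1.b', g.2.1.s, g.2.1.t), g.2.2))
    (fun g a => (g.1, { g.2.1 with b := a.1, c := a.2 }, g.2.2)) where
  w_put _ _ := rfl
  r_put _ _ := rfl
  inj := by
    rintro ⟨x, ⟨b, c, b', s, t⟩, e⟩ ⟨x', ⟨d, c', d', s', t'⟩, e'⟩ h1 h2
    simp only [Prod.mk.injEq] at h1 h2 ⊢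
    simp [h1, h2]

theorem swapA_involutive : Function.Involutive
    ((simulator B g ι hT).swapA : SimReg T mA mB dE → SimReg T mA mB dE) :=
  fun _ => rfl

theorem swapB_involutive : Function.Involutive
    ((simulator B g ι hT).swapB : SimReg T mA mB dE → SimReg T mA mB dE) :=
  fun _ => rfl

theorem boxA_mem_unitary (j : ℕ) : ((simulator B g ι hT).boxA Q j :
    Matrix (SimReg T mA mB dE) (SimReg T mA mB dE) ℂ) ∈
      Matrix.unitaryGroup (SimReg T mA mB dE) ℂ := by
  have h : ((simulator B g ι hT).unitaryA Q j : Matrix (SimReg T mA mB dE) (SimReg T mA mB dE) ℂ) ∈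
      Matrix.unitaryGroup (SimReg T mA mB dE) ℂ :=
    splits_unitaryA.actOn_mem_unitary (Q.UA j).2
  rw [Simulator.boxA]
  split_ifs
  · exact mul_mem_unitary (basisMap_mem_unitary (swapA_involutive B g ι hT)) h
  · exact h
  · exact one_mem _

theorem boxB_mem_unitary (j : ℕ) : ((simulator B g ι hT).boxB Q j :
    Matrix (SimReg T mA mB dE) (SimReg T mA mB dE) ℂ) ∈
      Matrix.unitaryGroup (SimReg T mA mB dE) ℂ := by
  have h : ((simulator B g ι hT).unitaryB Q j : Matrix (SimReg T mA mB dE) (SimReg T mA mB dE) ℂ) ∈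
      Matrix.unitaryGroup (SimReg T mA mB dE) ℂ :=
    splits_unitaryB.actOn_mem_unitary (Q.UB j).2
  rw [Simulator.boxB]
  split_ifs
  · exact mul_mem_unitary (basisMap_mem_unitary (swapB_involutive B g ι hT)) h
  · exact h
  · exact one_mem _

theorem boxA_mul_active (hN : Even N) {j : ℕ} (hj : Odd j) (n : ℕ)
    (W : Matrix (Core mA mB dE) (ABC mA mB × Fin dE) ℂ) :
    (simulator B g ι hT).boxA (dE := dE) Q j * (viewA T mA mB dE).active mkCore n W =
      (viewA T mA mB dE).active mkCore n (coreBox (dE := dE) Q j * W) := by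
  have hne : j ≠ N := by
    rintro rfl
    exact (Nat.not_even_iff_odd.mpr hj) hN
  have h : ∀ V : Matrix (Core mA mB dE) (ABC mA mB × Fin dE) ℂ,
      (simulator B g ι hT).unitaryA (dE := dE) Q j * (viewA T mA mB dE).active mkCore n V =
      (viewA T mA mB dE).active mkCore n (coreA (dE := dE) Q j * V) := fun V =>
    actOn_mul_place splits_unitaryA splits_coreA (fun _ => rfl) (fun _ _ => rfl) (fun _ _ => rfl) _ V
  have hswap : ∀ V : Matrix (Core mA mB dE) (ABC mA mB × Fin dE) ℂ,
      (basisMap (simulator B g ι hT).swapA :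
        Matrix (SimReg T mA mB dE) (SimReg T mA mB dE) ℂ) * (viewA T mA mB dE).active mkCore n V =
      (viewA T mA mB dE).active mkCore n
        ((basisMap coreSwapA : Matrix (Core mA mB dE) (Core mA mB dE) ℂ) * V) := fun V =>
    basisMap_mul_place (swapA_involutive B g ι hT) coreSwapA_involutive (fun _ => rfl)
      (fun _ => rfl) V
  rw [Simulator.boxA, coreBox]
  by_cases h1 : j = N + 1
  · rw [if_pos h1, if_pos h1, Matrix.mul_assoc, Matrix.mul_assoc, h, hswap]
  · rw [if_neg h1, if_neg h1, if_neg hne]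
    by_cases h2 : j ≤ N
    · rw [if_pos ⟨hj, h2⟩, if_pos h2, if_pos hj, h]
    · rw [if_neg (fun hh => h2 hh.2), if_neg h2, Matrix.one_mul, Matrix.one_mul]

theorem boxB_mul_active (hN : Even N) (hN0 : 0 < N) {j : ℕ} (hj : Even j) (hj0 : 0 < j) (n : ℕ)
    (W : Matrix (Core mA mB dE) (ABC mA mB × Fin dE) ℂ) :
    (simulator B g ι hT).boxB (dE := dE) Q j * (viewA T mA mB dE).flip.active mkCore n W =
      (viewA T mA mB dE).flip.active mkCore n (coreBox (dE := dE) Q j * W) := by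
  have hne : j ≠ N + 1 := by
    rintro rfl
    exact (Nat.not_even_iff_odd.mpr hN.add_one) hj
  have h : ∀ V : Matrix (Core mA mB dE) (ABC mA mB × Fin dE) ℂ,
      (simulator B g ι hT).unitaryB (dE := dE) Q j * (viewA T mA mB dE).flip.active mkCore n V =
      (viewA T mA mB dE).flip.active mkCore n (coreB (dE := dE) Q j * V) := fun V =>
    actOn_mul_place splits_unitaryB splits_coreB (fun _ => rfl) (fun _ _ => rfl) (fun _ _ => rfl) _ V
  have hswap : ∀ V : Matrix (Core mA mB dE) (ABC mA mB × Fin dE) ℂ,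
      (basisMap (simulator B g ι hT).swapB :
        Matrix (SimReg T mA mB dE) (SimReg T mA mB dE) ℂ) * (viewA T mA mB dE).flip.active mkCore n V =
      (viewA T mA mB dE).flip.active mkCore n
        ((basisMap coreSwapB : Matrix (Core mA mB dE) (Core mA mB dE) ℂ) * V) := fun V =>
    basisMap_mul_place (swapB_involutive B g ι hT) coreSwapB_involutive (fun _ => rfl)
      (fun _ => rfl) V
  rw [Simulator.boxB, coreBox, if_neg hne]
  by_cases h1 : j = N
  · rw [if_pos ⟨h1, hN0⟩, if_pos h1, Matrix.mul_assoc, Matrix.mul_assoc, h, hswap]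
  · rw [if_neg (fun hh => h1 hh.1), if_neg h1]
    by_cases h2 : j ≤ N
    · rw [if_pos ⟨hj, hj0, h2⟩, if_pos h2, if_neg (Nat.not_odd_iff_even.mpr hj), h]
    · rw [if_neg (fun hh => h2 hh.2.2), if_neg h2, Matrix.one_mul, Matrix.one_mul]

theorem liftA_op (k : Fin T) (L : Matrix (Fin 2 × Fin 2) (Fin 2 × Fin 2) ℂ) :
    ((simulator B g ι hT).liftA ((portA T).op k L) :
      Matrix (SimReg T mA mB dE) (SimReg T mA mB dE) ℂ) =
    actOn (fun g => ((viewA T mA mB dE).u g, (viewA T mA mB dE).s g k))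
      (fun g => ((portA T).r k (g.1.c, g.1.c', g.1.s, g.1.t), (g.1.a, g.1.a'), g.2.1, g.2.2)) L :=
  actOn_actOn _ _ _ _ L

theorem liftB_op (k : Fin T) (L : Matrix (Fin 2 × Fin 2) (Fin 2 × Fin 2) ℂ) :
    ((simulator B g ι hT).liftB ((portB T).op k L) :
      Matrix (SimReg T mA mB dE) (SimReg T mA mB dE) ℂ) =
    actOn (fun g => ((viewA T mA mB dE).flip.u g, (viewA T mA mB dE).flip.s g k))
      (fun g => ((portB T).r k (g.2.1.c, g.2.1.s, g.2.1.t), g.1, (g.2.1.b, g.2.1.b'), g.2.2)) L :=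
  actOn_actOn _ _ _ _ L

theorem isSide_alice (hN : Even N) : IsSide (dE := dE) Q false ((viewA T mA mB dE).of false) mkCore
    (fun k L => (simulator B g ι hT).liftA ((portA T).op k L)) ((simulator B g ι hT).boxA Q) where
  bell k q W := by
    rw [liftA_op]
    exact (access_putA k).bell (splits_putA k) splits_coreC (fun _ _ => rfl) (fun _ _ _ => rfl) q W
  fetch k q W := by
    rw [liftA_op]
    exact (access_putA k).fetch (splits_putA k) splits_coreC (fun _ _ => rfl) (fun _ _ _ => rfl) q W
  start k q W := by
    rw [liftA_op]
    exact startMat_mul_active (access_putA k) (splits_putA k) 0 q W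
  call c act n W := callBox_mul_active (boxA_mem_unitary B g ι hT Q)
    (fun j n W => boxA_mul_active B g ι hT Q hN (by simp) n W) c act n W

theorem isSide_bob (hN : Even N) (hN0 : 0 < N) :
    IsSide (dE := dE) Q true ((viewA T mA mB dE).of true) mkCore
    (fun k L => (simulator B g ι hT).liftB ((portB T).op k L)) ((simulator B g ι hT).boxB Q) where
  bell k q W := by
    rw [liftB_op]
    exact (access_putB k).bell (splits_putB k) splits_coreC (fun _ _ => rfl) (fun _ _ _ => rfl) q W
  fetch k q W := by
    rw [liftB_op]
    exact (access_putB k).fetch (splits_putB k) splits_coreC (fun _ _ => rfl) (fun _ _ _ => rfl) q W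
  start k q W := by
    rw [liftB_op]
    exact startMat_mul_active (access_putB k) (splits_putB k) 0 q W
  call c act n W := callBox_mul_active (boxB_mem_unitary B g ι hT Q)
    (fun j n W => boxB_mul_active B g ι hT Q hN hN0 (by simp [parity_simps]) (by simp) n W) c act n W

theorem liftA_one : ((simulator B g ι hT).liftA 1 :
    Matrix (SimReg T mA mB dE) (SimReg T mA mB dE) ℂ) = 1 := by
  ext ⟨⟨a, c, a', c', s, t⟩, y, e⟩ ⟨⟨b, d, b', d', s', t'⟩, y', e'⟩
  simp only [Simulator.liftA, actOn, Matrix.of_apply, Matrix.one_apply, Prod.mk.injEq,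
    RegA.mk.injEq]
  rw [← ite_and]
  congr 1
  exact propext (by tauto)

theorem liftB_one : ((simulator B g ι hT).liftB 1 :
    Matrix (SimReg T mA mB dE) (SimReg T mA mB dE) ℂ) = 1 := by
  ext ⟨x, ⟨b, c, b', s, t⟩, e⟩ ⟨x', ⟨d, c', d', s', t'⟩, e'⟩
  simp only [Simulator.liftB, actOn, Matrix.of_apply, Matrix.one_apply, Prod.mk.injEq,
    RegB.mk.injEq]
  rw [← ite_and]
  congr 1
  exact propext (by tauto)

variable (T mA mB dE) in
/-- The classical-quantum states of the simulation. -/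
abbrev SimState : Type :=
  Store T (T * B.D) × Store T (T * B.D) × Fin 2 → Matrix (SimReg T mA mB dE) (SimReg T mA mB dE) ℂ

/-- The state with given classical part. -/
def single (z : Store T (T * B.D) × Store T (T * B.D) × Fin 2) :
    Matrix (SimReg T mA mB dE) (SimReg T mA mB dE) ℂ →ₗ[ℂ] SimState B T mA mB dE :=
  LinearMap.single ℂ (fun _ => Matrix (SimReg T mA mB dE) (SimReg T mA mB dE) ℂ) z

theorem isPartyStep_alice (y : Store T (T * B.D)) :
    IsPartyStep (V := SimState B T mA mB dE) ((simulator B g ι hT).stepA Q)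
      (fun x u => single B (x, y, u)) (simulator B g ι hT).liftA
      ((simulator B g ι hT).boxA Q) where
  lift_one := liftA_one B g ι hT
  branch _ _ f K hK x u ρ := (simulator B g ι hT).stepA_branch Q f K hK x y u ρ
  query f x u ρ := (simulator B g ι hT).stepA_query Q f (x, y, u) ρ

theorem isPartyStep_bob (x : Store T (T * B.D)) :
    IsPartyStep (V := SimState B T mA mB dE) ((simulator B g ι hT).stepB Q)
      (fun y u => single B (x, y, u)) (simulator B g ι hT).liftB
      ((simulator B g ι hT).boxB Q) where
  lift_one := liftB_one B g ι hT
  branch _ _ f K hK y u ρ := (simulator B g ι hT).stepB_branch Q f K hK x y u ρ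
  query f y u ρ := (simulator B g ι hT).stepB_query Q f (x, y, u) ρ

end boxes

/-! ### The joint state as a mixture over logs. -/

section run

variable {F : Type} [Field F] [DecidableEq F] {p ε : ℝ}
variable (B : BlockCode F p ε) (g : ℕ → F) (ι : Msg → F) {T : ℕ} (hT : Even T)
variable {N mA mB dE : ℕ} (Q : NoiselessProtocol N mA mB)

variable (T) in
/-- The state before turn `τ`, with `u` in the communication register. -/
def stateOf (u : Fin 2) (τ : ℕ) (J : Log) (σ : Matrix (ABC mA mB × Fin dE) (ABC mA mB × Fin dE) ℂ) :
    SimState B T mA mB dE :=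
  single B (viewStore B T false τ J.1 J.2, viewStore B T true τ J.1 J.2, u)
    (conj (stageAt Q (viewA T mA mB dE) mkCore B.D τ J.2) σ)

theorem turn_succ (τ : ℕ) : ((simulator B g ι hT).turn Q (τ + 1) :
    SimState B T mA mB dE →ₗ[ℂ] SimState B T mA mB dE) =
      if τ.bodd then runSteps ((simulator B g ι hT).stepB Q) (moves B g ι (portB T) true τ)
      else runSteps ((simulator B g ι hT).stepA Q) (moves B g ι (portA T) false τ) := by
  have h : Odd (τ + 1) ↔ τ.bodd = false := by
    rw [Nat.odd_add_one, Nat.not_odd_iff_even, Nat.even_iff, Nat.mod_two_of_bodd]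
    cases τ.bodd <;> simp
  rw [Simulator.turn]
  cases hb : τ.bodd
  · rw [if_pos (h.mpr hb)]
    rfl
  · rw [if_neg (by rw [h, hb]; simp)]
    rfl

/-- The register of the party at rest is a parameter of the embedding, and its content does not
change when the log grows by a message of the other party. -/
theorem turn_stateOf (hN : Even N) (hN0 : 0 < N) {τ : ℕ} (hτ : τ < T * B.D) (J : Log)
    (σ : Matrix (ABC mA mB × Fin dE) (ABC mA mB × Fin dE) ℂ) :
    (simulator B g ι hT).turn Q (τ + 1) (stateOf B T Q (J.1 τ) τ J σ) =
      ∑ m, (1 / 4 : ℂ) • stateOf B T Q (sendBit B g ι τ (nextMsgs B g ι τ J m)) (τ + 1)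
        (J.1, nextMsgs B g ι τ J m) σ := by
  have hne : ∀ m t, t * B.D ≠ τ → J.2 t = nextMsgs B g ι τ J m t := by
    intro m t ht
    rw [nextMsgs]
    split_ifs with hd
    · rw [Function.update_of_ne]
      rintro rfl
      exact ht (Nat.div_mul_cancel hd)
    · rfl
  rw [turn_succ]
  cases hb : τ.bodd
  · have h := (isPartyStep_alice B g ι hT Q (mA := mA) (mB := mB) (dE := dE)
      (viewStore B T true τ J.1 J.2)).turn (g := g) (ι := ι) (P := portA T)
      (isSide_alice B g ι hT Q hN) hτ hb J σ
    refine Eq.trans ?_ (h.trans (Finset.sum_congr rfl fun m _ => ?_))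
    · rfl
    · rw [stateOf, viewStore_succ_of_ne (o := true) (by rw [hb]; simp) (hne m)]
  · have h := (isPartyStep_bob B g ι hT Q (mA := mA) (mB := mB) (dE := dE)
      (viewStore B T false τ J.1 J.2)).turn (g := g) (ι := ι) (P := portB T)
      (isSide_bob B g ι hT Q hN hN0) hτ hb J σ
    refine Eq.trans ?_ (h.trans (Finset.sum_congr rfl fun m _ => ?_))
    · rfl
    · rw [stateOf, viewStore_succ_of_ne (o := false) (by rw [hb]; simp) (hne m)]

/-- The probability of a noise bit and an outcome of a teleportation. -/
def eventProb (p : ℝ) (a : Fin 2 × (Fin 2 × Fin 2)) : ℝ := flipProb p a.1 * (1 / 4)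

theorem bsc_add (p : ℝ) (u f : Fin 2) : bsc p u (u + f) = flipProb p f := by
  rw [bsc, flipProb]
  congr 1
  exact propext (by rw [left_eq_add])

theorem noise_stateOf (u : Fin 2) (τ : ℕ) (J : Log)
    (σ : Matrix (ABC mA mB × Fin dE) (ABC mA mB × Fin dE) ℂ) :
    (simulator B g ι hT).noise (bsc p) (stateOf B T Q u τ J σ) =
      ∑ f, (flipProb p f : ℂ) • stateOf B T Q (u + f) τ J σ := by
  refine ((simulator B g ι hT).noise_single (bsc p) _ _ u _).trans ?_
  refine (Fintype.sum_equiv (Equiv.addLeft u) _ _ fun f => ?_).symm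
  rw [Equiv.coe_addLeft, bsc_add]
  rfl

/-- The freshly received bit is still in the communication register and not yet in any local
register. -/
theorem stateOf_nextLog (τ : ℕ) (J : Log) (a : Fin 2 × (Fin 2 × Fin 2))
    (σ : Matrix (ABC mA mB × Fin dE) (ABC mA mB × Fin dE) ℂ) :
    stateOf B T Q ((nextLog B g ι τ J a).1 (τ + 1)) (τ + 1) (nextLog B g ι τ J a) σ =
      stateOf B T Q (sendBit B g ι τ (nextMsgs B g ι τ J a.2) + a.1) (τ + 1)
        (J.1, nextMsgs B g ι τ J a.2) σ := by
  have hbits : ∀ i < τ + 1, (nextLog B g ι τ J a).1 i = J.1 i := fun i hi =>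
    Function.update_of_ne (by omega) _ _
  rw [stateOf, stateOf, viewStore_congr_bits hbits, viewStore_congr_bits hbits]
  simp only [nextLog, Function.update_self]

theorem noise_turn_stateOf (hN : Even N) (hN0 : 0 < N) {τ : ℕ} (hτ : τ < T * B.D) (J : Log)
    (σ : Matrix (ABC mA mB × Fin dE) (ABC mA mB × Fin dE) ℂ) :
    (simulator B g ι hT).noise (bsc p)
        ((simulator B g ι hT).turn Q (τ + 1) (stateOf B T Q (J.1 τ) τ J σ)) =
      ∑ a, (eventProb p a : ℂ) • stateOf B T Q ((nextLog B g ι τ J a).1 (τ + 1)) (τ + 1)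
        (nextLog B g ι τ J a) σ := by
  rw [turn_stateOf B g ι hT Q hN hN0 hτ, map_sum]
  refine Eq.trans (Finset.sum_congr rfl fun m _ => ?_)
    (Fintype.sum_prod_type_right (α₁ := Fin 2) (α₂ := Fin 2 × Fin 2) _).symm
  rw [map_smul, noise_stateOf, Finset.smul_sum]
  refine Finset.sum_congr rfl fun f _ => ?_
  rw [stateOf_nextLog, smul_smul, eventProb, mul_comm]
  push_cast
  rfl

theorem prepare_eq : (simulator B g ι hT).prepare (mA := mA) (mB := mB) (dE := dE) =
    stageAt Q (viewA T mA mB dE) mkCore B.D 0 (fun _ => (0, none, 0)) := by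
  rw [stageAt, (stepsBefore_of_dvd B.odd_D.pos (dvd_zero _)).1, Nat.zero_div, stage, mach,
    coreState, isPauliRep_corePauli.zero, stackOp, Matrix.one_mul, Matrix.one_mul]
  ext ⟨⟨a, c, a', c', s, t⟩, ⟨b, d, b', s', t'⟩, e⟩ i
  simp only [Simulator.prepare, View.active, place, View.activeAmp, viewA, mkCore, corePrep,
    Matrix.of_apply, pairsAmp, Prod.mk_eq_zero]
  by_cases h1 : d = 0 <;> by_cases h2 : a' = 0 <;> by_cases h3 : b' = 0 <;> by_cases h4 : c' = 0 <;>
    by_cases h5 : ((a, b, c), e) = i <;> simp [h1, h2, h3, h4, h5]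

theorem initial_eq (σ : Matrix (ABC mA mB × Fin dE) (ABC mA mB × Fin dE) ℂ)
    (ω : ℕ → Fin 2 × (Fin 2 × Fin 2)) :
    (simulator B g ι hT).initial σ =
      stateOf B T Q ((logAt B g ι ω 0).1 0) 0 (logAt B g ι ω 0) σ := by
  funext z
  rw [Simulator.initial, LinearMap.pi_apply, stateOf, single, LinearMap.single_apply, Pi.single_apply]
  by_cases hz : z = ((simulator B g ι hT).x₀, (simulator B g ι hT).y₀, 0)
  · rw [if_pos hz]
    refine Eq.trans ?_ (if_pos hz).symm
    rw [prepare_eq B g ι hT Q]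
    rfl
  · rw [if_neg hz]
    exact (if_neg hz).symm

/-- The state of the simulation is a mixture over noise and outcomes of teleportations. -/
theorem run_initial (hN : Even N) (hN0 : 0 < N) {k : ℕ} (hk : k ≤ T * B.D)
    (σ : Matrix (ABC mA mB × Fin dE) (ABC mA mB × Fin dE) ℂ) :
    (simulator B g ι hT).run (bsc p) Q k ((simulator B g ι hT).initial σ) =
      (simulator B g ι hT).turn Q (k + 1) (∑ ω : Fin k → Fin 2 × (Fin 2 × Fin 2),
        ((∏ i ∈ Finset.range k, eventProb p (extend 0 ω i) : ℝ) : ℂ) •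
          stateOf B T Q ((logAt B g ι (extend 0 ω) k).1 k) k (logAt B g ι (extend 0 ω) k) σ) := by
  induction k with
  | zero =>
    rw [Simulator.run, Fintype.sum_unique, Finset.range_zero, Finset.prod_empty, Complex.ofReal_one,
      one_smul, ← initial_eq]
  | succ k ih =>
    rw [Simulator.run, LinearMap.comp_apply, LinearMap.comp_apply, ih (by omega), map_sum, map_sum]
    congr 1
    rw [sum_extend_succ 0 k fun ω => ((∏ i ∈ Finset.range (k + 1), eventProb p (ω i) : ℝ) : ℂ) •
          stateOf B T Q ((logAt B g ι ω (k + 1)).1 (k + 1)) (k + 1) (logAt B g ι ω (k + 1)) σ]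
    refine Finset.sum_congr rfl fun ω _ => ?_
    rw [map_smul, map_smul, noise_turn_stateOf B g ι hT Q hN hN0 hk, Finset.smul_sum]
    refine Finset.sum_congr rfl fun a _ => ?_
    have hω : ∀ i < k, Function.update (extend 0 ω) k a i = extend 0 ω i := fun i hi =>
      Function.update_of_ne hi.ne _ _
    have hprod : ∏ i ∈ Finset.range k, eventProb p (Function.update (extend 0 ω) k a i) =
        ∏ i ∈ Finset.range k, eventProb p (extend 0 ω i) :=
      Finset.prod_congr rfl fun i hi => by rw [hω i (Finset.mem_range.mp hi)]
    rw [Finset.prod_range_succ, logAt, logAt_congr hω, Function.update_self, smul_smul, hprod,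
      Complex.ofReal_mul]

end run

/-! ### The output for a fixed history. -/

section output

variable {F : Type} [Field F] [DecidableEq F] {p ε : ℝ}
variable (B : BlockCode F p ε) (g : ℕ → F) (ι : Msg → F) {T : ℕ} (hT : Even T)
variable {N mA mB dE : ℕ} (Q : NoiselessProtocol N mA mB)

/-- The registers when the communication qubit is in Alice's `k`-th entanglement register and all
other auxiliary qubits are reset. -/
def embed (k : Fin T) (c : Core mA mB dE) : SimReg T mA mB dE :=
  (⟨c.1.1, 0, c.2.1.1, c.2.1.2.2, (), Function.update 0 k c.1.2.2⟩,
    ⟨c.1.2.1, 0, c.2.1.2.1, (), 0⟩, c.2.2)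

theorem transitAmp_embed {k : Fin T} (hk : (k : ℕ) + 1 = T) (c : Core mA mB dE) :
    (viewA T mA mB dE).flip.transitAmp k (embed k c) = 1 := by
  simp only [View.transitAmp, View.flip, viewA, embed, Pi.zero_apply, if_true, one_mul]
  refine Finset.prod_eq_one fun j hj => ?_
  have hj' := Finset.ne_of_mem_erase hj
  have : (j : ℕ) < k := by
    have h1 : (j : ℕ) ≠ k := fun h => hj' (Fin.ext h)
    omega
  simp [pairAmp, this, Function.update_of_ne hj']

/-- After the last teleportation all earlier pairs have been reset, so every auxiliary qubit is `0`
except the half of the last pair that carries the communication qubit. -/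
theorem mem_range_embed {k : Fin T} (hk : (k : ℕ) + 1 = T) {r : SimReg T mA mB dE}
    (h : (viewA T mA mB dE).flip.transitAmp k r ≠ 0) : r ∈ Set.range (embed k) := by
  obtain ⟨⟨a, c, a', c', s, t⟩, ⟨b, d, b', s', t'⟩, e⟩ := r
  simp only [View.transitAmp, View.flip, viewA] at h
  obtain ⟨h, h4⟩ := mul_ne_zero_iff.mp h
  obtain ⟨h, h3⟩ := mul_ne_zero_iff.mp h
  obtain ⟨h1, h2⟩ := mul_ne_zero_iff.mp h
  obtain rfl : d = 0 := by_contra fun hd => h1 (if_neg hd)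
  obtain rfl : c = 0 := by_contra fun hc => h2 (if_neg hc)
  replace h3 : t' k = 0 := by_contra fun ht => h3 (if_neg ht)
  rw [Finset.prod_ne_zero_iff] at h4
  have hj : ∀ j : Fin T, j ≠ k → t' j = 0 ∧ t j = 0 := by
    intro j hjk
    have hlt : (j : ℕ) < k := by
      have h1 : (j : ℕ) ≠ k := fun h => hjk (Fin.ext h)
      omega
    have h5 := h4 j (Finset.mem_erase.mpr ⟨hjk, Finset.mem_univ _⟩)
    by_contra hne
    exact h5 (by rw [pairAmp, if_pos hlt, if_neg hne])
  refine ⟨((a, b, t k), (a', b', c'), e), ?_⟩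
  have ht : Function.update (0 : Fin T → Fin 2) k (t k) = t := by
    funext j
    by_cases hjk : j = k
    · rw [hjk, Function.update_self]
    · rw [Function.update_of_ne hjk, (hj j hjk).2, Pi.zero_apply]
  have ht' : (0 : Fin T → Fin 2) = t' := by
    funext j
    by_cases hjk : j = k
    · rw [hjk, h3, Pi.zero_apply]
    · rw [(hj j hjk).1, Pi.zero_apply]
  simp only [embed, ht, ← ht']

theorem output_single (z : Store T (T * B.D) × Store T (T * B.D) × Fin 2)
    (ρ : Matrix (SimReg T mA mB dE) (SimReg T mA mB dE) ℂ) :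
    (simulator B g ι hT).output (single B z ρ) =
      partialTrace (fun g : SimReg T mA mB dE => (g.1.a', g.2.1.b', g.1.c'))
        (fun g => ((g.1.a, g.1.c, g.1.s, g.1.t), (g.2.1.b, g.2.1.c, g.2.1.s, g.2.1.t), g.2.2)) ρ := by
  rw [Simulator.output, LinearMap.sum_apply]
  refine (Finset.sum_eq_single z ?_ ?_).trans ?_
  · intro z' _ hz'
    rw [LinearMap.comp_apply, LinearMap.proj_apply, single, LinearMap.single_apply,
      Pi.single_eq_of_ne hz', map_zero]
  · intro h
    exact absurd (Finset.mem_univ z) h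
  · rw [LinearMap.comp_apply, LinearMap.proj_apply, single, LinearMap.single_apply,
      Pi.single_eq_same]

/-- The output for a given history. -/
def outcome (st : (Fin 2 × Fin 2) × List Entry) :
    Matrix (ABC mA mB × Fin dE) (ABC mA mB × Fin dE) ℂ →ₗ[ℂ] Matrix (ABC mA mB) (ABC mA mB) ℂ :=
  partialTrace (fun k : Core mA mB dE => k.2.1) (fun k => (k.1, k.2.2)) ∘ₗ conj (coreState Q st)

theorem isKraus_outcome (st : (Fin 2 × Fin 2) × List Entry) :
    IsKraus (outcome (dE := dE) Q st) := by
  refine isKraus_partialTrace_comp_conj ?_ (coreState_isometry Q st)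
  rintro ⟨a, b, c⟩ ⟨a', b', c'⟩ h1 h2
  simp_all

/-- The number of steps is even, so the last teleportation is Bob's and leaves the qubit in Alice's
last entanglement register. That register is discarded; the result is in the dummy registers. -/
theorem output_stateOf (hT0 : 0 < T) (u : Fin 2) (J : Log)
    (σ : Matrix (ABC mA mB × Fin dE) (ABC mA mB × Fin dE) ℂ) :
    (simulator B g ι hT).output (stateOf B T Q u (T * B.D) J σ) = outcome Q (mach J.2 T) σ := by
  obtain ⟨t, rfl⟩ : ∃ t, T = t + 1 := ⟨T - 1, by omega⟩
  have ht : t.bodd = true := by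
    have : (t + 1).bodd = false := by
      obtain ⟨a, ha⟩ := hT
      rw [ha, ← two_mul]
      simp [show Nat.bodd 2 = false from rfl]
    rw [Nat.bodd_succ] at this
    simpa using this
  have hs : stageAt Q (viewA (t + 1) mA mB dE) mkCore B.D ((t + 1) * B.D) J.2 =
      (viewA (t + 1) mA mB dE).flip.transit mkCore ⟨t, Nat.lt_succ_self t⟩
        (coreState Q (mach J.2 (t + 1))) := by
    rw [stageAt, (stepsBefore_of_dvd B.odd_D.pos (Dvd.intro_left _ rfl)).1,
      Nat.mul_div_cancel _ B.odd_D.pos, stage, dif_pos (Nat.lt_succ_self t), ht]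
    rfl
  rw [stateOf, output_single, hs, outcome, ← LinearMap.comp_apply]
  refine LinearMap.congr_fun (partialTrace_conj_place (emb := embed ⟨t, Nat.lt_succ_self t⟩)
    (fun k => ?_) (fun k => transitAmp_embed rfl k) (fun r hr => ?_) (fun k => rfl)
    (fun k l => ?_) _) σ
  · simp [embed, mkCore, viewA, View.flip]
  · by_contra h
    exact hr (mem_range_embed rfl h)
  · obtain ⟨⟨a, b, c⟩, k, e⟩ := k
    obtain ⟨⟨a', b', c'⟩, k', e'⟩ := l
    simp only [embed, Prod.mk.injEq, (Function.update_injective _ _).eq_iff]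
    tauto

/-- All steps have been made in the first `T * B.D` turns, so the closing turn of Alice is empty. -/
theorem turn_last : ((simulator B g ι hT).turn Q (T * B.D + 1) :
    SimState B T mA mB dE →ₗ[ℂ] SimState B T mA mB dE) = LinearMap.id := by
  rw [turn_succ, moves, moves, dif_neg (lt_irrefl _), dif_neg (lt_irrefl _)]
  split_ifs <;> rfl

/-- The simulation is a mixture over noise and outcomes of teleportations. -/
theorem channel_eq (hN : Even N) (hN0 : 0 < N) (hT0 : 0 < T) :
    (simulator B g ι hT).channel (bsc p) Q dE =
      ∑ ω : Fin (T * B.D) → Fin 2 × (Fin 2 × Fin 2), ((∏ i, eventProb p (ω i) : ℝ) : ℂ) •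
        outcome Q (mach (logAt B g ι (extend 0 ω) (T * B.D)).2 T) := by
  refine LinearMap.ext fun σ => ?_
  rw [Simulator.channel, LinearMap.comp_apply, LinearMap.comp_apply,
    run_initial B g ι hT Q hN hN0 le_rfl, turn_last, LinearMap.id_apply, map_sum,
    LinearMap.sum_apply]
  refine Finset.sum_congr rfl fun ω _ => ?_
  have hprod : ∏ i ∈ Finset.range (T * B.D), eventProb p (extend 0 ω i) =
      ∏ i, eventProb p (ω i) := by
    rw [← Fin.prod_univ_eq_prod_range fun i => eventProb p (extend 0 ω i)]
    refine Finset.prod_congr rfl fun i _ => ?_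
    rw [extend, dif_pos i.2]
  rw [map_smul, output_stateOf B g ι hT Q hT0, LinearMap.smul_apply, hprod]

end output

/-! ### Conclusion -/

/-- The protocol is the outcome of the error-free history, so the Kraus form of outcomes applies to
it. -/
theorem isKraus_channel {N mA mB : ℕ} (dE : ℕ) (Q : NoiselessProtocol N mA mB) (hN : Even N)
    (hN0 : 0 < N) : IsKraus (Q.channel dE) := by
  rw [← partialTrace_conj_coreState (st := (0, cleanStack (N + 1))) Q hN hN0
    ⟨[], N + 1, rfl, by simp⟩]
  exact isKraus_outcome Q _

theorem eventProb_nonneg {p : ℝ} (h0 : 0 ≤ p) (h1 : p ≤ 1) (a : Fin 2 × (Fin 2 × Fin 2)) :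
    0 ≤ eventProb p a :=
  mul_nonneg (flipProb_nonneg h0 h1 _) (by norm_num)

/-- Marginalising over the outcomes of the teleportations. -/
theorem sum_prod_eventProb_mul (p : ℝ) {n : ℕ} (ψ : (Fin n → Fin 2) → ℝ) :
    ∑ ω : Fin n → Fin 2 × (Fin 2 × Fin 2), (∏ i, eventProb p (ω i)) * ψ (fun i => (ω i).1) =
      ∑ f : Fin n → Fin 2, (∏ i, flipProb p (f i)) * ψ f := by
  rw [← (Equiv.arrowProdEquivProdArrow (Fin n) (fun _ => Fin 2)
    (fun _ => Fin 2 × Fin 2)).symm.sum_comp, Fintype.sum_prod_type]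
  refine Finset.sum_congr rfl fun f _ => ?_
  simp only [Equiv.arrowProdEquivProdArrow, Equiv.coe_fn_symm_mk, eventProb,
    Finset.prod_mul_distrib, Finset.prod_const, Finset.sum_const, Finset.card_univ,
    Fintype.card_fin, Fintype.card_pi, Fintype.card_prod, nsmul_eq_mul]
  have h : ((4 : ℝ) ^ n) * (1 / 4) ^ n = 1 := by
    rw [← mul_pow]
    norm_num
  push_cast
  rw [← mul_pow, show (2 * 2 : ℝ) = 4 by norm_num]
  linear_combination (∏ i, flipProb p (f i)) * ψ f * h

section succeeds

variable {F : Type} [Field F] [DecidableEq F] {p ε : ℝ}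
variable (B : BlockCode F p ε) {g : ℕ → F} {ι : Msg → F} {N : ℕ}

/-- With few bad blocks the protocol is completed. -/
theorem progress_logAt (hg : IsTreeCode g ι (2 * (N + 1))) (ω : ℕ → Fin 2 × (Fin 2 × Fin 2))
    (h : 48 * blockErrors B (2 * (2 * (N + 1))) (fun i => (ω i).1) < 2 * (2 * (N + 1))) :
    Progress (mach (logAt B g ι ω (2 * (2 * (N + 1)) * B.D)).2 (2 * (2 * (N + 1)))).2
      (N + 1 : ℕ) := by
  have h1 := card_not_goodStep_le (B := B) hg
    (R := (logAt B g ι ω (2 * (2 * (N + 1)) * B.D)).1)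
    (h := (logAt B g ι ω (2 * (2 * (N + 1)) * B.D)).2) (f := fun i => (ω i).1)
    (fun τ hτ => logAt_sendBit hτ) (fun t ht => logAt_decision ht)
  -- With `e` bad blocks there are at most `4 e` bad steps, and `12 e < N + 1`, so `2 (N + 1) - 3 *
  -- 4 e` still exceeds `N + 1`.
  refine (progress_mach _ _).mono ?_
  push_cast
  omega

/-- The bad event depends on the noise bits only, so the outcomes of the teleportations are summed
out and the bound on block errors applies. The tree code needs depth `2 (N + 1)`, the number of
messages of each party. -/
theorem simulator_succeedsOver (h0 : 0 ≤ p) (h1 : p ≤ 1) (hε : ε * 4 ^ 48 ≤ 1)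
    (hg : IsTreeCode g ι (2 * (N + 1))) (hN : Even N) (hN0 : 0 < N) :
    (simulator B g ι (T := 2 * (2 * (N + 1))) (even_two_mul _)).SucceedsOver (bsc p) N
      (2 * (1 / 2) ^ (2 * (2 * (N + 1)))) := by
  classical
  intro mA mB dE Q
  set T := 2 * (2 * (N + 1)) with hT
  have hext : ∀ ω : Fin (T * B.D) → Fin 2 × (Fin 2 × Fin 2),
      (fun i => (extend 0 ω i).1) = extend 0 fun i => (ω i).1 := by
    intro ω
    funext i
    rw [extend, extend]
    split_ifs <;> rfl
  rw [channel_eq B g ι _ Q hN hN0 (by omega)]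
  have hsum : ∑ ω : Fin (T * B.D) → Fin 2 × (Fin 2 × Fin 2), ∏ i, eventProb p (ω i) = 1 := by
    have h := sum_prod_eventProb_mul p (n := T * B.D) (fun _ => 1)
    simp only [mul_one] at h
    rw [h, sum_prod_flipProb]
  have hgood : ∀ ω : Fin (T * B.D) → Fin 2 × (Fin 2 × Fin 2),
      ¬ T ≤ 48 * blockErrors B T (extend 0 fun i => (ω i).1) →
      outcome Q (mach (logAt B g ι (extend 0 ω) (T * B.D)).2 T) = Q.channel dE := by
    intro ω hω
    rw [not_le, ← hext] at hω
    exact partialTrace_conj_coreState Q hN hN0 (progress_logAt B hg _ hω)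
  have hbad : (∑ ω : Fin (T * B.D) → Fin 2 × (Fin 2 × Fin 2),
      if T ≤ 48 * blockErrors B T (extend 0 fun i => (ω i).1) then ∏ i, eventProb p (ω i) else 0) ≤
      (1 / 2) ^ T := by
    refine le_trans (le_of_eq ?_) (prob_blockErrors_le h0 h1 B hε T)
    rw [← sum_prod_eventProb_mul p (n := T * B.D)
      (fun f => if T ≤ 48 * blockErrors B T (extend 0 f) then 1 else 0)]
    refine Finset.sum_congr rfl fun ω _ => ?_
    rw [mul_ite, mul_one, mul_zero]
  have key := diamondNorm_sub_sum_le (isKraus_channel dE Q hN hN0)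
    (fun ω : Fin (T * B.D) → Fin 2 × (Fin 2 × Fin 2) => ∏ i, eventProb p (ω i))
    (fun ω => Finset.prod_nonneg fun i _ => eventProb_nonneg h0 h1 _) hsum
    (fun ω => outcome Q (mach (logAt B g ι (extend 0 ω) (T * B.D)).2 T))
    (fun ω => isKraus_outcome Q _)
    (fun ω => T ≤ 48 * blockErrors B T (extend 0 fun i => (ω i).1)) hgood
  exact key.trans (ENNReal.ofReal_le_ofReal (mul_le_mul_of_nonneg_left hbad (by norm_num)))

/-- One entangled pair is used per block of at least one transmission. -/
theorem simulator_entRate_le_one {T : ℕ} (hT : Even T) : (simulator B g ι hT).entRate ≤ 1 := by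
  have hD : (1 : ℝ) ≤ B.D := by exact_mod_cast B.odd_D.pos
  have hcard : Fintype.card (Fin T → Fin 2) = 2 ^ T := by simp
  rw [Simulator.entRate, hcard, min_self]
  refine div_le_one_of_le₀ ?_ ?_
  · push_cast
    rw [Real.logb_self_eq_one (by norm_num), mul_one, Real.logb_pow,
      Real.logb_self_eq_one (by norm_num), mul_one]
    exact le_mul_of_one_le_right (Nat.cast_nonneg _) hD
  · push_cast
    rw [Real.logb_self_eq_one (by norm_num)]
    positivity

theorem le_simulator_commRate {K : ℝ} (hK : 0 < K) (hp : 1 - 2 * p ≠ 0)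
    (hD : (B.D : ℝ) ≤ K / (1 - 2 * p) ^ 2) (hN0 : 0 < N) :
    (1 - 2 * p) ^ 2 / (8 * K) ≤
      (simulator B g ι (T := 2 * (2 * (N + 1))) (even_two_mul _)).commRate N := by
  have hD0 : (0 : ℝ) < B.D := by exact_mod_cast B.odd_D.pos
  have hN1 : (1 : ℝ) ≤ N := by exact_mod_cast hN0
  have hp2 : 0 < (1 - 2 * p) ^ 2 := by positivity
  rw [Simulator.commRate]
  push_cast
  rw [Real.logb_self_eq_one (by norm_num), mul_one, div_le_div_iff₀ (by positivity) (by positivity)]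
  rw [le_div_iff₀ hp2] at hD
  calc (1 - 2 * p) ^ 2 * (2 * (2 * (N + 1)) * B.D) = 4 * (N + 1) * (B.D * (1 - 2 * p) ^ 2) := by ring
    _ ≤ 4 * (N + 1) * K := by gcongr
    -- Uses `N + 1 ≤ 2 N`.
    _ ≤ N * (8 * K) := by nlinarith

end succeeds

end QSim

end

theorem mainTheorem6 :
    ∃ c l : ℝ, 0 < c ∧ 0 < l ∧
      ∀ p : ℝ, 0 ≤ p → p ≤ 1 →
      ∀ C : ℝ, QSim.capacity (QSim.bsc p) = C → 0 < C →
      ∀ N : ℕ, Even N → 0 < N →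
      ∃ S : QSim.Simulator 2,
        l * C ≤ S.commRate N ∧
        S.entRate ≤ 1 ∧
        S.SucceedsOver (QSim.bsc p) N ((2 : ℝ) ^ (-(c * N))) := by
  -- The field is fixed before `p` and `N`, so the constant `K` of the block code is absolute. The
  -- value `(1 / 4) ^ 48` of `ε` matches the exponent in the bound on block errors.
  obtain ⟨q, hq, hprime⟩ := Nat.exists_infinite_primes
    ((2 * (Fintype.card QSim.Msg * Fintype.card QSim.Msg)) ^ 2)
  have : Fact q.Prime := ⟨hprime⟩
  obtain ⟨K, hK, hcode⟩ := QSim.exists_blockCode (ZMod q) (ε := (1 / 4) ^ 48) (by positivity)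
  have hcard : Fintype.card QSim.Msg ≤ Fintype.card (ZMod q) := by
    rw [ZMod.card]
    refine le_trans ?_ hq
    have h : 0 < Fintype.card QSim.Msg := Fintype.card_pos
    generalize Fintype.card QSim.Msg = a at h
    nlinarith [Nat.mul_le_mul h h, Nat.le_mul_self a]
  obtain ⟨ι⟩ := Function.Embedding.nonempty_of_card_le hcard
  have hlog : 0 < Real.log 2 := Real.log_pos (by norm_num)
  refine ⟨1, Real.log 2 / (8 * K), one_pos, by positivity, ?_⟩
  rintro p h0 h1 C rfl hC N hN hN0
  have hcap := QSim.capacity_bsc_le h0 h1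
  -- Positive capacity excludes `p = 1 / 2`.
  have hp : 1 - 2 * p ≠ 0 := by
    intro hp
    rw [hp] at hcap
    norm_num at hcap
    linarith
  obtain ⟨B, hB⟩ := hcode p h0 h1 hp
  obtain ⟨g, hg⟩ := QSim.exists_isTreeCode ι.injective (by rwa [ZMod.card]) (2 * (N + 1))
  refine ⟨QSim.simulator B g ι (T := 2 * (2 * (N + 1))) (even_two_mul _), ?_,
    QSim.simulator_entRate_le_one B _, ?_⟩
  · refine le_trans ?_ (QSim.le_simulator_commRate B hK hp hB hN0)
    rw [le_div_iff₀ hlog] at hcap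
    rw [div_mul_eq_mul_div, mul_comm]
    gcongr
  · intro mA mB dE Q
    refine (QSim.simulator_succeedsOver B h0 h1 (by norm_num) hg hN hN0 mA mB dE Q).trans
      (ENNReal.ofReal_le_ofReal ?_)
    rw [one_mul, Real.rpow_neg (by norm_num), Real.rpow_natCast, ← inv_pow, ← one_div,
      -- One factor `1 / 2` absorbs the leading `2`, and `N` factors give the bound with `c = 1`.
      show 2 * (2 * (N + 1)) = N + (3 * N + 3) + 1 by ring, pow_succ, pow_add]
    have h3 : ((1 : ℝ) / 2) ^ (3 * N + 3) ≤ 1 := pow_le_one₀ (by norm_num) (by norm_num)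
    have h4 : (0 : ℝ) < (1 / 2) ^ N := by positivity
    nlinarith
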